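/- **Definitions.** A visibly pushdown alphabet is a finite alphabet $\Sigma=\Sigma_{\mathrm{call}}\uplus\Sigma_{\mathrm{int}}\uplus\Sigma_{\mathrm{ret}}$. The set $\Sigma^\triangle$ of well-matched words is the smallest set containing $\varepsilon$ and all $c\in\Sigma_{\mathrm{int}}$ and closed under concatenation and under $w\mapsto awb$ for $a\in\Sigma_{\mathrm{call}}$, $b\in\Sigma_{\mathrm{ret}}$. For $w\in\Sigma^*$ let $\Delta(w)$ be the number of call letters minus the number of return letters in $w$. A context is a pair $(u,v)\in\Sigma^*\times\Sigma^*$ with $uv\in\Sigma^\triangle$; it induces the map $\mathrm{ext}_{u,v}\colon\Sigma^\triangle\to\Sigma^\triangle$, $x\mapsto uxv$. A DVPA (deterministic visibly pushdown automaton) over $\Sigma$ has finite sets of states and of stack symbols, the latter containing a bottom symbol $\bot$. In each step it reads an input letter and the topmost stack symbol and changes its state; on a call letter it additionally pushes one symbol different from $\bot$, on a return letter it pops the topmost symbol (possibly $\bot$; once the stack is empty the automaton is stuck), and on an internal letter it leaves the stack unchanged. It starts in the initial state with stack $\bot$, and accepts a word if after reading it the state is final and the stack is exactly $\bot$. Its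 language $L(A)$ is contained in $\Sigma^\triangle$. An Ext-algebra $(R,O)$ consists of a monoid $R$ and a submonoid $O$ of $(R^R,\circ)$ containing all left multiplications $\lambda_r\colon x\mapsto rx$ and all right multiplications $\rho_r\colon x\mapsto xr$, $r\in R$; it is finite if $R$ is. A morphism $(\varphi,\psi)\colon(R,O)\to(S,P)$ is a pair of monoid morphisms $\varphi\colon R\to S$, $\psi\colon O\to P$ with $\psi(e)(\varphi(r))=\varphi(e(r))$, $\psi(\lambda_r)=\lambda_{\varphi(r)}$ and $\psi(\rho_r)=\rho_{\varphi(r)}$ for all $e\in O$, $r\in R$. With $\mathcal O(\Sigma^\triangle)=\{\mathrm{ext}_{u,v}\mid (u,v)\text{ a context}\}$, the pair $(\Sigma^\triangle,\mathcal O(\Sigma^\triangle))$ is an Ext-algebra. For $L\subseteq\Sigma^\triangle$ the syntactic congruence is $x\sim_L y\iff(\forall e\in\mathcal O(\Sigma^\triangle)\colon e(x)\in L\Leftrightarrow e(y)\in L)$. The syntactic Ext-algebra of $L$ is $(R_L,O_L)$, where $R_L=\Sigma^\triangle/{\sim_L}$ and $O_L$ is the set of all maps on $R_L$ induced by elements of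 $\mathcal O(\Sigma^\triangle)$; the syntactic morphism $(\varphi_L,\psi_L)\colon(\Sigma^\triangle,\mathcal O(\Sigma^\triangle))\to(R_L,O_L)$ is given by $\varphi_L(w)=[w]_{\sim_L}$ and $\psi_L(e)([w]_{\sim_L})=[e(w)]_{\sim_L}$. Let $(\varphi,\psi)\colon(\Sigma^\triangle,\mathcal O(\Sigma^\triangle))\to(R,O)$ be a morphism and $F\subseteq R$. An element $r\in R$ is $F$-reachable if $e(r)\in F$ for some $e\in O$; an element $e\in O$ is $F$-reachable if $e(r)$ is $F$-reachable for some $r\in R$. The morphism is $F$-length-synchronous if for every $F$-reachable idempotent $e\in O$ and all contexts $(u,v),(u',v')$ with $\psi(\mathrm{ext}_{u,v})=\psi(\mathrm{ext}_{u',v'})=e$ and $\Delta(u),\Delta(u')>0$ one has $|u|/|v|=|u'|/|v'|$. It is $F$-weakly-length-synchronous if under the same conditions $u=u'$ implies $|v|=|v'|$, and $v=v'$ implies $|u|=|u'|$. For $k,l\in\mathbb N$ let $\mathcal O(\Sigma^\triangle)^{k,l}=\{\mathrm{ext}_{u,v}\mid (u,v)\text{ a context},\ |u|=k,\ |v|=l\}$.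 A semigroup is aperiodic if it contains no non-trivial group; a subset of $O$ is called aperiodic if all semigroups contained in it are aperiodic. The morphism is quasi-aperiodic if $\psi(\mathcal O(\Sigma^\triangle)^{k,l})$ is aperiodic for all $k,l\in\mathbb N$. All finite objects are given to and returned by algorithms as finite tables, with respect to numberings of the finite sets involved: a DVPA by its transition tables, initial and bottom symbols and list of final states; a morphism from $(\Sigma^\triangle,\mathcal O(\Sigma^\triangle))$ into a finite Ext-algebra $(R,O)$ by $\Sigma$, the multiplication table and neutral element of $R$, the list of the value tables of the elements of $O$, the values $\varphi(c)$ for $c\in\Sigma_{\mathrm{int}}$ and the tables of $\psi(\mathrm{ext}_{a,b})$ for $a\in\Sigma_{\mathrm{call}}$, $b\in\Sigma_{\mathrm{ret}}$; a subset of a finite set by a list of its elements. **Proposition.** The following computability and decidability results hold. 1. Given a DVPA $A$, one can effectively compute the syntactic Ext-algebra of $L=L(A)$, its syntactic morphism $(\varphi_L,\psi_L)$, and $\varphi_L(L)$. 2. Given a morphism $(\varphi,\psi)\colon(\Sigma^\triangle,\mathcal O(\Sigma^\triangle))\to(R,O)$ for a visibly pushdown alphabet $\Sigma$ and a finite Ext-algebra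 $(R,O)$, the following are decidable: (a) Quasi-aperiodicity. In case $(\varphi,\psi)$ is not quasi-aperiodic, one can effectively compute $k,l\in\mathbb N$ such that $\psi(\mathcal O(\Sigma^\triangle)^{k,l})$ is not aperiodic. (b) $F$-length-synchronicity for a given $F\subseteq R$. In case $(\varphi,\psi)$ is not $F$-length-synchronous, one can effectively compute a quadruple $(k,l,k',l')\in\mathbb N_{>0}^4$ such that there exist $uv,u'v'\in\Sigma^\triangle$ and an $F$-reachable idempotent $e\in O$ with $\psi(\mathrm{ext}_{u,v})=\psi(\mathrm{ext}_{u',v'})=e$, $\Delta(u)>0$, $\Delta(u')>0$, $k=|u|$, $l=|v|$, $k'=|u'|$, $l'=|v'|$ and $\frac kl\neq\frac{k'}{l'}$. (c) $F$-weak-length-synchronicity for a given $F\subseteq R$. -/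

import Mathlib

namespace VisiblyPushdown

/-! ### Visibly pushdown alphabets, well-matched words, contexts -/

/-- A visibly pushdown alphabet: three disjoint alphabets of call, internal and return letters.
Finiteness is supplied by a `LetterNumbering`. -/
structure VPAlphabet where
  call : Type
  int : Type
  ret : Type

/-- The letters of the alphabet, i.e. the disjoint union of its three parts. -/
inductive Letter (S : VPAlphabet) where
  | call (a : S.call) : Letter S
  | int (c : S.int) : Letter S
  | ret (b : S.ret) : Letter S

/-- Words over the alphabet. -/
abbrev Word (S : VPAlphabet) := List (Letter S)

variable {S : VPAlphabet}

/-- Well-matched words. -/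
inductive WellMatched : Word S → Prop
  | nil : WellMatched []
  | int (c : S.int) : WellMatched [Letter.int c]
  | nest (a : S.call) (b : S.ret) {w : Word S} (hw : WellMatched w) :
      WellMatched (Letter.call a :: (w ++ [Letter.ret b]))
  | append {u v : Word S} (hu : WellMatched u) (hv : WellMatched v) (hu' : u ≠ []) (hv' : v ≠ []) :
      WellMatched (u ++ v)

theorem WellMatched.mul {u v : Word S} (hu : WellMatched u) (hv : WellMatched v) :
    WellMatched (u ++ v) := by
  by_cases h : u = []
  · simpa [h] using hv
  by_cases h' : v = []
  · simpa [h'] using hu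
  exact hu.append hv h h'

/-- Inserting a well-matched word into a well-matched word gives a well-matched word. -/
theorem WellMatched.insert {w x : Word S} (hw : WellMatched w) (hx : WellMatched x) :
    ∀ u v : Word S, u ++ v = w → WellMatched (u ++ x ++ v) := by
  induction hw with
  | nil =>
    intro u v h
    obtain ⟨rfl, rfl⟩ := List.append_eq_nil_iff.mp h
    simpa using hx
  | int c =>
    intro u v h
    rcases List.append_eq_singleton_iff.mp h with ⟨rfl, rfl⟩ | ⟨rfl, rfl⟩
    · simpa using hx.mul (WellMatched.int c)
    · simpa using (WellMatched.int c).mul hx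
  | @nest a b w hw ih =>
    intro u v h
    rcases u with _ | ⟨l, u⟩
    · simp only [List.nil_append] at h ⊢
      subst h
      exact hx.mul (hw.nest a b)
    · simp only [List.cons_append, List.cons.injEq] at h
      obtain ⟨rfl, h⟩ := h
      rcases List.eq_nil_or_concat v with rfl | ⟨v, l, rfl⟩
      · simp only [List.append_nil] at h ⊢
        subst h
        exact (hw.nest a b).mul hx
      · rw [List.concat_eq_append, ← List.append_assoc] at h
        obtain ⟨h1, h2⟩ := List.append_inj' h rfl
        simp only [List.cons.injEq, and_true] at h2
        subst h2
        simpa using (ih u v h1).nest a b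
  | @append s t hs ht _ _ ihs iht =>
    intro u v h
    rcases List.append_eq_append_iff.mp h with ⟨z, rfl, rfl⟩ | ⟨z, rfl, rfl⟩
    · simpa using (ihs u z rfl).mul ht
    · simpa using hs.mul (iht z v rfl)

/-- The set of well-matched words, as a type. -/
def WMWord (S : VPAlphabet) := {w : Word S // WellMatched w}

/-- The monoid of well-matched words under concatenation. -/
instance : Monoid (WMWord S) where
  mul u v := ⟨u.1 ++ v.1, u.2.mul v.2⟩
  one := ⟨[], WellMatched.nil⟩
  mul_assoc u v w := Subtype.ext (List.append_assoc u.1 v.1 w.1)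
  one_mul u := Subtype.ext (List.nil_append u.1)
  mul_one u := Subtype.ext (List.append_nil u.1)

/-- An internal letter as a well-matched word. -/
def WMWord.ofInt (c : S.int) : WMWord S := ⟨[Letter.int c], WellMatched.int c⟩

/-- The contribution of a letter to the height. -/
def Letter.height : Letter S → ℤ
  | .call _ => 1
  | .int _ => 0
  | .ret _ => -1

/-- The height `Δ(w)`: the number of call letters minus the number of return letters. -/
def height (w : Word S) : ℤ := (w.map Letter.height).sum

/-- Contexts: pairs `(u, v)` of words such that `uv` is well-matched. -/
structure Context (S : VPAlphabet) where
  u : Word S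
  v : Word S
  wm : WellMatched (u ++ v)

/-- The context `(a, b)` for a call letter `a` and a return letter `b`. -/
def Context.pair (a : S.call) (b : S.ret) : Context S where
  u := [Letter.call a]
  v := [Letter.ret b]
  wm := WellMatched.nil.nest a b

/-- The function `x ↦ u x v` on well-matched words. -/
def Context.fn (σ : Context S) : Function.End (WMWord S) :=
  fun x => ⟨σ.u ++ x.1 ++ σ.v, σ.wm.insert x.2 σ.u σ.v rfl⟩

/-! ### Ext-algebras -/

/-- Left multiplication by `r`. -/
def leftMult {R : Type} [Monoid R] (r : R) : Function.End R := fun x => r * x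

/-- Right multiplication by `r`. -/
def rightMult {R : Type} [Monoid R] (r : R) : Function.End R := fun x => x * r

/-- An Ext-algebra with underlying monoid `R`: a submonoid of the monoid of functions `R → R`
(under composition) that contains all left and right multiplications. -/
structure ExtAlgebra (R : Type) [Monoid R] where
  ops : Submonoid (Function.End R)
  left_mem : ∀ r, leftMult r ∈ ops
  right_mem : ∀ r, rightMult r ∈ ops

section ExtAlgebra

variable {R R' : Type} [Monoid R] [Monoid R']

/-- Left multiplication as an element of the second component. -/
def ExtAlgebra.left (A : ExtAlgebra R) (r : R) : A.ops := ⟨leftMult r, A.left_mem r⟩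

/-- Right multiplication as an element of the second component. -/
def ExtAlgebra.right (A : ExtAlgebra R) (r : R) : A.ops := ⟨rightMult r, A.right_mem r⟩

/-- Morphisms of Ext-algebras. -/
structure ExtHom (A : ExtAlgebra R) (B : ExtAlgebra R') where
  phi : R →* R'
  psi : A.ops →* B.ops
  psi_apply : ∀ (e : A.ops) (r : R), (psi e).1 (phi r) = phi (e.1 r)
  psi_left : ∀ r : R, psi (A.left r) = B.left (phi r)
  psi_right : ∀ r : R, psi (A.right r) = B.right (phi r)

/-- A congruence on an Ext-algebra: an equivalence relation on the monoid preserved by all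
operations. -/
structure ExtCongruence (A : ExtAlgebra R) extends Setoid R where
  ops_compat : ∀ e ∈ A.ops, ∀ x y : R, r x y → r (e x) (e y)

variable {A : ExtAlgebra R}

/-- A congruence on an Ext-algebra is in particular a monoid congruence. -/
def ExtCongruence.toCon (c : ExtCongruence A) : Con R where
  toSetoid := c.toSetoid
  mul' := fun {w x y z} h1 h2 =>
    c.toSetoid.trans (c.ops_compat _ (A.right_mem y) w x h1)
      (c.ops_compat _ (A.left_mem x) y z h2)

/-- The operation induced on the quotient by an operation. -/
def ExtCongruence.liftOp (c : ExtCongruence A) (e : A.ops) : Function.End c.toCon.Quotient :=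
  Quotient.map' e.1 (fun x y h => c.ops_compat e.1 e.2 x y h)

theorem ExtCongruence.liftOp_mk (c : ExtCongruence A) (e : A.ops) (x : R) :
    c.liftOp e (x : c.toCon.Quotient) = (e.1 x : R) := rfl

/-- The quotient of an Ext-algebra by a congruence. -/
def ExtCongruence.quotient (c : ExtCongruence A) : ExtAlgebra c.toCon.Quotient where
  ops :=
    { carrier := {e' | ∃ e ∈ A.ops, ∀ x : R, e' (x : c.toCon.Quotient) = (e x : R)}
      mul_mem' := by
        rintro e' f' ⟨e, he, h⟩ ⟨f, hf, h'⟩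
        refine ⟨e * f, A.ops.mul_mem he hf, fun x => ?_⟩
        change e' (f' _) = _
        rw [h', h]
        rfl
      one_mem' := ⟨1, A.ops.one_mem, fun _ => rfl⟩ }
  left_mem := by
    intro r
    induction r using Con.induction_on with
    | H r => exact ⟨leftMult r, A.left_mem r, fun _ => rfl⟩
  right_mem := by
    intro r
    induction r using Con.induction_on with
    | H r => exact ⟨rightMult r, A.right_mem r, fun _ => rfl⟩

/-- The quotient morphism associated to a congruence. -/
def ExtCongruence.quotientHom (c : ExtCongruence A) : ExtHom A c.quotient where
  phi := c.toCon.mk'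
  psi :=
    { toFun := fun e => ⟨c.liftOp e, e.1, e.2, fun _ => rfl⟩
      map_one' := by
        apply Subtype.ext
        funext x
        induction x using Con.induction_on with
        | H x => rfl
      map_mul' := by
        intro e f
        apply Subtype.ext
        funext x
        induction x using Con.induction_on with
        | H x => rfl }
  psi_apply := fun _ _ => rfl
  psi_left := by
    intro r
    apply Subtype.ext
    funext x
    induction x using Con.induction_on with
    | H x => rfl
  psi_right := by
    intro r
    apply Subtype.ext
    funext x
    induction x using Con.induction_on with
    | H x => rfl

end ExtAlgebra

/-- The Ext-algebra of well-matched words, whose operations are the functions `x ↦ u x v` for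
contexts `(u, v)`. -/
def wordExt (S : VPAlphabet) : ExtAlgebra (WMWord S) where
  ops :=
    { carrier := Set.range Context.fn
      mul_mem' := by
        rintro _ _ ⟨σ, rfl⟩ ⟨τ, rfl⟩
        refine ⟨⟨σ.u ++ τ.u, τ.v ++ σ.v, ?_⟩, ?_⟩
        · have := σ.wm.insert τ.wm σ.u σ.v rfl
          simpa using this
        · funext x
          apply Subtype.ext
          change (σ.u ++ τ.u) ++ x.1 ++ (τ.v ++ σ.v) = σ.u ++ (τ.u ++ x.1 ++ τ.v) ++ σ.v
          simp
      one_mem' := by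
        refine ⟨⟨[], [], WellMatched.nil⟩, ?_⟩
        funext x
        apply Subtype.ext
        change [] ++ x.1 ++ [] = x.1
        simp }
  left_mem := by
    intro r
    refine ⟨⟨r.1, [], by simpa using r.2⟩, ?_⟩
    funext x
    apply Subtype.ext
    change r.1 ++ x.1 ++ [] = r.1 ++ x.1
    simp
  right_mem := by
    intro r
    refine ⟨⟨[], r.1, r.2⟩, ?_⟩
    funext x
    apply Subtype.ext
    change [] ++ x.1 ++ r.1 = x.1 ++ r.1
    simp

/-- The operation `ext_{u,v}` for a context `(u, v)`. -/
def Context.extOp (σ : Context S) : (wordExt S).ops := ⟨σ.fn, σ, rfl⟩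

/-- The syntactic congruence of a language of well-matched words. -/
def syntacticCongruence (L : Set (Word S)) : ExtCongruence (wordExt S) where
  r := fun u v => ∀ e ∈ (wordExt S).ops, (e u).1 ∈ L ↔ (e v).1 ∈ L
  iseqv :=
    { refl := fun _ _ _ => Iff.rfl
      symm := fun h e he => (h e he).symm
      trans := fun h h' e he => (h e he).trans (h' e he) }
  ops_compat := fun e he _ _ h f hf => h (f * e) ((wordExt S).ops.mul_mem hf he)

/-- The underlying monoid `R_L` of the syntactic Ext-algebra. -/
abbrev SyntacticMonoid (L : Set (Word S)) : Type := (syntacticCongruence L).toCon.Quotient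

/-- The syntactic Ext-algebra `(R_L, O_L)`. -/
def syntacticExt (L : Set (Word S)) : ExtAlgebra (SyntacticMonoid L) :=
  (syntacticCongruence L).quotient

/-- The syntactic morphism `(φ_L, ψ_L)`. -/
def syntacticHom (L : Set (Word S)) : ExtHom (wordExt S) (syntacticExt L) :=
  (syntacticCongruence L).quotientHom

/-- The subset `φ_L(L)` of `R_L`. -/
def syntacticImage (L : Set (Word S)) : Set (SyntacticMonoid L) :=
  (syntacticHom L).phi '' {w | w.1 ∈ L}

/-! ### Deterministic visibly pushdown automata -/

/-- A DVPA with states `Q` and stack alphabet `G` (which contains the bottom symbol). A call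
letter pushes a non-bottom symbol, a return letter pops the top symbol, an internal letter
leaves the stack unchanged; in all three cases the top symbol may be read. -/
structure DVPA (S : VPAlphabet) (Q G : Type) where
  start : Q
  accept : Set Q
  bot : G
  onCall : Q → S.call → G → Q × {g : G // g ≠ bot}
  onInt : Q → S.int → G → Q
  onRet : Q → S.ret → G → Q

namespace DVPA

variable {Q G : Type} (M : DVPA S Q G)

/-- The transition function: the new state and the word replacing the top symbol. -/
def step (q : Q) : Letter S → G → Q × List G
  | .call a, g => ((M.onCall q a g).1, [(M.onCall q a g).2.1, g])
  | .int c, g => (M.onInt q c g, [g])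
  | .ret b, g => (M.onRet q b g, [])

/-- The extended transition function; the top of the stack is the head of the list. -/
def run : Q → Word S → List G → Q × List G
  | q, [], s => (q, s)
  | q, _ :: _, [] => (q, [])
  | q, a :: w, g :: s => run (M.step q a g).1 w ((M.step q a g).2 ++ s)

/-- The language accepted by a DVPA. -/
def language : Set (Word S) :=
  {w | (M.run M.start w [M.bot]).1 ∈ M.accept ∧ (M.run M.start w [M.bot]).2 = [M.bot]}

end DVPA

/-! ### Reachability, length-synchronicity, quasi-aperiodicity -/

/-- A set of contexts is length-synchronous. -/
def LengthSynchronousSet (X : Set (Context S)) : Prop :=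
  ∀ σ ∈ X, ∀ τ ∈ X, 0 < height σ.u → 0 < height τ.u →
    (σ.u.length : ℚ) / σ.v.length = (τ.u.length : ℚ) / τ.v.length

/-- A set of contexts is weakly length-synchronous. -/
def WeaklyLengthSynchronousSet (X : Set (Context S)) : Prop :=
  ∀ σ ∈ X, ∀ τ ∈ X, 0 < height σ.u → 0 < height τ.u →
    (σ.u = τ.u → σ.v.length = τ.v.length) ∧ (σ.v = τ.v → σ.u.length = τ.u.length)

/-- A set `X` contains a non-trivial group (with respect to the ambient multiplication; the
neutral element of the group need not be that of the ambient structure). -/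
def ContainsNontrivialGroup {M : Type} [Mul M] (X : Set M) : Prop :=
  ∃ H : Subsemigroup M, (H : Set M) ⊆ X ∧ (H : Set M).Nontrivial ∧
    ∃ e ∈ H, ∀ x ∈ H, e * x = x ∧ x * e = x ∧ ∃ y ∈ H, x * y = e ∧ y * x = e

/-- All semigroups contained in the set `X` are aperiodic. -/
def AperiodicSet {M : Type} [Mul M] (X : Set M) : Prop :=
  ∀ N : Subsemigroup M, (N : Set M) ⊆ X → ¬ ContainsNontrivialGroup (N : Set M)

section Properties

variable {R : Type} [Monoid R] (A : ExtAlgebra R)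

/-- `r ∈ R` is `F`-reachable. -/
def ReachableElem (F : Set R) (r : R) : Prop := ∃ e ∈ A.ops, e r ∈ F

/-- `e ∈ O` is `F`-reachable. -/
def ReachableOp (F : Set R) (e : A.ops) : Prop := ∃ r : R, ReachableElem A F (e.1 r)

variable {A} (h : ExtHom (wordExt S) A)

/-- The set of contexts `(u, v)` with `ψ(ext_{u,v}) = e`. -/
def contextsOf (e : A.ops) : Set (Context S) := {σ | h.psi σ.extOp = e}

/-- `F`-length-synchronicity of a morphism. -/
def LengthSynchronous (F : Set R) : Prop :=
  ∀ e : A.ops, IsIdempotentElem e → ReachableOp A F e → LengthSynchronousSet (contextsOf h e)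

/-- `F`-weak-length-synchronicity of a morphism. -/
def WeaklyLengthSynchronous (F : Set R) : Prop :=
  ∀ e : A.ops, IsIdempotentElem e → ReachableOp A F e →
    WeaklyLengthSynchronousSet (contextsOf h e)

/-- The image under `ψ` of the set of all `ext_{u,v}` with `|u| = k` and `|v| = l`. -/
def opsImage (k l : ℕ) : Set A.ops :=
  {e | ∃ σ : Context S, σ.u.length = k ∧ σ.v.length = l ∧ h.psi σ.extOp = e}

/-- Quasi-aperiodicity of a morphism. -/
def QuasiAperiodic : Prop := ∀ k l : ℕ, AperiodicSet (opsImage h k l)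

/-- `(k, l, k', l')` witnesses the failure of `F`-length-synchronicity. -/
def LengthWitness (F : Set R) (k l k' l' : ℕ) : Prop :=
  (0 < k ∧ 0 < l ∧ 0 < k' ∧ 0 < l') ∧
  (∃ σ τ : Context S, ∃ e : A.ops, IsIdempotentElem e ∧ ReachableOp A F e ∧
    h.psi σ.extOp = e ∧ h.psi τ.extOp = e ∧ 0 < height σ.u ∧ 0 < height τ.u ∧
    k = σ.u.length ∧ l = σ.v.length ∧ k' = τ.u.length ∧ l' = τ.v.length) ∧
  (k : ℚ) / l ≠ (k' : ℚ) / l'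

end Properties

/-! ### Finite presentations

Inputs and outputs of algorithms are finite tables of natural numbers. Elements of a finite set
`X` are referred to by their position in a numbering `Fin n ≃ X`. Algorithms are functions
between types of such tables that are computable in the sense of `Computable`. -/

/-- A numbering of the letters of a (hence finite) visibly pushdown alphabet. -/
structure LetterNumbering (S : VPAlphabet) where
  numCall : ℕ
  numInt : ℕ
  numRet : ℕ
  call : Fin numCall ≃ S.call
  int : Fin numInt ≃ S.int
  ret : Fin numRet ≃ S.ret

/-- The list `l` enumerates (in any order, possibly with repetitions) the positions of the
elements of the set `F`. -/
def ListsSet {X : Type} {n : ℕ} (e : Fin n ≃ X) (l : List ℕ) (F : Set X) : Prop :=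
  ∀ i : ℕ, i ∈ l ↔ ∃ x ∈ F, (e.symm x : ℕ) = i

/-- The value table of a function `X → X`. -/
def fnTable {X : Type} {n : ℕ} (e : Fin n ≃ X) (f : X → X) : List ℕ :=
  List.ofFn fun i => (e.symm (f (e i)) : ℕ)

/-- Raw data describing a DVPA. -/
structure DVPACode where
  numCall : ℕ
  numInt : ℕ
  numRet : ℕ
  numStates : ℕ
  numStack : ℕ
  start : ℕ
  accept : List ℕ
  bot : ℕ
  onCall : List (List (List (ℕ × ℕ)))
  onInt : List (List (List ℕ))
  onRet : List (List (List ℕ))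

/-- A `DVPACode` as a tuple. -/
def DVPACode.equiv : DVPACode ≃ ℕ × ℕ × ℕ × ℕ × ℕ × ℕ × List ℕ × ℕ ×
    List (List (List (ℕ × ℕ))) × List (List (List ℕ)) × List (List (List ℕ)) where
  toFun c := (c.numCall, c.numInt, c.numRet, c.numStates, c.numStack, c.start, c.accept, c.bot,
    c.onCall, c.onInt, c.onRet)
  invFun t := ⟨t.1, t.2.1, t.2.2.1, t.2.2.2.1, t.2.2.2.2.1, t.2.2.2.2.2.1, t.2.2.2.2.2.2.1,
    t.2.2.2.2.2.2.2.1, t.2.2.2.2.2.2.2.2.1, t.2.2.2.2.2.2.2.2.2.1, t.2.2.2.2.2.2.2.2.2.2⟩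
  left_inv _ := rfl
  right_inv _ := rfl

instance : Primcodable DVPACode := Primcodable.ofEquiv _ DVPACode.equiv

/-- The code `c` describes the DVPA `M`, with respect to numberings of its letters, states and
stack symbols. -/
structure DVPACode.Presents (c : DVPACode) {S : VPAlphabet} (N : LetterNumbering S) {Q G : Type}
    {n m : ℕ} (eQ : Fin n ≃ Q) (eG : Fin m ≃ G) (M : DVPA S Q G) : Prop where
  numCall : c.numCall = N.numCall
  numInt : c.numInt = N.numInt
  numRet : c.numRet = N.numRet
  numStates : c.numStates = n
  numStack : c.numStack = m
  start : c.start = eQ.symm M.start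
  accept : ListsSet eQ c.accept M.accept
  bot : c.bot = eG.symm M.bot
  onCall : c.onCall = List.ofFn fun q : Fin n => List.ofFn fun a => List.ofFn fun g =>
    ((eQ.symm (M.onCall (eQ q) (N.call a) (eG g)).1 : ℕ),
      (eG.symm (M.onCall (eQ q) (N.call a) (eG g)).2.1 : ℕ))
  onInt : c.onInt = List.ofFn fun q : Fin n => List.ofFn fun a => List.ofFn fun g =>
    (eQ.symm (M.onInt (eQ q) (N.int a) (eG g)) : ℕ)
  onRet : c.onRet = List.ofFn fun q : Fin n => List.ofFn fun b => List.ofFn fun g =>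
    (eQ.symm (M.onRet (eQ q) (N.ret b) (eG g)) : ℕ)

/-- Raw data describing a morphism from the Ext-algebra of well-matched words to a finite
Ext-algebra: the alphabet, the target `(R, O)` (multiplication table and neutral element of `R`,
list of the value tables of the elements of `O`), the values `φ(c)` for internal letters `c` and
the value tables of `ψ(ext_{a,b})` for call letters `a` and return letters `b`. -/
structure HomCode where
  numCall : ℕ
  numInt : ℕ
  numRet : ℕ
  size : ℕ
  one : ℕ
  mul : List (List ℕ)
  ops : List (List ℕ)
  phi : List ℕ
  psi : List (List (List ℕ))

/-- A `HomCode` as a tuple. -/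
def HomCode.equiv : HomCode ≃ ℕ × ℕ × ℕ × ℕ × ℕ × List (List ℕ) × List (List ℕ) × List ℕ ×
    List (List (List ℕ)) where
  toFun c := (c.numCall, c.numInt, c.numRet, c.size, c.one, c.mul, c.ops, c.phi, c.psi)
  invFun t := ⟨t.1, t.2.1, t.2.2.1, t.2.2.2.1, t.2.2.2.2.1, t.2.2.2.2.2.1, t.2.2.2.2.2.2.1,
    t.2.2.2.2.2.2.2.1, t.2.2.2.2.2.2.2.2⟩
  left_inv _ := rfl
  right_inv _ := rfl

instance : Primcodable HomCode := Primcodable.ofEquiv _ HomCode.equiv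

/-- The code `c` describes the Ext-algebra `A` on the monoid `R` together with the morphism `h`,
with respect to numberings of the letters and of `R`. -/
structure HomCode.Presents (c : HomCode) {S : VPAlphabet} (N : LetterNumbering S) {R : Type} [Monoid R]
    {n : ℕ} (e : Fin n ≃ R) {A : ExtAlgebra R} (h : ExtHom (wordExt S) A) : Prop where
  numCall : c.numCall = N.numCall
  numInt : c.numInt = N.numInt
  numRet : c.numRet = N.numRet
  size : c.size = n
  one : c.one = e.symm 1
  mul : c.mul = List.ofFn fun i : Fin n => List.ofFn fun j => (e.symm (e i * e j) : ℕ)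
  ops : ∀ t : List ℕ, t ∈ c.ops ↔ ∃ f ∈ A.ops, t = fnTable e f
  phi : c.phi = List.ofFn fun a => (e.symm (h.phi (WMWord.ofInt (N.int a))) : ℕ)
  psi : c.psi = List.ofFn fun a => List.ofFn fun b =>
    fnTable e (h.psi (Context.pair (N.call a) (N.ret b)).extOp).1

end VisiblyPushdown

open VisiblyPushdown

-- Everything rests on generating contexts from letters. A context arises from the contexts of
-- single letters by composition and by turning (u,v) into (uv,ε) or (ε,uv); the same works for
-- pairs of contexts that share one component, where pending calls (or returns) are split off
-- simultaneously (`mem_growAll_ctx`, `mem_growAll_pairs`). Saturation makes this effective: if each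
-- generated object carries a vector in a finite-dimensional rational space on which the operations
-- act linearly in each argument, the spans of the vectors reached in k steps increase and stay
-- constant once two successive ones agree, so as many steps as the dimension suffice
-- (`span_growSet_eq`).
--
-- Syntactic algebra: a well-matched word acts on a DVPA as a map Q → G → Q, and words with equal
-- action are syntactically equivalent, so the size of R_L is bounded explicitly. Saturation with
-- one basis vector per operation gives a finite list of contexts realising all of O_L
-- (`exists_growSet_ctxOp`). Membership tests under these contexts decide the congruence
-- (`codeEqv_iff`), and their words meet every class.
--
-- Length-synchronicity: a pair of contexts gets the vector (1, lengths) placed at the index formed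
-- by the sign of Δ(u) and the two operations. Composition acts affinely on lengths, hence linearly
-- after homogenisation. A linear condition on lengths that holds for all short pairs of a given
-- index therefore holds for all pairs of that index (`functional_eq_zero`). Equality of ratios and
-- equality of lengths are such conditions, so violations already occur among short pairs
-- (`exists_syncFailsAt`, `exists_weakWitness`).
--
-- Quasi-aperiodicity: it fails exactly if some g with g^(ω+1) = g ≠ g^ω has g and g^ω realised by
-- contexts of the same lengths, a collision (`not_aperiodicSet_opsImage`, `exists_pow_opExponent`).
-- Collisions can be enumerated. Their absence has a finite certificate: the length vectors of g^ω
-- and of g lie in different cosets of a subgroup of ℤ², and some modulus still separates them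
-- (`exists_separating_modulus`); the reductions of all data modulo a common multiple then form a
-- finite closed collision-free set (`exists_isInvariant`). Searching for a collision or a
-- certificate always terminates.

attribute [fun_prop] Primrec
attribute [fun_prop] Primrec.id Primrec.const Primrec.comp Primrec.pair Primrec.fst Primrec.snd

namespace VisiblyPushdown

/-! ### Primitive recursive functions in composed form -/

section Primrec

variable {α β γ σ : Type} [Primcodable α] [Primcodable β] [Primcodable γ] [Primcodable σ]

-- These closure rules are stated for functions of an arbitrary parameter, with functional arguments
-- primitive recursive jointly in parameter and element. In this form `fun_prop` can follow the term
-- of an algorithm.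
@[fun_prop]
theorem primrec_fst {f : α → β × γ} (hf : Primrec f) : Primrec fun a => (f a).1 :=
  Primrec.fst.comp hf

@[fun_prop]
theorem primrec_snd {f : α → β × γ} (hf : Primrec f) : Primrec fun a => (f a).2 :=
  Primrec.snd.comp hf

@[fun_prop]
theorem primrec_add {f g : α → ℕ} (hf : Primrec f) (hg : Primrec g) :
    Primrec fun a => f a + g a := Primrec.nat_add.comp hf hg

@[fun_prop]
theorem primrec_mul {f g : α → ℕ} (hf : Primrec f) (hg : Primrec g) :
    Primrec fun a => f a * g a := Primrec.nat_mul.comp hf hg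

@[fun_prop]
theorem primrec_mod {f g : α → ℕ} (hf : Primrec f) (hg : Primrec g) :
    Primrec fun a => f a % g a := Primrec.nat_mod.comp hf hg

@[fun_prop]
theorem primrec_pow {f g : α → ℕ} (hf : Primrec f) (hg : Primrec g) :
    Primrec fun a => f a ^ g a :=
  (Primrec₂.unpaired'.1 Nat.Primrec.pow : Primrec₂ fun a b : ℕ => a ^ b).comp hf hg

@[fun_prop]
theorem primrec_factorial {f : α → ℕ} (hf : Primrec f) : Primrec fun a => (f a).factorial := by
  have : Primrec fun n : ℕ => n.factorial := by
    refine (Primrec.nat_rec₁ (f := fun n r => (n + 1) * r) 1 ?_).of_eq fun n => ?_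
    · exact Primrec₂.mk (by fun_prop)
    · induction n with
      | zero => rfl
      | succ n ih => rw [Nat.factorial_succ, ← ih]
  exact this.comp hf

@[fun_prop]
theorem primrec_list_map {f : α → List β} {g : α → β → σ} (hf : Primrec f)
    (hg : Primrec fun p : α × β => g p.1 p.2) : Primrec fun a => (f a).map (g a) :=
  Primrec.list_map hf hg

@[fun_prop]
theorem primrec_list_flatMap {f : α → List β} {g : α → β → List σ} (hf : Primrec f)
    (hg : Primrec fun p : α × β => g p.1 p.2) : Primrec fun a => (f a).flatMap (g a) :=
  Primrec.list_flatMap hf hg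

@[fun_prop]
theorem primrec_list_foldl {f : α → List β} {g : α → σ} {h : α → σ → β → σ} (hf : Primrec f)
    (hg : Primrec g) (hh : Primrec fun p : α × σ × β => h p.1 p.2.1 p.2.2) :
    Primrec fun a => (f a).foldl (h a) (g a) :=
  Primrec.list_foldl hf hg (h := fun a p => h a p.1 p.2) hh

@[fun_prop]
theorem primrec_list_append {f g : α → List β} (hf : Primrec f) (hg : Primrec g) :
    Primrec fun a => f a ++ g a := Primrec.list_append.comp hf hg

@[fun_prop]
theorem primrec_list_cons {f : α → β} {g : α → List β} (hf : Primrec f) (hg : Primrec g) :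
    Primrec fun a => f a :: g a := Primrec.list_cons.comp hf hg

@[fun_prop]
theorem primrec_list_range {f : α → ℕ} (hf : Primrec f) : Primrec fun a => List.range (f a) :=
  Primrec.list_range.comp hf

@[fun_prop]
theorem primrec_list_length {f : α → List β} (hf : Primrec f) : Primrec fun a => (f a).length :=
  Primrec.list_length.comp hf

@[fun_prop]
theorem primrec_list_getD {f : α → List β} {g : α → ℕ} {d : β} (hf : Primrec f) (hg : Primrec g) :
    Primrec fun a => (f a).getD (g a) d := (Primrec.list_getD d).comp hf hg

@[fun_prop]
theorem primrec_list_findIdx {f : α → List β} {p : α → β → Bool} (hf : Primrec f)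
    (hp : Primrec fun q : α × β => p q.1 q.2) : Primrec fun a => (f a).findIdx (p a) :=
  Primrec.list_findIdx hf hp

@[fun_prop]
theorem primrec_and {f g : α → Bool} (hf : Primrec f) (hg : Primrec g) :
    Primrec fun a => f a && g a := Primrec.and.comp hf hg

@[fun_prop]
theorem primrec_or {f g : α → Bool} (hf : Primrec f) (hg : Primrec g) :
    Primrec fun a => f a || g a := Primrec.or.comp hf hg

@[fun_prop]
theorem primrec_not {f : α → Bool} (hf : Primrec f) : Primrec fun a => !(f a) :=
  Primrec.not.comp hf

@[fun_prop]
theorem primrec_decide_eq [DecidableEq β] {f g : α → β} (hf : Primrec f) (hg : Primrec g) :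
    Primrec fun a => decide (f a = g a) := Primrec.eq.decide.comp hf hg

@[fun_prop]
theorem primrec_cond {c : α → Bool} {f g : α → σ} (hc : Primrec c) (hf : Primrec f)
    (hg : Primrec g) : Primrec fun a => bif c a then f a else g a := Primrec.cond hc hf hg

@[fun_prop]
theorem primrec_list_any {f : α → List β} {p : α → β → Bool} (hf : Primrec f)
    (hp : Primrec fun q : α × β => p q.1 q.2) : Primrec fun a => (f a).any (p a) := by
  have : Primrec fun a => (f a).foldl (fun r b => r || p a b) false := by fun_prop
  refine this.of_eq fun a => ?_
  have key : ∀ (l : List β) (r : Bool), l.foldl (fun r b => r || p a b) r = (r || l.any (p a)) := by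
    intro l
    induction l with
    | nil => simp
    | cons b l ih => intro r; simp [ih, Bool.or_assoc]
  simp [key]

@[fun_prop]
theorem primrec_list_all {f : α → List β} {p : α → β → Bool} (hf : Primrec f)
    (hp : Primrec fun q : α × β => p q.1 q.2) : Primrec fun a => (f a).all (p a) := by
  have : Primrec fun a => !((f a).any fun b => !(p a b)) := by fun_prop
  refine this.of_eq fun a => ?_
  simp [List.any_eq_not_all_not]

@[fun_prop]
theorem primrec_list_filter {f : α → List β} {p : α → β → Bool} (hf : Primrec f)
    (hp : Primrec fun q : α × β => p q.1 q.2) : Primrec fun a => (f a).filter (p a) := by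
  have : Primrec fun a => (f a).flatMap fun b => bif p a b then [b] else [] := by fun_prop
  refine this.of_eq fun a => ?_
  induction f a with
  | nil => rfl
  | cons b l ih =>
    rw [List.flatMap_cons, ih, List.filter_cons]
    cases p a b <;> simp

@[fun_prop]
theorem primrec_iterate {f : α → ℕ} {g : α → β} {h : α → β → β} (hf : Primrec f)
    (hg : Primrec g) (hh : Primrec fun p : α × β => h p.1 p.2) :
    Primrec fun a => (h a)^[f a] (g a) := Primrec.nat_iterate hf hg hh

@[fun_prop]
theorem primrec_list_casesOn {f : α → List β} {g : α → σ} {h : α → β → List β → σ}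
    (hf : Primrec f) (hg : Primrec g) (hh : Primrec fun p : α × β × List β => h p.1 p.2.1 p.2.2) :
    Primrec fun a => (f a).casesOn (motive := fun _ => σ) (g a) (h a) :=
  Primrec.list_casesOn hf hg (h := fun a p => h a p.1 p.2) hh

end Primrec

/-! ### Unbounded search -/

/-- A decidable relation that is total has a computable choice function. -/
theorem exists_computable_choice {α β : Type} [Primcodable α] [Primcodable β] [Inhabited β]
    {r : α → β → Bool} (hr : Computable₂ r) (h : ∀ a, ∃ b, r a b = true) :
    ∃ f : α → β, Computable f ∧ ∀ a, r a (f a) = true := by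
  classical
  let t : α → ℕ → Option β := fun a n =>
    (Encodable.decode n : Option β).bind fun b => bif r a b then some b else none
  have ht : Computable₂ t := by
    refine Computable.option_bind (Computable.decode.comp Computable.snd) ?_
    refine Computable.cond (hr.comp (Computable.fst.comp Computable.fst) Computable.snd)
      (Computable.option_some.comp Computable.snd) (Computable.const none)
  have hs : ∀ a b n, b ∈ t a n → r a b = true := by
    intro a b n hb
    simp only [t, Option.mem_def, Option.bind_eq_some_iff] at hb
    obtain ⟨b', -, hb'⟩ := hb
    cases hrb : r a b' <;> simp [hrb] at hb'
    rwa [← hb']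
  have hd : ∀ a, (Nat.rfindOpt (t a)).Dom := by
    intro a
    obtain ⟨b, hb⟩ := h a
    exact Nat.rfindOpt_dom.2 ⟨Encodable.encode b, b, by simp [t, hb]⟩
  refine ⟨fun a => (Nat.rfindOpt (t a)).get (hd a), ?_, fun a => ?_⟩
  · exact (Partrec.rfindOpt ht).of_eq_tot fun a => Part.get_mem (hd a)
  · obtain ⟨n, hn⟩ := Nat.rfindOpt_spec (Part.get_mem (hd a))
    exact hs a _ n hn

/-! ### Iterated closure under operations -/

section Grow

/-- The list `l` is enlarged `k` times by the results of the operations on pairs of members. -/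
def growList {J : Type} (ops : J → J → List J) (k : ℕ) (l : List J) : List J :=
  (fun l => l ++ l.flatMap fun x => l.flatMap fun y => ops x y)^[k] l

/-- The set `A` is enlarged `k` times by the results of the operations on pairs of members. -/
def growSet {I : Type} (ops : I → I → List I) (A : Set I) : ℕ → Set I
  | 0 => A
  | k + 1 => growSet ops A k ∪ {z | ∃ x ∈ growSet ops A k, ∃ y ∈ growSet ops A k, z ∈ ops x y}

@[fun_prop]
theorem primrec_growList {α J : Type} [Primcodable α] [Primcodable J] {ops : α → J → J → List J}
    {k : α → ℕ} {l : α → List J} (hops : Primrec fun p : α × J × J => ops p.1 p.2.1 p.2.2)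
    (hk : Primrec k) (hl : Primrec l) : Primrec fun a => growList (ops a) (k a) (l a) := by
  unfold growList
  fun_prop

variable {I J : Type} {ops : I → I → List I} {A : Set I}

theorem growSet_mono {k l : ℕ} (h : k ≤ l) : growSet ops A k ⊆ growSet ops A l := by
  induction h with
  | refl => exact le_rfl
  | step _ ih => exact ih.trans Set.subset_union_left

/-- The elements obtained after any number of steps. -/
def growAll (ops : I → I → List I) (A : Set I) : Set I := ⋃ k, growSet ops A k

theorem mem_growAll {x : I} : x ∈ growAll ops A ↔ ∃ k, x ∈ growSet ops A k := Set.mem_iUnion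

theorem growAll_base {x : I} (hx : x ∈ A) : x ∈ growAll ops A := mem_growAll.2 ⟨0, hx⟩

theorem growAll_ops {x y z : I} (hx : x ∈ growAll ops A) (hy : y ∈ growAll ops A)
    (hz : z ∈ ops x y) : z ∈ growAll ops A := by
  obtain ⟨k, hk⟩ := mem_growAll.1 hx
  obtain ⟨l, hl⟩ := mem_growAll.1 hy
  exact mem_growAll.2 ⟨max k l + 1, Or.inr ⟨x, growSet_mono (le_max_left k l) hk, y,
    growSet_mono (le_max_right k l) hl, hz⟩⟩

theorem growAll_induction {P : I → Prop} (base : ∀ x ∈ A, P x)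
    (step : ∀ x y z, P x → P y → z ∈ ops x y → P z) {x : I} (hx : x ∈ growAll ops A) : P x := by
  obtain ⟨k, hk⟩ := mem_growAll.1 hx
  induction k generalizing x with
  | zero => exact base x hk
  | succ k ih =>
    rcases hk with hk | ⟨a, ha, b, hb, hz⟩
    · exact ih (mem_growAll.2 ⟨k, hk⟩) hk
    · exact step a b x (ih (mem_growAll.2 ⟨k, ha⟩) ha) (ih (mem_growAll.2 ⟨k, hb⟩) hb) hz

/-- Closure commutes with an encoding that is compatible with the operations. -/
theorem mem_growList_iff {E : I → J} {opsJ : J → J → List J} {l : List J}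
    (hops : ∀ x y, opsJ (E x) (E y) = (ops x y).map E) (hl : ∀ z, z ∈ l ↔ ∃ x ∈ A, z = E x)
    (k : ℕ) (z : J) : z ∈ growList opsJ k l ↔ ∃ x ∈ growSet ops A k, z = E x := by
  induction k generalizing z with
  | zero => exact hl z
  | succ k ih =>
    rw [growList, Function.iterate_succ_apply', ← growList]
    simp only [List.mem_append, List.mem_flatMap, ih]
    constructor
    · rintro (⟨x, hx, rfl⟩ | ⟨_, ⟨x, hx, rfl⟩, _, ⟨y, hy, rfl⟩, hz⟩)
      · exact ⟨x, Or.inl hx, rfl⟩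
      · rw [hops, List.mem_map] at hz
        obtain ⟨z, hz, rfl⟩ := hz
        exact ⟨z, Or.inr ⟨x, hx, y, hy, hz⟩, rfl⟩
    · rintro ⟨z, hz | ⟨x, hx, y, hy, hz⟩, rfl⟩
      · exact Or.inl ⟨z, hz, rfl⟩
      · exact Or.inr ⟨_, ⟨x, hx, rfl⟩, _, ⟨y, hy, rfl⟩, by rw [hops]; exact List.mem_map_of_mem hz⟩

end Grow

/-! ### Saturation -/

section Saturation

variable {I W : Type} [AddCommGroup W] [Module ℚ W]

/-- If all operations are separately linear with respect to a map into a finite-dimensional space,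
then the span of the image is reached after `finrank` many steps. -/
theorem span_growSet_eq [Module.Finite ℚ W] {ops : I → I → List I} {A : Set I} (Φ : I → W)
    (hl : ∀ x y, ∀ z ∈ ops x y, ∃ α β : W →ₗ[ℚ] W, α (Φ x) = Φ z ∧ β (Φ y) = Φ z ∧
      (∀ x', ∃ z' ∈ ops x' y, α (Φ x') = Φ z') ∧ (∀ y', ∃ z' ∈ ops x y', β (Φ y') = Φ z'))
    {B : ℕ} (hB : Module.finrank ℚ W ≤ B) {x : I} (hx : x ∈ growAll ops A) :
    Φ x ∈ Submodule.span ℚ (Φ '' growSet ops A B) := by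
  set S : ℕ → Submodule ℚ W := fun k => Submodule.span ℚ (Φ '' growSet ops A k) with hS
  have mono : Monotone S := fun k l h => Submodule.span_mono (Set.image_mono (growSet_mono h))
  -- The vector of a new element is α (Φ x), and Φ x already lies in the span of stage k, so x may
  -- be replaced by members of stage k. The same is then done for y, with a map β belonging to the
  -- replaced x. The results lie in stage k + 1.
  have next : ∀ k, S k = S (k + 1) → S (k + 1) = S (k + 2) := by
    intro k hk
    refine le_antisymm (mono (Nat.le_succ _)) (Submodule.span_le.2 ?_)
    rintro _ ⟨z, hz | ⟨x, hx, y, hy, hz⟩, rfl⟩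
    · exact Submodule.subset_span ⟨z, hz, rfl⟩
    have hx' : Φ x ∈ S k := hk ▸ Submodule.subset_span ⟨x, hx, rfl⟩
    have hy' : Φ y ∈ S k := hk ▸ Submodule.subset_span ⟨y, hy, rfl⟩
    obtain ⟨α, -, hα, -, hα', -⟩ := hl x y z hz
    rw [← hα]
    refine (Submodule.span_le (p := (S (k + 1)).comap α)).2 ?_ hx'
    rintro _ ⟨x', hx', rfl⟩
    obtain ⟨z', hz', e⟩ := hα' x'
    obtain ⟨-, β, -, hβ, -, hβ'⟩ := hl x' y z' hz'
    change α (Φ x') ∈ S (k + 1)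
    rw [e, ← hβ]
    refine (Submodule.span_le (p := (S (k + 1)).comap β)).2 ?_ hy'
    rintro _ ⟨y', hy', rfl⟩
    obtain ⟨z'', hz'', e'⟩ := hβ' y'
    change β (Φ y') ∈ S (k + 1)
    rw [e']
    exact Submodule.subset_span ⟨z'', Or.inr ⟨x', hx', y', hy', hz''⟩, rfl⟩
  have stable : ∀ k, S k = S (k + 1) → ∀ l, k ≤ l → S l = S k := by
    intro k hk l hkl
    have : ∀ j, S (k + j) = S (k + j + 1) := by
      intro j
      induction j with
      | zero => exact hk
      | succ j ih => exact next _ ih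
    obtain ⟨j, rfl⟩ := Nat.exists_eq_add_of_le hkl
    clear hkl
    induction j with
    | zero => rfl
    | succ j ih => exact (this j).symm.trans ih
  -- Otherwise the dimension would rise strictly B + 1 times and exceed that of W.
  obtain ⟨k, hk, hkB⟩ : ∃ k, S k = S (k + 1) ∧ k ≤ B := by
    by_contra! hne
    have grow : ∀ k, k ≤ B + 1 → k ≤ Module.finrank ℚ (S k) := by
      intro k
      induction k with
      | zero => simp
      | succ k ih =>
        intro hkB
        have hlt : S k < S (k + 1) :=
          lt_of_le_of_ne (mono (Nat.le_succ k)) fun h => absurd (hne k h) (by omega)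
        have := Submodule.finrank_lt_finrank_of_lt hlt
        have := ih (by omega)
        omega
    have h1 := grow (B + 1) le_rfl
    have h2 := Submodule.finrank_le (S (B + 1))
    omega
  obtain ⟨l, hl⟩ := mem_growAll.1 hx
  have : Φ x ∈ S (max k l) := Submodule.subset_span ⟨x, growSet_mono (le_max_right k l) hl, rfl⟩
  rw [stable k hk _ (le_max_left k l)] at this
  exact mono hkB this

/-- A linear map on finitely supported functions that acts on the indices and the values. -/
theorem exists_linearMap_single {X V : Type} [AddCommGroup V] [Module ℚ V] (o : X → X)
    (b : V →ₗ[ℚ] V) : ∃ α : (X →₀ V) →ₗ[ℚ] (X →₀ V),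
      ∀ x v, α (Finsupp.single x v) = Finsupp.single (o x) (b v) :=
  ⟨Finsupp.lmapDomain V ℚ o ∘ₗ Finsupp.mapRange.linearMap b, fun x v => by simp⟩

end Saturation

variable {S : VPAlphabet}

/-! ### Heights and decompositions of contexts -/

@[simp]
theorem height_nil : height ([] : Word S) = 0 := rfl

@[simp]
theorem height_cons (a : Letter S) (w : Word S) : height (a :: w) = a.height + height w := by
  simp [height]

@[simp]
theorem height_append (u v : Word S) : height (u ++ v) = height u + height v := by
  simp [height]

theorem WellMatched.height_eq_zero {w : Word S} (hw : WellMatched w) : height w = 0 := by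
  induction hw with
  | nil => rfl
  | int c => rfl
  | nest a b _ ih => simp [ih, Letter.height]
  | append _ _ _ _ ihu ihv => simp [ihu, ihv]

/-- Either both parts of a context are well-matched, or the first pending call letter and its
matching return letter can be split off. -/
theorem WellMatched.split {t : Word S} (ht : WellMatched t) : ∀ u v : Word S, u ++ v = t →
    (WellMatched u ∧ WellMatched v) ∨ ∃ w a u' v' b x, u = w ++ Letter.call a :: u' ∧
      v = v' ++ Letter.ret b :: x ∧ WellMatched w ∧ WellMatched x ∧ WellMatched (u' ++ v') := by
  induction ht with
  | nil =>
    intro u v h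
    obtain ⟨rfl, rfl⟩ := List.append_eq_nil_iff.mp h
    exact Or.inl ⟨.nil, .nil⟩
  | int c =>
    intro u v h
    rcases List.append_eq_singleton_iff.mp h with ⟨rfl, rfl⟩ | ⟨rfl, rfl⟩
    · exact Or.inl ⟨.nil, .int c⟩
    · exact Or.inl ⟨.int c, .nil⟩
  | @nest a b w hw ih =>
    intro u v h
    rcases u with _ | ⟨l, u⟩
    · simp only [List.nil_append] at h
      subst h
      exact Or.inl ⟨.nil, hw.nest a b⟩
    · simp only [List.cons_append, List.cons.injEq] at h
      obtain ⟨rfl, h⟩ := h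
      rcases List.eq_nil_or_concat v with rfl | ⟨v, l, rfl⟩
      · simp only [List.append_nil] at h
        subst h
        exact Or.inl ⟨hw.nest a b, .nil⟩
      · rw [List.concat_eq_append, ← List.append_assoc] at h
        obtain ⟨h1, h2⟩ := List.append_inj' h rfl
        simp only [List.cons.injEq, and_true] at h2
        subst h2
        refine Or.inr ⟨[], a, u, v, b, [], by simp, by simp, .nil, .nil, ?_⟩
        rwa [h1]
  | @append s t hs ht _ _ ihs iht =>
    intro u v h
    rcases List.append_eq_append_iff.mp h with ⟨z, rfl, rfl⟩ | ⟨z, rfl, rfl⟩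
    · rcases ihs u z rfl with ⟨h1, h2⟩ | ⟨w, a, u', v', b, x, rfl, rfl, h3, h4, h5⟩
      · exact Or.inl ⟨h1, h2.mul ht⟩
      · exact Or.inr ⟨w, a, u', v', b, x ++ t, rfl, by simp, h3, h4.mul ht, h5⟩
    · rcases iht z v rfl with ⟨h1, h2⟩ | ⟨w, a, u', v', b, x, rfl, rfl, h3, h4, h5⟩
      · exact Or.inl ⟨hs.mul h1, h2⟩
      · exact Or.inr ⟨s ++ w, a, u', v', b, x, by simp, rfl, hs.mul h3, h4, h5⟩

/-- Splitting off well-matched blocks changes nothing, and every pending call letter of u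
contributes 1; the recursion is on the shorter word behind the first pending call. -/
theorem WellMatched.height_nonneg {u v : Word S} (h : WellMatched (u ++ v)) : 0 ≤ height u := by
  rcases h.split u v rfl with ⟨h1, -⟩ | ⟨w, a, u', v', b, x, hu, -, h3, h4, h5⟩
  · exact h1.height_eq_zero.ge
  · have : u'.length < u.length := by simp [hu]; omega
    have := h5.height_nonneg
    simp only [hu, height_append, h3.height_eq_zero, height_cons, Letter.height]
    omega
termination_by u.length

theorem Context.height_nonneg (σ : Context S) : 0 ≤ height σ.u := σ.wm.height_nonneg

theorem Context.height_v (σ : Context S) : height σ.v = -height σ.u := by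
  have := σ.wm.height_eq_zero
  rw [height_append] at this
  omega

theorem Context.length_u_pos {σ : Context S} (h : 0 < height σ.u) : 0 < σ.u.length := by
  rcases hu : σ.u with _ | ⟨a, u⟩
  · simp [hu] at h
  · simp

theorem Context.length_v_pos {σ : Context S} (h : 0 < height σ.u) : 0 < σ.v.length := by
  have hv := σ.height_v
  rcases hu : σ.v with _ | ⟨a, u⟩
  · simp [hu] at hv
    omega
  · simp

/-- Pairs of contexts `(u, v)`, `(u, v')` with the same first component, generated by splitting
off the pending call letters of `u`. -/
inductive SameLeft : Word S → Word S → Word S → Prop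
  | base {w v v' : Word S} (hw : WellMatched w) (hv : WellMatched v) (hv' : WellMatched v') :
      SameLeft w v v'
  | nest {w u v v' x x' : Word S} (a : S.call) (b b' : S.ret) (hw : WellMatched w)
      (hx : WellMatched x) (hx' : WellMatched x') (h : SameLeft u v v') :
      SameLeft (w ++ Letter.call a :: u) (v ++ Letter.ret b :: x) (v' ++ Letter.ret b' :: x')

/-- The position of the first pending call in u is determined by u alone, so splitting with v and
with v' peels off the same prefix. The mixed cases are impossible: u would have height zero and
positive height. -/
theorem SameLeft.of_wellMatched {u v v' : Word S} (h : WellMatched (u ++ v))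
    (h' : WellMatched (u ++ v')) : SameLeft u v v' := by
  rcases h.split u v rfl with ⟨h1, h2⟩ | ⟨w, a, u₁, v₁, b, x, hu, rfl, h3, h4, h5⟩ <;>
    rcases h'.split u v' rfl with ⟨h1', h2'⟩ | ⟨w', a', u₁', v₁', b', x', hu', rfl, h3', h4', h5'⟩
  · exact .base h1 h2 h2'
  · exfalso
    have := h1.height_eq_zero
    have := h5'.height_nonneg
    simp only [hu', height_append, h3'.height_eq_zero, height_cons, Letter.height] at *
    omega
  · exfalso
    have := h1'.height_eq_zero
    have := h5.height_nonneg
    simp only [hu, height_append, h3.height_eq_zero, height_cons, Letter.height] at *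
    omega
  -- If w' were longer than w, it would consist of w, the call letter and a prefix of u₁. That
  -- prefix has nonnegative height, so w' would have positive height.
  · have key : ∀ {w w' u₁ u₁' v₁ : Word S} {a a' : S.call}, WellMatched w → WellMatched w' →
        WellMatched (u₁ ++ v₁) → w ++ Letter.call a :: u₁ = w' ++ Letter.call a' :: u₁' →
        w'.length ≤ w.length := by
      intro w w' u₁ u₁' v₁ a a' hw hw' h₁ e
      rcases List.append_eq_append_iff.mp e with ⟨z, rfl, hz⟩ | ⟨z, rfl, hz⟩
      · rcases z with _ | ⟨c, z⟩
        · simp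
        · simp only [List.cons_append, List.cons.injEq] at hz
          obtain ⟨rfl, rfl⟩ := hz
          have e1 := hw'.height_eq_zero
          rw [List.append_assoc] at h₁
          have e2 := h₁.height_nonneg
          simp only [height_append, hw.height_eq_zero, height_cons, Letter.height] at e1
          omega
      · simp
    have e : w ++ Letter.call a :: u₁ = w' ++ Letter.call a' :: u₁' := hu ▸ hu'
    have hlen : w.length = w'.length :=
      le_antisymm (key h3' h3 h5' e.symm) (key h3 h3' h5 e)
    obtain ⟨rfl, e2⟩ := List.append_inj e hlen
    simp only [List.cons.injEq, Letter.call.injEq] at e2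
    obtain ⟨rfl, rfl⟩ := e2
    rw [hu]
    have : u₁.length < u.length := by simp [hu]; omega
    exact .nest a b b' h3 h4 h4' (SameLeft.of_wellMatched h5 h5')
termination_by u.length

/-- Pairs of contexts `(u, v)`, `(u', v)` with the same second component, generated by splitting
off the pending return letters of `v`. -/
inductive SameRight : Word S → Word S → Word S → Prop
  | base {w u u' : Word S} (hw : WellMatched w) (hu : WellMatched u) (hu' : WellMatched u') :
      SameRight w u u'
  | nest {w v u u' x x' : Word S} (b : S.ret) (a a' : S.call) (hw : WellMatched w)
      (hx : WellMatched x) (hx' : WellMatched x') (h : SameRight v u u') :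
      SameRight (v ++ Letter.ret b :: w) (x ++ Letter.call a :: u) (x' ++ Letter.call a' :: u')

/-- The alphabet with call and return letters exchanged. -/
def VPAlphabet.mirror (S : VPAlphabet) : VPAlphabet := ⟨S.ret, S.int, S.call⟩

/-- A letter as a letter of the mirrored alphabet. -/
def Letter.mirror : Letter S → Letter S.mirror
  | .call a => .ret a
  | .int c => .int c
  | .ret b => .call b

/-- The reversed word over the mirrored alphabet. -/
def mirrorWord (w : Word S) : Word S.mirror := w.reverse.map Letter.mirror

@[simp]
theorem mirrorWord_nil : mirrorWord ([] : Word S) = [] := rfl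

@[simp]
theorem mirrorWord_cons (a : Letter S) (w : Word S) :
    mirrorWord (a :: w) = mirrorWord w ++ [a.mirror] := by simp [mirrorWord]

@[simp]
theorem mirrorWord_append (u v : Word S) :
    mirrorWord (u ++ v) = mirrorWord v ++ mirrorWord u := by simp [mirrorWord]

theorem mirrorWord_mirrorWord (w : Word S) : mirrorWord (mirrorWord w) = w := by
  induction w with
  | nil => rfl
  | cons a w ih =>
    rw [mirrorWord_cons, mirrorWord_append, ih]
    cases a <;> rfl

theorem WellMatched.mirror {w : Word S} (hw : WellMatched w) : WellMatched (mirrorWord w) := by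
  induction hw with
  | nil => exact .nil
  | int c => exact .int (S := S.mirror) c
  | nest a b _ ih => simpa [Letter.mirror] using WellMatched.nest (S := S.mirror) b a ih
  | append _ _ _ _ ihu ihv => simpa using ihv.mul ihu

theorem SameLeft.mirror {w v v' : Word S} (h : SameLeft w v v') :
    SameRight (mirrorWord w) (mirrorWord v) (mirrorWord v') := by
  induction h with
  | base hw hv hv' => exact .base hw.mirror hv.mirror hv'.mirror
  | nest a b b' hw hx hx' _ ih =>
    simpa [Letter.mirror] using SameRight.nest (S := S.mirror) a b b' hw.mirror hx.mirror hx'.mirror ih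

/-- Reversal with calls and returns exchanged turns a common second component into a common first
one. -/
theorem SameRight.of_wellMatched {v u u' : Word S} (h : WellMatched (u ++ v))
    (h' : WellMatched (u' ++ v)) : SameRight v u u' := by
  have h1 := h.mirror
  have h2 := h'.mirror
  rw [mirrorWord_append] at h1 h2
  have := (SameLeft.of_wellMatched h1 h2).mirror
  rwa [mirrorWord_mirrorWord, mirrorWord_mirrorWord, mirrorWord_mirrorWord] at this

/-! ### Operations on contexts -/

namespace Context

@[ext]
theorem ext {σ τ : Context S} (hu : σ.u = τ.u) (hv : σ.v = τ.v) : σ = τ := by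
  cases σ; cases τ; cases hu; cases hv; rfl

/-- The context whose operation is the composition. -/
def mul (σ τ : Context S) : Context S where
  u := σ.u ++ τ.u
  v := τ.v ++ σ.v
  wm := by simpa using σ.wm.insert τ.wm σ.u σ.v rfl

/-- The well-matched word `u v`. -/
def word (σ : Context S) : WMWord S := ⟨σ.u ++ σ.v, σ.wm⟩

/-- The context `(w, ε)`. -/
def ofLeft (w : WMWord S) : Context S := ⟨w.1, [], by simpa using w.2⟩

/-- The context `(ε, w)`. -/
def ofRight (w : WMWord S) : Context S := ⟨[], w.1, w.2⟩

theorem extOp_mul (σ τ : Context S) : (σ.mul τ).extOp = σ.extOp * τ.extOp := by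
  apply Subtype.ext
  funext x
  apply Subtype.ext
  change (σ.u ++ τ.u) ++ x.1 ++ (τ.v ++ σ.v) = σ.u ++ (τ.u ++ x.1 ++ τ.v) ++ σ.v
  simp

theorem extOp_ofLeft (w : WMWord S) : (ofLeft w).extOp = (wordExt S).left w := by
  apply Subtype.ext
  funext x
  apply Subtype.ext
  change w.1 ++ x.1 ++ [] = w.1 ++ x.1
  simp

theorem extOp_ofRight (w : WMWord S) : (ofRight w).extOp = (wordExt S).right w := by
  apply Subtype.ext
  funext x
  apply Subtype.ext
  change [] ++ x.1 ++ w.1 = x.1 ++ w.1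
  simp

theorem extOp_one : (σ : Context S) → σ.extOp.1 1 = σ.word := by
  intro σ
  apply Subtype.ext
  change σ.u ++ [] ++ σ.v = σ.u ++ σ.v
  simp

end Context

section Hom

variable {R : Type} [Monoid R] {A : ExtAlgebra R} (h : ExtHom (wordExt S) A)

/-- The operation on `R` induced by a context. -/
def ctxOp (σ : Context S) : Function.End R := (h.psi σ.extOp).1

theorem ctxOp_mul (σ τ : Context S) : ctxOp h (σ.mul τ) = ctxOp h σ * ctxOp h τ := by
  rw [ctxOp, Context.extOp_mul, map_mul]
  rfl

theorem ctxOp_ofLeft (w : WMWord S) : ctxOp h (.ofLeft w) = leftMult (h.phi w) := by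
  rw [ctxOp, Context.extOp_ofLeft, h.psi_left]
  rfl

theorem ctxOp_ofRight (w : WMWord S) : ctxOp h (.ofRight w) = rightMult (h.phi w) := by
  rw [ctxOp, Context.extOp_ofRight, h.psi_right]
  rfl

theorem phi_word (σ : Context S) : h.phi σ.word = ctxOp h σ 1 := by
  rw [ctxOp, ← Context.extOp_one, ← h.psi_apply, map_one]

end Hom

/-! ### Generating all contexts -/

/-- The operations generating the pairs of contexts with the same first component
(`f = false`) or with the same second component (`f = true`). -/
def pairOps (f : Bool) (x y : Context S × Context S) : List (Context S × Context S) :=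
  [(x.1.mul y.1, x.2.mul y.2),
   (.ofLeft x.1.word, .ofLeft (bif f then y.1.word else x.1.word)),
   (.ofRight x.1.word, .ofRight (bif f then x.1.word else y.1.word))]

/-- The pairs of contexts from which all others are generated. -/
def pairGens (f : Bool) : Set (Context S × Context S) :=
  {x | x = (.ofLeft 1, .ofLeft 1) ∨ (∃ c, x = (.ofLeft (.ofInt c), .ofLeft (.ofInt c))) ∨
    ∃ a a' b b', (bif f then b = b' else a = a') ∧ x = (.pair a b, .pair a' b')}

/-- The operations generating all contexts. -/
def ctxOps (x y : Context S) : List (Context S) :=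
  [x.mul y, .ofLeft x.word, .ofRight x.word]

/-- The contexts from which all others are generated. -/
def ctxGens : Set (Context S) :=
  {x | x = .ofLeft 1 ∨ (∃ c, x = .ofLeft (.ofInt c)) ∨ ∃ a b, x = .pair a b}

variable {f : Bool}

theorem mul_mem_growAll {x y : Context S × Context S} (hx : x ∈ growAll (pairOps f) (pairGens f))
    (hy : y ∈ growAll (pairOps f) (pairGens f)) :
    (x.1.mul y.1, x.2.mul y.2) ∈ growAll (pairOps f) (pairGens f) :=
  growAll_ops hx hy (by simp [pairOps])

/-- Well-matched words are not generated separately: they appear as uv for the first context of a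
generated pair, and nesting and concatenation are imitated by composing contexts of the form (w,ε).
-/
theorem exists_word_mem_growAll {w : Word S} (hw : WellMatched w) :
    ∃ x ∈ growAll (pairOps f) (pairGens f), x.1.u ++ x.1.v = w := by
  induction hw with
  | nil => exact ⟨_, growAll_base (Or.inl rfl), rfl⟩
  | int c => exact ⟨_, growAll_base (Or.inr (Or.inl ⟨c, rfl⟩)), rfl⟩
  | @nest a b w hw ih =>
    obtain ⟨x, hx, rfl⟩ := ih
    refine ⟨_, mul_mem_growAll (growAll_base (Or.inr (Or.inr ⟨a, a, b, b, by cases f <;> rfl, rfl⟩)))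
      (growAll_ops hx hx (z := _) (List.mem_cons_of_mem _ List.mem_cons_self)), ?_⟩
    simp [Context.mul, Context.pair, Context.ofLeft, Context.word]
  | append hu hv _ _ ihu ihv =>
    obtain ⟨x, hx, rfl⟩ := ihu
    obtain ⟨y, hy, rfl⟩ := ihv
    refine ⟨_, mul_mem_growAll
      (growAll_ops hx hx (z := _) (List.mem_cons_of_mem _ List.mem_cons_self))
      (growAll_ops hy hy (z := _) (List.mem_cons_of_mem _ List.mem_cons_self)), ?_⟩
    simp [Context.mul, Context.ofLeft, Context.word]

theorem ofLeft_mem_growAll (w w' : WMWord S) (hf : f = false → w = w') :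
    (Context.ofLeft w, Context.ofLeft w') ∈ growAll (pairOps f) (pairGens f) := by
  obtain ⟨x, hx, e⟩ := exists_word_mem_growAll (f := f) w.2
  obtain ⟨y, hy, e'⟩ := exists_word_mem_growAll (f := f) w'.2
  have e : x.1.word = w := Subtype.ext e
  have e' : y.1.word = w' := Subtype.ext e'
  refine growAll_ops hx hy ?_
  cases f
  · simp [pairOps, e, ← hf rfl]
  · simp [pairOps, e, e']

theorem ofRight_mem_growAll (w w' : WMWord S) (hf : f = true → w = w') :
    (Context.ofRight w, Context.ofRight w') ∈ growAll (pairOps f) (pairGens f) := by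
  obtain ⟨x, hx, e⟩ := exists_word_mem_growAll (f := f) w.2
  obtain ⟨y, hy, e'⟩ := exists_word_mem_growAll (f := f) w'.2
  have e : x.1.word = w := Subtype.ext e
  have e' : y.1.word = w' := Subtype.ext e'
  refine growAll_ops hx hy ?_
  cases f
  · simp [pairOps, e, e']
  · simp [pairOps, e, ← hf rfl]

/-- The context (w a u, v b x) is the composite of (w,ε), (ε,x), (a,b) and (u,v). In the two members
of the pair only the data on the right, b and x and v, may differ. -/
theorem mem_growAll_of_sameLeft {u v v' : Word S} (h : SameLeft u v v') :
    ∃ x ∈ growAll (pairOps false) (pairGens false), x.1.u = u ∧ x.1.v = v ∧ x.2.u = u ∧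
      x.2.v = v' := by
  induction h with
  | @base w v v' hw hv hv' =>
    exact ⟨_, mul_mem_growAll (ofLeft_mem_growAll ⟨w, hw⟩ ⟨w, hw⟩ fun _ => rfl)
      (ofRight_mem_growAll ⟨v, hv⟩ ⟨v', hv'⟩ (by simp)),
      by simp [Context.mul, Context.ofLeft, Context.ofRight]⟩
  | @nest w u v v' y y' a b b' hw hy hy' _ ih =>
    obtain ⟨x, hx, h1, h2, h3, h4⟩ := ih
    exact ⟨_, mul_mem_growAll (mul_mem_growAll
      (ofLeft_mem_growAll ⟨w, hw⟩ ⟨w, hw⟩ fun _ => rfl)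
      (ofRight_mem_growAll ⟨y, hy⟩ ⟨y', hy'⟩ (by simp)))
      (mul_mem_growAll (growAll_base (Or.inr (Or.inr ⟨a, a, b, b', rfl, rfl⟩))) hx),
      by simp [Context.mul, Context.ofLeft, Context.ofRight, Context.pair, h1, h2, h3, h4]⟩

theorem mem_growAll_of_sameRight {v u u' : Word S} (h : SameRight v u u') :
    ∃ x ∈ growAll (pairOps true) (pairGens true), x.1.u = u ∧ x.1.v = v ∧ x.2.u = u' ∧
      x.2.v = v := by
  induction h with
  | @base w v v' hw hv hv' =>
    exact ⟨_, mul_mem_growAll (ofLeft_mem_growAll ⟨v, hv⟩ ⟨v', hv'⟩ (by simp))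
      (ofRight_mem_growAll ⟨w, hw⟩ ⟨w, hw⟩ fun _ => rfl),
      by simp [Context.mul, Context.ofLeft, Context.ofRight]⟩
  | @nest w u v v' y y' b a a' hw hy hy' _ ih =>
    obtain ⟨x, hx, h1, h2, h3, h4⟩ := ih
    exact ⟨_, mul_mem_growAll (mul_mem_growAll
      (ofLeft_mem_growAll ⟨y, hy⟩ ⟨y', hy'⟩ (by simp))
      (ofRight_mem_growAll ⟨w, hw⟩ ⟨w, hw⟩ fun _ => rfl))
      (mul_mem_growAll (growAll_base (Or.inr (Or.inr ⟨a, a', b, b, rfl, rfl⟩))) hx),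
      by simp [Context.mul, Context.ofLeft, Context.ofRight, Context.pair, h1, h2, h3, h4]⟩

/-- The generated pairs are exactly the pairs of contexts that agree in one component. -/
theorem mem_growAll_pairs (f : Bool) (σ τ : Context S) :
    (σ, τ) ∈ growAll (pairOps f) (pairGens f) ↔ (bif f then σ.v = τ.v else σ.u = τ.u) := by
  constructor
  · intro h
    refine growAll_induction (P := fun x : Context S × Context S =>
      (bif f then x.1.v = x.2.v else x.1.u = x.2.u)) ?_ ?_ h
    · rintro x (rfl | ⟨c, rfl⟩ | ⟨a, a', b, b', hf, rfl⟩)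
      · cases f <;> rfl
      · cases f <;> rfl
      · cases f <;> simp_all [Context.pair]
    · intro x y z hx hy hz
      simp only [pairOps, List.mem_cons, List.not_mem_nil, or_false] at hz
      rcases hz with rfl | rfl | rfl <;> cases f <;>
        simp_all [Context.mul, Context.ofLeft, Context.ofRight]
  · intro h
    cases f
    · obtain ⟨x, hx, h1, h2, h3, h4⟩ := mem_growAll_of_sameLeft (SameLeft.of_wellMatched σ.wm
        (v' := τ.v) (by rw [show σ.u = τ.u from h]; exact τ.wm))
      have : x = (σ, τ) := Prod.ext (Context.ext h1 h2)
        (Context.ext (h3.trans (show σ.u = τ.u from h)) h4)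
      rwa [this] at hx
    · obtain ⟨x, hx, h1, h2, h3, h4⟩ := mem_growAll_of_sameRight (SameRight.of_wellMatched σ.wm
        (u' := τ.u) (by rw [show σ.v = τ.v from h]; exact τ.wm))
      have : x = (σ, τ) := Prod.ext (Context.ext h1 h2)
        (Context.ext h3 (h4.trans (show σ.v = τ.v from h)))
      rwa [this] at hx

/-- All contexts are generated. -/
theorem mem_growAll_ctx (σ : Context S) : σ ∈ growAll ctxOps ctxGens := by
  have h := (mem_growAll_pairs false σ σ).2 rfl
  refine growAll_induction (P := fun x : Context S × Context S => x.1 ∈ growAll ctxOps ctxGens)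
    ?_ ?_ h
  · rintro x (rfl | ⟨c, rfl⟩ | ⟨a, a', b, b', hf, rfl⟩)
    · exact growAll_base (Or.inl rfl)
    · exact growAll_base (Or.inr (Or.inl ⟨c, rfl⟩))
    · exact growAll_base (Or.inr (Or.inr ⟨a, b, rfl⟩))
  · intro x y z hx hy hz
    simp only [pairOps, List.mem_cons, List.not_mem_nil, or_false] at hz
    rcases hz with rfl | rfl | rfl
    · exact growAll_ops hx hy (by simp [ctxOps])
    · exact growAll_ops hx hy (by simp [ctxOps])
    · exact growAll_ops hx hy (by simp [ctxOps])

/-! ### Access to the tables -/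

section Fields

variable {α : Type} [Primcodable α]

theorem primrec_dvpaCode_equiv {f : α → DVPACode} (hf : Primrec f) :
    Primrec fun a => DVPACode.equiv (f a) := (Primrec.of_equiv (e := DVPACode.equiv)).comp hf

theorem primrec_homCode_equiv {f : α → HomCode} (hf : Primrec f) :
    Primrec fun a => HomCode.equiv (f a) := (Primrec.of_equiv (e := HomCode.equiv)).comp hf

variable {f : α → DVPACode}

@[fun_prop]
theorem primrec_dvpaCode_numCall (hf : Primrec f) :
    Primrec fun a => (f a).numCall :=
  primrec_fst (primrec_dvpaCode_equiv hf)

@[fun_prop]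
theorem primrec_dvpaCode_numInt (hf : Primrec f) :
    Primrec fun a => (f a).numInt :=
  primrec_fst (primrec_snd (primrec_dvpaCode_equiv hf))

@[fun_prop]
theorem primrec_dvpaCode_numRet (hf : Primrec f) :
    Primrec fun a => (f a).numRet :=
  primrec_fst (primrec_snd (primrec_snd (primrec_dvpaCode_equiv hf)))

@[fun_prop]
theorem primrec_dvpaCode_numStates (hf : Primrec f) :
    Primrec fun a => (f a).numStates :=
  primrec_fst (primrec_snd (primrec_snd (primrec_snd (primrec_dvpaCode_equiv hf))))

@[fun_prop]
theorem primrec_dvpaCode_numStack (hf : Primrec f) :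
    Primrec fun a => (f a).numStack :=
  primrec_fst (primrec_snd (primrec_snd (primrec_snd (primrec_snd (primrec_dvpaCode_equiv hf)))))

@[fun_prop]
theorem primrec_dvpaCode_start (hf : Primrec f) :
    Primrec fun a => (f a).start :=
  primrec_fst (primrec_snd (primrec_snd (primrec_snd (primrec_snd (primrec_snd
    (primrec_dvpaCode_equiv hf))))))

@[fun_prop]
theorem primrec_dvpaCode_accept (hf : Primrec f) :
    Primrec fun a => (f a).accept :=
  primrec_fst (primrec_snd (primrec_snd (primrec_snd (primrec_snd (primrec_snd (primrec_snd
    (primrec_dvpaCode_equiv hf)))))))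

@[fun_prop]
theorem primrec_dvpaCode_bot (hf : Primrec f) :
    Primrec fun a => (f a).bot :=
  primrec_fst (primrec_snd (primrec_snd (primrec_snd (primrec_snd (primrec_snd (primrec_snd
    (primrec_snd (primrec_dvpaCode_equiv hf))))))))

@[fun_prop]
theorem primrec_dvpaCode_onCall (hf : Primrec f) :
    Primrec fun a => (f a).onCall :=
  primrec_fst (primrec_snd (primrec_snd (primrec_snd (primrec_snd (primrec_snd (primrec_snd
    (primrec_snd (primrec_snd (primrec_dvpaCode_equiv hf)))))))))

@[fun_prop]
theorem primrec_dvpaCode_onInt (hf : Primrec f) :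
    Primrec fun a => (f a).onInt :=
  primrec_fst (primrec_snd (primrec_snd (primrec_snd (primrec_snd (primrec_snd (primrec_snd
    (primrec_snd (primrec_snd (primrec_snd (primrec_dvpaCode_equiv hf))))))))))

@[fun_prop]
theorem primrec_dvpaCode_onRet (hf : Primrec f) :
    Primrec fun a => (f a).onRet :=
  primrec_snd (primrec_snd (primrec_snd (primrec_snd (primrec_snd (primrec_snd (primrec_snd
    (primrec_snd (primrec_snd (primrec_snd (primrec_dvpaCode_equiv hf))))))))))

@[fun_prop]
theorem primrec_homCode_numCall {f : α → HomCode} (hf : Primrec f) :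
    Primrec fun a => (f a).numCall :=
  primrec_fst (primrec_homCode_equiv hf)

@[fun_prop]
theorem primrec_homCode_numInt {f : α → HomCode} (hf : Primrec f) :
    Primrec fun a => (f a).numInt :=
  primrec_fst (primrec_snd (primrec_homCode_equiv hf))

@[fun_prop]
theorem primrec_homCode_numRet {f : α → HomCode} (hf : Primrec f) :
    Primrec fun a => (f a).numRet :=
  primrec_fst (primrec_snd (primrec_snd (primrec_homCode_equiv hf)))

@[fun_prop]
theorem primrec_homCode_size {f : α → HomCode} (hf : Primrec f) :
    Primrec fun a => (f a).size :=
  primrec_fst (primrec_snd (primrec_snd (primrec_snd (primrec_homCode_equiv hf))))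

@[fun_prop]
theorem primrec_homCode_one {f : α → HomCode} (hf : Primrec f) :
    Primrec fun a => (f a).one :=
  primrec_fst (primrec_snd (primrec_snd (primrec_snd (primrec_snd (primrec_homCode_equiv hf)))))

@[fun_prop]
theorem primrec_homCode_mul {f : α → HomCode} (hf : Primrec f) :
    Primrec fun a => (f a).mul :=
  primrec_fst (primrec_snd (primrec_snd (primrec_snd (primrec_snd (primrec_snd
    (primrec_homCode_equiv hf))))))

@[fun_prop]
theorem primrec_homCode_ops {f : α → HomCode} (hf : Primrec f) :
    Primrec fun a => (f a).ops :=
  primrec_fst (primrec_snd (primrec_snd (primrec_snd (primrec_snd (primrec_snd (primrec_snd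
    (primrec_homCode_equiv hf)))))))

@[fun_prop]
theorem primrec_homCode_phi {f : α → HomCode} (hf : Primrec f) :
    Primrec fun a => (f a).phi :=
  primrec_fst (primrec_snd (primrec_snd (primrec_snd (primrec_snd (primrec_snd (primrec_snd
    (primrec_snd (primrec_homCode_equiv hf))))))))

@[fun_prop]
theorem primrec_homCode_psi {f : α → HomCode} (hf : Primrec f) :
    Primrec fun a => (f a).psi :=
  primrec_snd (primrec_snd (primrec_snd (primrec_snd (primrec_snd (primrec_snd (primrec_snd
    (primrec_snd (primrec_homCode_equiv hf))))))))

theorem primrec_homCode_mk {x₁ x₂ x₃ x₄ x₅ : α → ℕ} {x₆ x₇ : α → List (List ℕ)} {x₈ : α → List ℕ}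
    {x₉ : α → List (List (List ℕ))} (h₁ : Primrec x₁) (h₂ : Primrec x₂) (h₃ : Primrec x₃)
    (h₄ : Primrec x₄) (h₅ : Primrec x₅) (h₆ : Primrec x₆) (h₇ : Primrec x₇) (h₈ : Primrec x₈)
    (h₉ : Primrec x₉) : Primrec fun a =>
      (⟨x₁ a, x₂ a, x₃ a, x₄ a, x₅ a, x₆ a, x₇ a, x₈ a, x₉ a⟩ : HomCode) :=
  (Primrec.of_equiv_symm (e := HomCode.equiv)).comp
    (by fun_prop : Primrec fun a => (x₁ a, x₂ a, x₃ a, x₄ a, x₅ a, x₆ a, x₇ a, x₈ a, x₉ a))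

end Fields

/-! ### Words over numbered letters -/

/-- Words whose letters are given by their kind and number. -/
abbrev CodeWord := List (ℕ × ℕ)

section Encoding

variable {S : VPAlphabet} (N : LetterNumbering S)

/-- The kind and number of a letter. -/
def encLetter : Letter S → ℕ × ℕ
  | .call a => (0, N.call.symm a)
  | .int c => (1, N.int.symm c)
  | .ret b => (2, N.ret.symm b)

/-- A word given by kinds and numbers. -/
def encWord (w : Word S) : CodeWord := w.map (encLetter N)

/-- A context given by kinds and numbers. -/
def encCtx (σ : Context S) : CodeWord × CodeWord := (encWord N σ.u, encWord N σ.v)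

@[simp]
theorem encWord_append (u v : Word S) : encWord N (u ++ v) = encWord N u ++ encWord N v := by
  simp [encWord]

theorem encWord_injective : Function.Injective (encWord N) := by
  refine List.map_injective_iff.2 fun a b h => ?_
  cases a <;> cases b <;> simp_all [encLetter, Fin.val_inj]

theorem encCtx_injective : Function.Injective (encCtx N) := fun _ _ h =>
  Context.ext (encWord_injective N (congrArg Prod.fst h))
    (encWord_injective N (congrArg Prod.snd h))

end Encoding

/-- The operations generating all contexts, on numbered letters. -/
def codeOps (x y : CodeWord × CodeWord) : List (CodeWord × CodeWord) :=
  [(x.1 ++ y.1, y.2 ++ x.2), (x.1 ++ x.2, []), ([], x.1 ++ x.2)]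

/-- The generating contexts, on numbered letters. -/
def codeGens (numCall numInt numRet : ℕ) : List (CodeWord × CodeWord) :=
  ([], []) :: ((List.range numInt).map (fun c => ([(1, c)], [])) ++
    (List.range numCall).flatMap fun a => (List.range numRet).map fun b => ([(0, a)], [(2, b)]))

section Contexts

variable {S : VPAlphabet} (N : LetterNumbering S)

theorem mem_codeGens (z : CodeWord × CodeWord) :
    z ∈ codeGens N.numCall N.numInt N.numRet ↔ ∃ σ ∈ ctxGens (S := S), z = encCtx N σ := by
  simp only [codeGens, List.mem_cons, List.mem_append, List.mem_map, List.mem_flatMap,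
    List.mem_range, ctxGens, Set.mem_ofPred_eq]
  constructor
  · rintro (rfl | ⟨c, hc, rfl⟩ | ⟨a, ha, b, hb, rfl⟩)
    · exact ⟨_, Or.inl rfl, rfl⟩
    · exact ⟨_, Or.inr (Or.inl ⟨N.int ⟨c, hc⟩, rfl⟩),
        by simp [encCtx, Context.ofLeft, WMWord.ofInt, encWord, encLetter]⟩
    · exact ⟨_, Or.inr (Or.inr ⟨N.call ⟨a, ha⟩, N.ret ⟨b, hb⟩, rfl⟩),
        by simp [encCtx, Context.pair, encWord, encLetter]⟩
  · rintro ⟨σ, rfl | ⟨c, rfl⟩ | ⟨a, b, rfl⟩, rfl⟩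
    · exact Or.inl rfl
    · exact Or.inr (Or.inl ⟨_, (N.int.symm c).2, rfl⟩)
    · exact Or.inr (Or.inr ⟨_, (N.call.symm a).2, _, (N.ret.symm b).2, rfl⟩)

theorem mem_growList_code (k : ℕ) (z : CodeWord × CodeWord) :
    z ∈ growList codeOps k (codeGens N.numCall N.numInt N.numRet) ↔
      ∃ σ ∈ growSet ctxOps (ctxGens (S := S)) k, z = encCtx N σ := by
  refine mem_growList_iff (fun σ τ => ?_) (mem_codeGens N) k z
  simp [codeOps, ctxOps, encCtx, Context.mul, Context.word, Context.ofLeft, Context.ofRight,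
    encWord]

end Contexts

/-! ### Simulating an automaton -/

/-- One step of the automaton given by tables. -/
def codeStep (c : DVPACode) (r : ℕ × List ℕ) (a : ℕ × ℕ) : ℕ × List ℕ :=
  r.2.casesOn (motive := fun _ => ℕ × List ℕ) (r.1, []) fun g s =>
    bif decide (a.1 = 0) then
      ((((c.onCall.getD r.1 []).getD a.2 []).getD g (0, 0)).1,
        (((c.onCall.getD r.1 []).getD a.2 []).getD g (0, 0)).2 :: g :: s)
    else bif decide (a.1 = 1) then (((c.onInt.getD r.1 []).getD a.2 []).getD g 0, g :: s)
    else (((c.onRet.getD r.1 []).getD a.2 []).getD g 0, s)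

/-- Membership in the language of the automaton given by tables. -/
def codeMem (c : DVPACode) (w : CodeWord) : Bool :=
  decide ((w.foldl (codeStep c) (c.start, [c.bot])).2 = [c.bot]) &&
    c.accept.any fun q => decide (q = (w.foldl (codeStep c) (c.start, [c.bot])).1)

/-- A sufficient number of steps for generating all operations of the syntactic Ext-algebra. -/
def codeBound (c : DVPACode) : ℕ :=
  ((c.numStates ^ c.numStack) ^ c.numStates) ^ ((c.numStates ^ c.numStack) ^ c.numStates)

/-- Contexts for all operations of the syntactic Ext-algebra. -/
def codeCtxs (c : DVPACode) : List (CodeWord × CodeWord) :=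
  growList codeOps (codeBound c) (codeGens c.numCall c.numInt c.numRet)

/-- The syntactic congruence. -/
def codeEqv (c : DVPACode) (x y : CodeWord) : Bool :=
  (codeCtxs c).all fun z => decide (codeMem c (z.1 ++ x ++ z.2) = codeMem c (z.1 ++ y ++ z.2))

/-- Representatives of the classes of the syntactic congruence. -/
def codeReps (c : DVPACode) : List CodeWord :=
  ((codeCtxs c).map fun z => z.1 ++ z.2).foldl
    (fun r w => bif r.any fun x => codeEqv c x w then r else r ++ [w]) []

/-- The number of the class of a word. -/
def codeIdx (c : DVPACode) (w : CodeWord) : ℕ := (codeReps c).findIdx fun x => codeEqv c x w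

/-- The tables of the syntactic morphism. -/
def syntacticCode (c : DVPACode) : HomCode where
  numCall := c.numCall
  numInt := c.numInt
  numRet := c.numRet
  size := (codeReps c).length
  one := codeIdx c []
  mul := (codeReps c).map fun x => (codeReps c).map fun y => codeIdx c (x ++ y)
  ops := (codeCtxs c).map fun z => (codeReps c).map fun x => codeIdx c (z.1 ++ x ++ z.2)
  phi := (List.range c.numInt).map fun a => codeIdx c [(1, a)]
  psi := (List.range c.numCall).map fun a => (List.range c.numRet).map fun b =>
    (codeReps c).map fun x => codeIdx c ([(0, a)] ++ x ++ [(2, b)])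

/-- The list of numbers of the classes contained in the language. -/
def syntacticImageCode (c : DVPACode) : List ℕ :=
  (List.range (codeReps c).length).filter fun i => codeMem c ((codeReps c).getD i [])

section Primrec

variable {α : Type} [Primcodable α] {f : α → DVPACode} {g g' : α → CodeWord}

@[fun_prop]
theorem primrec_codeStep {r : α → ℕ × List ℕ} {a : α → ℕ × ℕ} (hf : Primrec f) (hr : Primrec r)
    (ha : Primrec a) : Primrec fun x => codeStep (f x) (r x) (a x) := by
  unfold codeStep
  fun_prop

@[fun_prop]
theorem primrec_codeMem (hf : Primrec f) (hg : Primrec g) :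
    Primrec fun x => codeMem (f x) (g x) := by
  unfold codeMem
  fun_prop

@[fun_prop]
theorem primrec_codeCtxs (hf : Primrec f) : Primrec fun x => codeCtxs (f x) := by
  unfold codeCtxs codeBound codeGens codeOps
  fun_prop

@[fun_prop]
theorem primrec_codeEqv (hf : Primrec f) (hg : Primrec g) (hg' : Primrec g') :
    Primrec fun x => codeEqv (f x) (g x) (g' x) := by
  unfold codeEqv
  fun_prop

@[fun_prop]
theorem primrec_codeReps (hf : Primrec f) : Primrec fun x => codeReps (f x) := by
  unfold codeReps
  fun_prop

@[fun_prop]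
theorem primrec_codeIdx (hf : Primrec f) (hg : Primrec g) :
    Primrec fun x => codeIdx (f x) (g x) := by
  unfold codeIdx
  fun_prop

theorem primrec_syntacticCode : Primrec syntacticCode := by
  refine primrec_homCode_mk ?_ ?_ ?_ ?_ ?_ ?_ ?_ ?_ ?_ <;> fun_prop

theorem primrec_syntacticImageCode : Primrec syntacticImageCode := by
  unfold syntacticImageCode
  fun_prop

end Primrec

@[simp]
theorem getD_ofFn {α : Type} {n : ℕ} (f : Fin n → α) (i : Fin n) (d : α) :
    (List.ofFn f).getD i d = f i := by
  simp [List.getD_eq_getElem?_getD]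

theorem map_range_eq_ofFn {α : Type} (n : ℕ) (f : ℕ → α) :
    (List.range n).map f = List.ofFn fun i : Fin n => f i := by
  apply List.ext_getElem <;> simp

/-! ### Runs on well-matched words -/

namespace DVPA

variable {S : VPAlphabet} {Q G : Type} (M : DVPA S Q G)

theorem run_nil_stack (q : Q) (w : Word S) : M.run q w [] = (q, []) := by
  cases w <;> rfl

theorem run_append (u v : Word S) : ∀ q s, M.run q (u ++ v) s =
    M.run (M.run q u s).1 v (M.run q u s).2 := by
  induction u with
  | nil => intro q s; rfl
  | cons a u ih =>
    intro q s
    rcases s with _ | ⟨g, s⟩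
    · simp [run_nil_stack]
    · exact ih _ _

/-- A well-matched word never pops or looks below the symbol that is on top at its start. Uniformity
in the rest of the stack is what makes its action a function of state and top symbol. -/
theorem exists_run_wellMatched {w : Word S} (hw : WellMatched w) :
    ∀ q g, ∃ q', ∀ s, M.run q w (g :: s) = (q', g :: s) := by
  induction hw with
  | nil => exact fun q g => ⟨q, fun s => rfl⟩
  | int c => exact fun q g => ⟨M.onInt q c g, fun s => rfl⟩
  | nest a b _ ih =>
    intro q g
    obtain ⟨q', h⟩ := ih (M.onCall q a g).1 (M.onCall q a g).2.1
    refine ⟨M.onRet q' b (M.onCall q a g).2.1, fun s => ?_⟩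
    have := h (g :: s)
    simp [run, step, run_append, this]
  | append _ _ _ _ ihu ihv =>
    intro q g
    obtain ⟨q', h⟩ := ihu q g
    obtain ⟨q'', h'⟩ := ihv q' g
    exact ⟨q'', fun s => by rw [run_append, h, h']⟩

/-- The effect of a well-matched word on the state, depending on the top of the stack. -/
noncomputable def effect (w : WMWord S) (q : Q) (g : G) : Q :=
  (M.exists_run_wellMatched w.2 q g).choose

theorem run_eq_effect (w : WMWord S) (q : Q) (g : G) (s : List G) :
    M.run q w.1 (g :: s) = (M.effect w q g, g :: s) :=
  (M.exists_run_wellMatched w.2 q g).choose_spec s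

/-- In a run on uxv the factor x matters only through its action on the state and top symbol reached
after u; if the stack is empty by then, the automaton is stuck anyway. -/
theorem syntactic_eq_of_effect_eq {x y : WMWord S} (h : M.effect x = M.effect y) :
    (syntacticHom M.language).phi x = (syntacticHom M.language).phi y := by
  refine (Con.eq _).2 ?_
  rintro _ ⟨σ, rfl⟩
  have : M.run M.start (σ.u ++ x.1 ++ σ.v) [M.bot] = M.run M.start (σ.u ++ y.1 ++ σ.v) [M.bot] := by
    simp only [run_append]
    rcases (M.run M.start σ.u [M.bot]).2 with _ | ⟨g, s⟩
    · simp only [run_nil_stack]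
    · rw [run_eq_effect, run_eq_effect, h]
  change (M.run M.start (σ.u ++ x.1 ++ σ.v) [M.bot]).1 ∈ M.accept ∧
    (M.run M.start (σ.u ++ x.1 ++ σ.v) [M.bot]).2 = [M.bot] ↔
    (M.run M.start (σ.u ++ y.1 ++ σ.v) [M.bot]).1 ∈ M.accept ∧
    (M.run M.start (σ.u ++ y.1 ++ σ.v) [M.bot]).2 = [M.bot]
  rw [this]

/-- The syntactic monoid embeds into the set of possible effects. -/
theorem exists_injective_syntacticMonoid :
    ∃ f : SyntacticMonoid M.language → (Q → G → Q), Function.Injective f := by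
  refine ⟨fun r => M.effect (Function.surjInv (Con.mk'_surjective) r), fun r r' h => ?_⟩
  rw [← Function.surjInv_eq Con.mk'_surjective r, ← Function.surjInv_eq Con.mk'_surjective r']
  exact M.syntactic_eq_of_effect_eq h

end DVPA

/-! ### The syntactic morphism -/

section Syntactic

variable {S : VPAlphabet} {L : Set (Word S)}

theorem syntacticHom_phi_surjective (L : Set (Word S)) :
    Function.Surjective (syntacticHom L).phi := Con.mk'_surjective

theorem syntacticHom_phi_eq_iff {x y : WMWord S} :
    (syntacticHom L).phi x = (syntacticHom L).phi y ↔
      ∀ σ : Context S, (σ.fn x).1 ∈ L ↔ (σ.fn y).1 ∈ L := by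
  refine (Con.eq _).trans ⟨fun h σ => h _ ⟨σ, rfl⟩, ?_⟩
  rintro h _ ⟨σ, rfl⟩
  exact h σ

/-- The empty context shows that the language is a union of classes of its syntactic congruence. -/
theorem phi_mem_syntacticImage {x : WMWord S} :
    (syntacticHom L).phi x ∈ syntacticImage L ↔ x.1 ∈ L := by
  refine ⟨?_, fun h => ⟨x, h, rfl⟩⟩
  rintro ⟨y, hy, h⟩
  have := (syntacticHom_phi_eq_iff.1 h) ⟨[], [], .nil⟩
  simpa [Context.fn] using this.1 (by simpa [Context.fn] using hy)

theorem phi_fn (σ : Context S) (x : WMWord S) :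
    (syntacticHom L).phi (σ.fn x) = ctxOp (syntacticHom L) σ ((syntacticHom L).phi x) :=
  ((syntacticHom L).psi_apply σ.extOp x).symm

theorem mem_syntacticExt_ops {f : Function.End (SyntacticMonoid L)} :
    f ∈ (syntacticExt L).ops ↔ ∃ σ : Context S, f = ctxOp (syntacticHom L) σ := by
  constructor
  · rintro ⟨_, ⟨σ, rfl⟩, h⟩
    refine ⟨σ, funext fun r => ?_⟩
    obtain ⟨x, rfl⟩ := syntacticHom_phi_surjective L r
    exact h x
  · rintro ⟨σ, rfl⟩
    exact ((syntacticHom L).psi σ.extOp).2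

end Syntactic

/-- All operations of a finite Ext-algebra that come from contexts come from contexts generated in
a bounded number of steps. -/
theorem exists_growSet_ctxOp {S : VPAlphabet} {R : Type} [Monoid R] [Finite R] {A : ExtAlgebra R}
    (h : ExtHom (wordExt S) A) {B : ℕ} (hB : Nat.card R ^ Nat.card R ≤ B) (σ : Context S) :
    ∃ τ ∈ growSet ctxOps (ctxGens (S := S)) B, ctxOp h τ = ctxOp h σ := by
  classical
  have := Fintype.ofFinite R
  -- One basis vector per operation, so the dimension is the number of maps R → R.
  let Φ : Context S → (Function.End R →₀ ℚ) := fun σ => Finsupp.single (ctxOp h σ) 1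
  have hfin : Finite (Function.End R) := inferInstanceAs (Finite (R → R))
  have := Fintype.ofFinite (Function.End R)
  have hcard : Fintype.card (Function.End R) = Nat.card R ^ Nat.card R := by
    rw [← Nat.card_eq_fintype_card]
    exact (Nat.card_fun (α := R) (β := R))
  have key : Φ σ ∈ Submodule.span ℚ (Φ '' growSet ctxOps (ctxGens (S := S)) B) := by
    refine span_growSet_eq Φ ?_ (by simpa [hcard] using hB) (mem_growAll_ctx σ)
    intro x y z hz
    have lin : ∀ o : Function.End R → Function.End R, ∃ α : (Function.End R →₀ ℚ) →ₗ[ℚ] _,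
        ∀ e, α (Finsupp.single e 1) = Finsupp.single (o e) (1 : ℚ) := fun o =>
      (exists_linearMap_single o LinearMap.id).imp fun α hα e => hα e 1
    simp only [ctxOps, List.mem_cons, List.not_mem_nil, or_false] at hz
    rcases hz with rfl | rfl | rfl
    · obtain ⟨α, hα⟩ := lin fun e => e * ctxOp h y
      obtain ⟨β, hβ⟩ := lin fun e => ctxOp h x * e
      refine ⟨α, β, by simp only [Φ, hα, ctxOp_mul], by simp only [Φ, hβ, ctxOp_mul],
        fun x' => ⟨_, List.mem_cons_self, by simp only [Φ, hα, ctxOp_mul]⟩,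
        fun y' => ⟨_, List.mem_cons_self, by simp only [Φ, hβ, ctxOp_mul]⟩⟩
    · obtain ⟨α, hα⟩ := lin fun e => leftMult (e 1)
      -- The result does not depend on the second argument, so a constant map on the basis serves.
      obtain ⟨β, hβ⟩ := lin fun e => ctxOp h (.ofLeft x.word)
      refine ⟨α, β, by simp only [Φ, hα, ctxOp_ofLeft, phi_word], by simp only [Φ, hβ],
        fun x' => ⟨_, List.mem_cons_of_mem _ List.mem_cons_self,
          by simp only [Φ, hα, ctxOp_ofLeft, phi_word]⟩,
        fun y' => ⟨_, List.mem_cons_of_mem _ List.mem_cons_self, by simp only [Φ, hβ]⟩⟩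
    · obtain ⟨α, hα⟩ := lin fun e => rightMult (e 1)
      obtain ⟨β, hβ⟩ := lin fun e => ctxOp h (.ofRight x.word)
      refine ⟨α, β, by simp only [Φ, hα, ctxOp_ofRight, phi_word], by simp only [Φ, hβ],
        fun x' => ⟨_, List.mem_cons_of_mem _ (List.mem_cons_of_mem _ List.mem_cons_self),
          by simp only [Φ, hα, ctxOp_ofRight, phi_word]⟩,
        fun y' => ⟨_, List.mem_cons_of_mem _ (List.mem_cons_of_mem _ List.mem_cons_self),
          by simp only [Φ, hβ]⟩⟩
  by_contra! hne
  -- If no short context had this operation, the corresponding coordinate would vanish on the whole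
  -- span, but it is 1 on Φ σ.
  have hle : Submodule.span ℚ (Φ '' growSet ctxOps (ctxGens (S := S)) B) ≤
      LinearMap.ker (Finsupp.lapply (R := ℚ) (ctxOp h σ)) := by
    refine Submodule.span_le.2 ?_
    rintro _ ⟨τ, hτ, rfl⟩
    simp [Φ, hne τ hτ]
  have := hle key
  simp [Φ] at this

/-! ### Correctness of the computed tables -/

section Correct

variable {c : DVPACode} {S : VPAlphabet} {N : LetterNumbering S} {Q G : Type} {p q : ℕ}
  {eQ : Fin p ≃ Q} {eG : Fin q ≃ G} {M : DVPA S Q G}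

/-- The tabulated automaton keeps consuming letters on an empty stack without effect, whereas
`DVPA.run` stops there; both end in the same configuration. -/
theorem foldl_codeStep (hc : c.Presents N eQ eG M) (w : Word S) : ∀ (r : Q) (s : List G),
    (encWord N w).foldl (codeStep c) ((eQ.symm r : ℕ), s.map fun g => (eG.symm g : ℕ)) =
      ((eQ.symm (M.run r w s).1 : ℕ), (M.run r w s).2.map fun g => (eG.symm g : ℕ)) := by
  induction w with
  | nil => intro r s; rfl
  | cons a w ih =>
    intro r s
    rcases s with _ | ⟨g, s⟩
    · have := ih r []
      rw [DVPA.run_nil_stack] at this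
      exact this
    · rw [DVPA.run, ← ih]
      change (encWord N w).foldl (codeStep c) (codeStep c _ (encLetter N a)) = _
      congr 1
      cases a <;> simp [encLetter, codeStep, hc.onCall, hc.onInt, hc.onRet, DVPA.step]

theorem codeMem_encWord (hc : c.Presents N eQ eG M) (w : Word S) :
    codeMem c (encWord N w) = true ↔ w ∈ M.language := by
  have h := foldl_codeStep hc w M.start [M.bot]
  rw [codeMem, hc.start, hc.bot]
  simp only [List.map_cons, List.map_nil] at h
  rw [h]
  simp only [Bool.and_eq_true, decide_eq_true_eq, List.any_eq_true, DVPA.language,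
    Set.mem_ofPred_eq, exists_eq_right]
  rw [and_comm, hc.accept]
  refine and_congr ⟨?_, fun h => ⟨_, h, rfl⟩⟩ ⟨fun h => ?_, fun h => by simp [h]⟩
  · rintro ⟨x, hx, h⟩
    rwa [← eQ.symm.injective (Fin.ext h)]
  · have hinj : Function.Injective fun g => (eG.symm g : ℕ) := fun a b h =>
      eG.symm.injective (Fin.ext h)
    exact List.map_injective_iff.2 hinj h

/-- A sufficient bound on the number of generation steps for the syntactic Ext-algebra. -/
theorem card_syntacticMonoid_le (hc : c.Presents N eQ eG M) :
    Finite (SyntacticMonoid M.language) ∧ Nat.card (SyntacticMonoid M.language) ^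
      Nat.card (SyntacticMonoid M.language) ≤ codeBound c := by
  have : Finite Q := Finite.of_equiv _ eQ
  have : Finite G := Finite.of_equiv _ eG
  obtain ⟨f, hf⟩ := M.exists_injective_syntacticMonoid
  have hfin : Finite (SyntacticMonoid M.language) := Finite.of_injective f hf
  refine ⟨hfin, ?_⟩
  have h1 := Nat.card_le_card_of_injective f hf
  have h2 : Nat.card (Q → G → Q) = (c.numStates ^ c.numStack) ^ c.numStates := by
    rw [Nat.card_fun, Nat.card_fun, ← Nat.card_congr eQ, ← Nat.card_congr eG, Nat.card_fin,
      Nat.card_fin, hc.numStates, hc.numStack]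
  rw [h2] at h1
  have h3 : 0 < Nat.card (SyntacticMonoid M.language) := Nat.card_pos
  exact (Nat.pow_le_pow_left h1 _).trans (Nat.pow_le_pow_right (h3.trans_le h1) h1)

theorem mem_codeCtxs (hc : c.Presents N eQ eG M) (z : CodeWord × CodeWord) :
    z ∈ codeCtxs c ↔ ∃ σ ∈ growSet ctxOps (ctxGens (S := S)) (codeBound c), z = encCtx N σ := by
  rw [codeCtxs, hc.numCall, hc.numInt, hc.numRet]
  exact mem_growList_code N _ z

theorem exists_mem_codeCtxs (hc : c.Presents N eQ eG M) (σ : Context S) :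
    ∃ τ : Context S, encCtx N τ ∈ codeCtxs c ∧
      ctxOp (syntacticHom M.language) τ = ctxOp (syntacticHom M.language) σ := by
  obtain ⟨hfin, hB⟩ := card_syntacticMonoid_le hc
  obtain ⟨τ, hτ, h⟩ := exists_growSet_ctxOp (syntacticHom M.language) hB σ
  exact ⟨τ, (mem_codeCtxs hc _).2 ⟨τ, hτ, rfl⟩, h⟩

theorem encWord_fn (σ : Context S) (x : WMWord S) :
    (encCtx N σ).1 ++ encWord N x.1 ++ (encCtx N σ).2 = encWord N (σ.fn x).1 := by
  simp [encCtx, Context.fn]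

/-- Whether uxv is in the language depends only on the class of x and on the operation of (u,v),
because φ_L(L) recognises L. Hence one listed context per operation is enough. -/
theorem codeEqv_iff (hc : c.Presents N eQ eG M) (x y : WMWord S) :
    codeEqv c (encWord N x.1) (encWord N y.1) = true ↔
      (syntacticHom M.language).phi x = (syntacticHom M.language).phi y := by
  have h1 : codeEqv c (encWord N x.1) (encWord N y.1) = true ↔ ∀ σ : Context S,
      encCtx N σ ∈ codeCtxs c → ((σ.fn x).1 ∈ M.language ↔ (σ.fn y).1 ∈ M.language) := by
    simp only [codeEqv, List.all_eq_true, decide_eq_true_eq]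
    constructor
    · intro h σ hσ
      have := h _ hσ
      rw [encWord_fn, encWord_fn] at this
      rw [← codeMem_encWord hc, ← codeMem_encWord hc, this]
    · intro h z hz
      obtain ⟨σ, -, rfl⟩ := (mem_codeCtxs hc z).1 hz
      have := h σ hz
      rw [encWord_fn, encWord_fn, Bool.eq_iff_iff, codeMem_encWord hc, codeMem_encWord hc]
      exact this
  rw [h1, syntacticHom_phi_eq_iff]
  refine ⟨fun h σ => ?_, fun h σ _ => h σ⟩
  obtain ⟨τ, hτ, e⟩ := exists_mem_codeCtxs hc σ
  have := h τ hτ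
  rwa [← phi_mem_syntacticImage, ← phi_mem_syntacticImage, phi_fn, phi_fn, e, ← phi_fn, ← phi_fn,
    phi_mem_syntacticImage, phi_mem_syntacticImage] at this

/-- Selecting representatives of an equivalence relation from a list. -/
theorem foldl_reps {α β : Type} (t : α → α → Bool) (cls : β → α) {γ : Type} (k : β → γ)
    (l : List β) (ht : ∀ x ∈ l, ∀ y ∈ l, t (cls x) (cls y) = true ↔ k x = k y) :
    ∃ r : List β, (l.map cls).foldl (fun r w => bif r.any fun x => t x w then r else r ++ [w]) []
      = r.map cls ∧ (∀ x ∈ r, x ∈ l) ∧ (r.map k).Nodup ∧ ∀ x ∈ l, k x ∈ r.map k := by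
  induction l using List.reverseRecOn with
  | nil => exact ⟨[], by simp⟩
  | append_singleton l w ih =>
    obtain ⟨r, h1, h2, h3, h4⟩ := ih fun x hx y hy => ht x (by simp [hx]) y (by simp [hy])
    rw [List.map_append, List.foldl_append, h1]
    simp only [List.map_cons, List.map_nil, List.foldl_cons, List.foldl_nil, List.any_map]
    cases h : r.any ((fun x => t x (cls w)) ∘ cls) with
    | true =>
      obtain ⟨x, hx, hxw⟩ := List.any_eq_true.1 h
      have hxw := (ht x (by simp [h2 x hx]) w (by simp)).1 hxw
      refine ⟨r, rfl, fun x hx => by simp [h2 x hx], h3, fun y hy => ?_⟩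
      rcases List.mem_append.1 hy with hy | hy
      · exact h4 y hy
      · rw [List.mem_singleton.1 hy, ← hxw]
        exact List.mem_map_of_mem hx
    | false =>
      refine ⟨r ++ [w], by simp, ?_, ?_, ?_⟩
      · intro x hx
        rcases List.mem_append.1 hx with hx | hx
        · simp [h2 x hx]
        · simp [List.mem_singleton.1 hx]
      · rw [List.map_append, List.nodup_append]
        refine ⟨h3, by simp, ?_⟩
        intro a ha b hb e
        obtain ⟨x, hx, rfl⟩ := List.mem_map.1 ha
        simp only [List.map_cons, List.map_nil, List.mem_singleton] at hb
        have := List.any_eq_false.1 h x hx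
        exact this ((ht x (by simp [h2 x hx]) w (by simp)).2 (e.trans hb))
      · intro y hy
        rcases List.mem_append.1 hy with hy | hy
        · simp [List.mem_map.1 (h4 y hy)]
        · simp [List.mem_singleton.1 hy]

/-- The representatives yield a numbering of the syntactic monoid. -/
theorem exists_reps (hc : c.Presents N eQ eG M) : ∃ r : List (WMWord S),
    codeReps c = r.map (fun x => encWord N x.1) ∧ (r.map (syntacticHom M.language).phi).Nodup ∧
      ∀ s, s ∈ r.map (syntacticHom M.language).phi := by
  obtain ⟨l, hl⟩ : ∃ l : List (Context S), codeCtxs c = l.map (encCtx N) := by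
    have : ∀ z ∈ codeCtxs c, ∃ σ : Context S, z = encCtx N σ := fun z hz =>
      ((mem_codeCtxs hc z).1 hz).imp fun _ h => h.2
    generalize codeCtxs c = m at this
    induction m with
    | nil => exact ⟨[], rfl⟩
    | cons z m ih =>
      obtain ⟨σ, rfl⟩ := this z (by simp)
      obtain ⟨l, rfl⟩ := ih fun z hz => this z (by simp [hz])
      exact ⟨σ :: l, rfl⟩
  have hwords : (codeCtxs c).map (fun z => z.1 ++ z.2) =
      (l.map Context.word).map fun x => encWord N x.1 := by
    simp [hl, encCtx, Context.word]
  obtain ⟨r, h1, h2, h3, h4⟩ := foldl_reps (codeEqv c) (fun x : WMWord S => encWord N x.1)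
    (syntacticHom M.language).phi (l.map Context.word) fun x _ y _ => codeEqv_iff hc x y
  refine ⟨r, ?_, h3, fun s => ?_⟩
  · rw [codeReps, hwords, h1]
  · obtain ⟨w, rfl⟩ := syntacticHom_phi_surjective _ s
    -- A listed context acting as right multiplication by the class of w sends 1 to that class, so
    -- its own word is equivalent to w.
    obtain ⟨τ, hτ, e⟩ := exists_mem_codeCtxs hc (.ofRight w)
    have : (syntacticHom M.language).phi w = (syntacticHom M.language).phi τ.word := by
      rw [phi_word, e, ctxOp_ofRight]
      exact (one_mul _).symm
    rw [this]
    rw [hl, List.mem_map] at hτ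
    obtain ⟨τ', hτ', e'⟩ := hτ
    rw [← encCtx_injective N e']
    exact h4 _ (List.mem_map_of_mem hτ')

/-- The classes are numbered by the order of their representatives, so each table entry amounts to
locating the class of an explicit word among the representatives. -/
theorem syntacticCode_presents (hc : c.Presents N eQ eG M) :
    ∃ (n : ℕ) (e : Fin n ≃ SyntacticMonoid M.language),
      (syntacticCode c).Presents N e (syntacticHom M.language) ∧
      ListsSet e (syntacticImageCode c) (syntacticImage M.language) := by
  classical
  obtain ⟨r, hr, hnd, hmem⟩ := exists_reps hc
  set φ := (syntacticHom M.language).phi with hφ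
  set e := List.Nodup.getEquivOfForallMemList (r.map φ) hnd hmem with he
  have hlen : (codeReps c).length = (r.map φ).length := by simp [hr]
  have hidx : ∀ w : WMWord S, codeIdx c (encWord N w.1) = (e.symm (φ w) : ℕ) := by
    intro w
    rw [codeIdx, hr, he]
    -- The inverse of the numbering is by definition the first index of an element in the list,
    -- which is also what the search computes.
    change _ = (r.map φ).idxOf (φ w)
    rw [List.findIdx_map, List.idxOf, List.findIdx_map]
    congr 1
    funext x
    rw [Bool.eq_iff_iff, Function.comp, Function.comp, beq_iff_eq]
    exact codeEqv_iff hc x w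
  have htab : ∀ {α : Type} (F : CodeWord → α) (H : SyntacticMonoid M.language → α),
      (∀ x : WMWord S, F (encWord N x.1) = H (φ x)) →
      (codeReps c).map F = List.ofFn fun i => H (e i) := by
    intro α F H h
    rw [hr, List.map_map]
    have : (fun i => H (e i)) = H ∘ (r.map φ).get := rfl
    rw [this, ← List.map_ofFn, List.ofFn_get, List.map_map]
    exact List.map_congr_left fun x _ => h x
  have hrow : ∀ σ : Context S, ((codeReps c).map fun x =>
      codeIdx c ((encCtx N σ).1 ++ x ++ (encCtx N σ).2)) =
      fnTable e (ctxOp (syntacticHom M.language) σ) := by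
    intro σ
    refine htab _ (fun s => (e.symm (ctxOp (syntacticHom M.language) σ s) : ℕ)) fun x => ?_
    rw [encWord_fn, hidx]
    exact congrArg (fun s => (e.symm s : ℕ)) (phi_fn σ x)
  refine ⟨_, e, ⟨hc.numCall, hc.numInt, hc.numRet, hlen, ?_, ?_, ?_, ?_, ?_⟩, ?_⟩
  · have := hidx 1
    rwa [map_one] at this
  · refine htab _ (fun s => List.ofFn fun j => (e.symm (s * e j) : ℕ)) fun x => ?_
    refine htab _ (fun s => (e.symm (φ x * s) : ℕ)) fun y => ?_
    rw [← map_mul, ← hidx, ← encWord_append]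
    rfl
  · intro t
    simp only [syntacticCode, List.mem_map, mem_syntacticExt_ops]
    constructor
    · rintro ⟨z, hz, rfl⟩
      obtain ⟨σ, -, rfl⟩ := (mem_codeCtxs hc z).1 hz
      exact ⟨_, ⟨σ, rfl⟩, hrow σ⟩
    · rintro ⟨_, ⟨σ, rfl⟩, rfl⟩
      obtain ⟨τ, hτ, h⟩ := exists_mem_codeCtxs hc σ
      exact ⟨_, hτ, by rw [hrow, h]⟩
  · simp only [syntacticCode, hc.numInt]
    rw [map_range_eq_ofFn]
    congr 1
    funext a
    rw [← hφ, ← hidx]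
    simp [WMWord.ofInt, encWord, encLetter]
  · simp only [syntacticCode, hc.numCall, hc.numRet]
    rw [map_range_eq_ofFn]
    congr 1
    funext a
    rw [map_range_eq_ofFn]
    congr 1
    funext b
    have := hrow (Context.pair (N.call a) (N.ret b))
    simp only [encCtx, Context.pair, encWord, encLetter, List.map_cons, List.map_nil,
      Equiv.symm_apply_apply] at this
    exact this
  · intro i
    simp only [syntacticImageCode, List.mem_filter, List.mem_range]
    constructor
    · rintro ⟨hi, h⟩
      rw [hr, List.length_map] at hi
      refine ⟨φ r[i], ?_, ?_⟩
      · rw [hφ, phi_mem_syntacticImage, ← codeMem_encWord hc]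
        simpa [hr, List.getD_eq_getElem?_getD, hi] using h
      · have : φ r[i] = e ⟨i, by simpa using hi⟩ := by
          change _ = (r.map φ).get _
          simp
        rw [this, Equiv.symm_apply_apply]
    · rintro ⟨x, hx, rfl⟩
      have hi := (e.symm x).2
      refine ⟨hi.trans_eq hlen.symm, ?_⟩
      replace hi := hi.trans_eq (List.length_map _)
      have h1 : φ r[(e.symm x : ℕ)] = x := by
        conv_rhs => rw [← e.apply_symm_apply x]
        change _ = (r.map φ).get _
        simp
      rw [← h1] at hx
      replace hx := (codeMem_encWord hc _).2 (phi_mem_syntacticImage.1 hx)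
      simpa [hr, List.getD_eq_getElem?_getD, hi] using hx

end Correct

/-! ### Operations and lengths of pairs of contexts, on tables -/

/-- The table of the composition. -/
def tableComp (n : ℕ) (s t : List ℕ) : List ℕ :=
  (List.range n).map fun i => s.getD (t.getD i 0) 0 % n

/-- The table of a left multiplication. -/
def tableLeft (c : HomCode) (r : ℕ) : List ℕ :=
  (List.range c.size).map fun i => (c.mul.getD r []).getD i 0 % c.size

/-- The table of a right multiplication. -/
def tableRight (c : HomCode) (r : ℕ) : List ℕ :=
  (List.range c.size).map fun i => (c.mul.getD i []).getD r 0 % c.size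

/-- The table of the operation of `(a, b)`. -/
def tablePair (c : HomCode) (a b : ℕ) : List ℕ :=
  (List.range c.size).map fun i => ((c.psi.getD a []).getD b []).getD i 0 % c.size

/-- The table of the operation of a context `(u, v)` together with `|u|` and `|v|`. -/
abbrev CtxItem := List ℕ × ℕ × ℕ

/-- Data on a pair of contexts; the boolean tells whether `Δ(u) > 0`. -/
abbrev PairItem := Bool × CtxItem × CtxItem

/-- Composition. -/
def itemMul (c : HomCode) (x y : CtxItem) : CtxItem :=
  (tableComp c.size x.1 y.1, x.2.1 + y.2.1, x.2.2 + y.2.2)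

/-- From `(u, v)` to `(u v, ε)`. -/
def itemLeft (c : HomCode) (x : CtxItem) : CtxItem :=
  (tableLeft c (x.1.getD c.one 0), x.2.1 + x.2.2, 0)

/-- From `(u, v)` to `(ε, u v)`. -/
def itemRight (c : HomCode) (x : CtxItem) : CtxItem :=
  (tableRight c (x.1.getD c.one 0), 0, x.2.1 + x.2.2)

/-- The operations `pairOps` on tables. -/
def itemOps (c : HomCode) (f : Bool) (x y : PairItem) : List PairItem :=
  [(x.1 || y.1, itemMul c x.2.1 y.2.1, itemMul c x.2.2 y.2.2),
   (false, itemLeft c x.2.1, itemLeft c (bif f then y.2.1 else x.2.1)),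
   (false, itemRight c x.2.1, itemRight c (bif f then x.2.1 else y.2.1))]

/-- The pairs of a call letter and a return letter. -/
def letterPairs (c : HomCode) : List (ℕ × ℕ) :=
  (List.range c.numCall).flatMap fun a => (List.range c.numRet).map fun b => (a, b)

/-- The generators `pairGens` on tables. -/
def itemGens (c : HomCode) (f : Bool) : List PairItem :=
  (false, (List.range c.size, 0, 0), (List.range c.size, 0, 0)) ::
    ((List.range c.numInt).map (fun i => (false, (tableLeft c (c.phi.getD i 0), 1, 0),
      (tableLeft c (c.phi.getD i 0), 1, 0))) ++
    (letterPairs c).flatMap fun x => (letterPairs c).flatMap fun y =>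
      bif (bif f then decide (x.2 = y.2) else decide (x.1 = y.1)) then
        [(true, (tablePair c x.1 x.2, 1, 1), (tablePair c y.1 y.2, 1, 1))] else [])

/-- The data on the pairs of contexts generated in `k` steps. -/
def itemList (c : HomCode) (f : Bool) (k : ℕ) : List PairItem :=
  growList (itemOps c f) k (itemGens c f)

section Primrec

variable {α : Type} [Primcodable α] {c : α → HomCode} {f : α → Bool}

@[fun_prop]
theorem primrec_tableComp {n : α → ℕ} {s t : α → List ℕ} (hn : Primrec n) (hs : Primrec s)
    (ht : Primrec t) : Primrec fun a => tableComp (n a) (s a) (t a) := by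
  unfold tableComp
  fun_prop

@[fun_prop]
theorem primrec_tableLeft {r : α → ℕ} (hc : Primrec c) (hr : Primrec r) :
    Primrec fun a => tableLeft (c a) (r a) := by
  unfold tableLeft
  fun_prop

@[fun_prop]
theorem primrec_tableRight {r : α → ℕ} (hc : Primrec c) (hr : Primrec r) :
    Primrec fun a => tableRight (c a) (r a) := by
  unfold tableRight
  fun_prop

@[fun_prop]
theorem primrec_tablePair {r s : α → ℕ} (hc : Primrec c) (hr : Primrec r) (hs : Primrec s) :
    Primrec fun a => tablePair (c a) (r a) (s a) := by
  unfold tablePair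
  fun_prop

@[fun_prop]
theorem primrec_letterPairs (hc : Primrec c) : Primrec fun a => letterPairs (c a) := by
  unfold letterPairs
  fun_prop

@[fun_prop]
theorem primrec_itemOps {x y : α → PairItem} (hc : Primrec c) (hf : Primrec f) (hx : Primrec x)
    (hy : Primrec y) : Primrec fun a => itemOps (c a) (f a) (x a) (y a) := by
  unfold itemOps itemMul itemLeft itemRight
  fun_prop

@[fun_prop]
theorem primrec_itemGens (hc : Primrec c) (hf : Primrec f) :
    Primrec fun a => itemGens (c a) (f a) := by
  unfold itemGens
  fun_prop

@[fun_prop]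
theorem primrec_itemList {k : α → ℕ} (hc : Primrec c) (hf : Primrec f) (hk : Primrec k) :
    Primrec fun a => itemList (c a) (f a) (k a) := by
  unfold itemList
  fun_prop

end Primrec

/-! ### The tables represent the morphism -/

section Tables

variable {R : Type} {n : ℕ}

/-- The value table of an operation. -/
def opTable (e : Fin n ≃ R) (g : Function.End R) : List ℕ := fnTable e g

@[simp]
theorem getD_opTable (e : Fin n ≃ R) (g : Function.End R) (r : R) (d : ℕ) :
    (opTable e g).getD (e.symm r) d = e.symm (g r) :=
  (getD_ofFn _ _ _).trans (congrArg (fun r => (e.symm (g r) : ℕ)) (e.apply_symm_apply r))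

theorem opTable_injective (e : Fin n ≃ R) {f g : Function.End R} (h : opTable e f = opTable e g) :
    f = g := by
  funext r
  have := congrArg (fun l => l.getD (e.symm r) 0) h
  simp only [getD_opTable] at this
  exact e.symm.injective (Fin.ext this)

/-- On genuine tables the reduction modulo n does nothing. It is built into the algorithms so that
even a meaningless code produces tables of functions on n points, which the search for a certificate
relies on. -/
theorem map_range_eq_opTable (e : Fin n ≃ R) {F : ℕ → ℕ} {g : Function.End R}
    (H : ∀ r, F (e.symm r) = e.symm (g r)) :
    (List.range n).map (fun i => F i % n) = opTable e g := by
  rw [map_range_eq_ofFn]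
  refine congrArg List.ofFn ?_
  funext i
  have := H (e i)
  rw [Equiv.symm_apply_apply] at this
  rw [this, Nat.mod_eq_of_lt (Fin.is_lt _)]

theorem tableComp_opTable (e : Fin n ≃ R) (f g : Function.End R) :
    tableComp n (opTable e f) (opTable e g) = opTable e (f * g) :=
  map_range_eq_opTable e fun r => by
    rw [getD_opTable, getD_opTable]
    rfl

end Tables

section Items

variable {c : HomCode} {S : VPAlphabet} {N : LetterNumbering S} {R : Type} [Monoid R] {n : ℕ}
  {e : Fin n ≃ R} {A : ExtAlgebra R} {h : ExtHom (wordExt S) A}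

theorem tableLeft_eq (hc : c.Presents N e h) (r : R) :
    tableLeft c (e.symm r) = opTable e (leftMult r) := by
  rw [tableLeft, hc.size]
  refine map_range_eq_opTable e fun s => ?_
  rw [hc.mul, getD_ofFn, getD_ofFn]
  simp [leftMult]

theorem tableRight_eq (hc : c.Presents N e h) (r : R) :
    tableRight c (e.symm r) = opTable e (rightMult r) := by
  rw [tableRight, hc.size]
  refine map_range_eq_opTable e fun s => ?_
  rw [hc.mul, getD_ofFn, getD_ofFn]
  simp [rightMult]

theorem tablePair_eq (hc : c.Presents N e h) (a : Fin N.numCall) (b : Fin N.numRet) :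
    tablePair c a b = opTable e (ctxOp h (.pair (N.call a) (N.ret b))) := by
  rw [tablePair, hc.size]
  refine map_range_eq_opTable e fun s => ?_
  rw [hc.psi, getD_ofFn, getD_ofFn]
  exact getD_opTable e _ s 0

/-- The data of a context. -/
def encItem (e : Fin n ≃ R) (h : ExtHom (wordExt S) A) (σ : Context S) : CtxItem :=
  (opTable e (ctxOp h σ), σ.u.length, σ.v.length)

/-- The data of a pair of contexts. -/
def encPair (e : Fin n ≃ R) (h : ExtHom (wordExt S) A) (x : Context S × Context S) : PairItem :=
  (decide (0 < height x.1.u), encItem e h x.1, encItem e h x.2)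

theorem itemMul_encItem (hc : c.Presents N e h) (σ τ : Context S) :
    itemMul c (encItem e h σ) (encItem e h τ) = encItem e h (σ.mul τ) := by
  simp only [itemMul, encItem, hc.size, tableComp_opTable, ctxOp_mul]
  simp [Context.mul, add_comm]

theorem itemLeft_encItem (hc : c.Presents N e h) (σ : Context S) :
    itemLeft c (encItem e h σ) = encItem e h (.ofLeft σ.word) := by
  rw [itemLeft, encItem, hc.one, getD_opTable, tableLeft_eq hc, encItem, ctxOp_ofLeft, phi_word]
  simp [Context.ofLeft, Context.word]

theorem itemRight_encItem (hc : c.Presents N e h) (σ : Context S) :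
    itemRight c (encItem e h σ) = encItem e h (.ofRight σ.word) := by
  rw [itemRight, encItem, hc.one, getD_opTable, tableRight_eq hc, encItem, ctxOp_ofRight, phi_word]
  simp [Context.ofRight, Context.word]

/-- The sign of Δ(u) can be tracked by a boolean because heights of contexts are nonnegative: a sum
is positive iff one summand is. The contexts (w,ε) and (ε,w) have height zero. -/
theorem itemOps_encPair (hc : c.Presents N e h) (f : Bool) (x y : Context S × Context S) :
    itemOps c f (encPair e h x) (encPair e h y) = (pairOps f x y).map (encPair e h) := by
  have h1 : (decide (0 < height x.1.u) || decide (0 < height y.1.u)) =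
      decide (0 < height (x.1.mul y.1).u) := by
    have hx := x.1.height_nonneg
    have hy := y.1.height_nonneg
    rw [Bool.eq_iff_iff]
    simp only [Bool.or_eq_true, decide_eq_true_eq, Context.mul, height_append]
    omega
  have h2 : ∀ w : WMWord S, decide (0 < height (Context.ofLeft w).u) = false := fun w => by
    simp [Context.ofLeft, w.2.height_eq_zero]
  have h3 : ∀ w : WMWord S, decide (0 < height (Context.ofRight w).u) = false := fun w => by
    simp [Context.ofRight]
  cases f <;> simp only [itemOps, encPair, pairOps, List.map_cons, List.map_nil, cond_true,
    cond_false, itemMul_encItem hc, itemLeft_encItem hc, itemRight_encItem hc, h1, h2, h3]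

theorem mem_itemGens (hc : c.Presents N e h) (f : Bool) (z : PairItem) :
    z ∈ itemGens c f ↔ ∃ x ∈ pairGens (S := S) f, z = encPair e h x := by
  have h0 : encPair e h (.ofLeft 1, .ofLeft 1) =
      (false, (List.range c.size, 0, 0), (List.range c.size, 0, 0)) := by
    have : opTable e (leftMult 1) = List.range c.size := by
      have h := map_range_eq_opTable e (F := fun i => i) (g := leftMult 1) fun r => by simp [leftMult]
      rw [← h, hc.size]
      refine (List.map_congr_left fun i hi => ?_).trans (List.map_id _)
      exact Nat.mod_eq_of_lt (List.mem_range.1 hi)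
    simp only [encPair, encItem, ctxOp_ofLeft, map_one, this]
    rfl
  have h1 : ∀ i : Fin N.numInt,
      encPair e h (.ofLeft (.ofInt (N.int i)), .ofLeft (.ofInt (N.int i))) =
      (false, (tableLeft c (c.phi.getD i 0), 1, 0), (tableLeft c (c.phi.getD i 0), 1, 0)) := by
    intro i
    rw [hc.phi, getD_ofFn, tableLeft_eq hc, ← ctxOp_ofLeft]
    rfl
  have h2 : ∀ (a a' : Fin N.numCall) (b b' : Fin N.numRet),
      encPair e h (.pair (N.call a) (N.ret b), .pair (N.call a') (N.ret b')) =
      (true, (tablePair c a b, 1, 1), (tablePair c a' b', 1, 1)) := by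
    intro a a' b b'
    rw [tablePair_eq hc, tablePair_eq hc]
    rfl
  have h3 : ∀ x : ℕ × ℕ, x ∈ letterPairs c ↔ x.1 < N.numCall ∧ x.2 < N.numRet := by
    rintro ⟨a, b⟩
    simp [letterPairs, hc.numCall, hc.numRet]
  simp only [itemGens, List.mem_cons, List.mem_append, List.mem_map, List.mem_flatMap,
    List.mem_range, hc.numInt, h3]
  constructor
  · rintro (rfl | ⟨i, hi, rfl⟩ | ⟨⟨a, b⟩, ⟨ha, hb⟩, ⟨a', b'⟩, ⟨ha', hb'⟩, hz⟩)
    · exact ⟨_, Or.inl rfl, h0.symm⟩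
    · exact ⟨_, Or.inr (Or.inl ⟨_, rfl⟩), (h1 ⟨i, hi⟩).symm⟩
    · refine ⟨(.pair (N.call ⟨a, ha⟩) (N.ret ⟨b, hb⟩), .pair (N.call ⟨a', ha'⟩) (N.ret ⟨b', hb'⟩)),
        Or.inr (Or.inr ⟨_, _, _, _, ?_, rfl⟩), ?_⟩
      · cases f <;> simp only [cond_true, cond_false] at hz ⊢
        · by_cases haa : a = a'
          · simp [haa]
          · simp [haa] at hz
        · by_cases hbb : b = b'
          · simp [hbb]
          · simp [hbb] at hz
      · rw [h2]
        revert hz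
        cases (bif f then decide (b = b') else decide (a = a')) <;> simp
  · rintro ⟨x, rfl | ⟨i, rfl⟩ | ⟨a, a', b, b', hf, rfl⟩, rfl⟩
    · exact Or.inl h0
    · obtain ⟨i, rfl⟩ := N.int.surjective i
      exact Or.inr (Or.inl ⟨i, i.2, (h1 i).symm⟩)
    · obtain ⟨a, rfl⟩ := N.call.surjective a
      obtain ⟨a', rfl⟩ := N.call.surjective a'
      obtain ⟨b, rfl⟩ := N.ret.surjective b
      obtain ⟨b', rfl⟩ := N.ret.surjective b'
      refine Or.inr (Or.inr ⟨(a, b), ⟨a.2, b.2⟩, (a', b'), ⟨a'.2, b'.2⟩, ?_⟩)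
      rw [h2]
      cases f <;> simp only [cond_true, cond_false, EmbeddingLike.apply_eq_iff_eq] at hf <;>
        simp [hf]

theorem mem_itemList (hc : c.Presents N e h) (f : Bool) (k : ℕ) (z : PairItem) :
    z ∈ itemList c f k ↔ ∃ x ∈ growSet (pairOps f) (pairGens (S := S) f) k, z = encPair e h x :=
  mem_growList_iff (itemOps_encPair hc f) (mem_itemGens hc f) k z

/-! ### Reachable idempotents -/

/-- The table `t` is that of a reachable idempotent. -/
def tableGood (c : HomCode) (l : List ℕ) (t : List ℕ) : Bool :=
  decide (tableComp c.size t t = t) && c.ops.any fun s => (List.range c.size).any fun i =>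
    l.any fun j => decide (j = s.getD (t.getD i 0) 0)

@[fun_prop]
theorem primrec_tableGood {α : Type} [Primcodable α] {c : α → HomCode} {l t : α → List ℕ}
    (hc : Primrec c) (hl : Primrec l) (ht : Primrec t) :
    Primrec fun a => tableGood (c a) (l a) (t a) := by
  unfold tableGood
  fun_prop

theorem tableGood_iff (hc : c.Presents N e h) {l : List ℕ} {F : Set R} (hl : ListsSet e l F)
    (g : A.ops) : tableGood c l (opTable e g.1) = true ↔
      IsIdempotentElem g ∧ ReachableOp A F g := by
  rw [tableGood, Bool.and_eq_true, decide_eq_true_eq, hc.size, tableComp_opTable]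
  refine and_congr ?_ ?_
  · exact ⟨fun h => Subtype.ext (opTable_injective e h),
      fun h => congrArg (fun g : A.ops => opTable e g.1) h⟩
  · simp only [List.any_eq_true, List.mem_range, decide_eq_true_eq, exists_eq_right]
    have key : ∀ (f : Function.End R) (r : R), (opTable e f).getD ((opTable e g.1).getD (e.symm r) 0) 0 ∈ l ↔
        f (g.1 r) ∈ F := by
      intro f r
      rw [getD_opTable, getD_opTable, hl]
      refine ⟨?_, fun h => ⟨_, h, rfl⟩⟩
      rintro ⟨x, hx, h⟩
      rwa [← e.symm.injective (Fin.ext h)]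
    constructor
    · rintro ⟨s, hs, i, hi, hsi⟩
      obtain ⟨f, hf, rfl : s = opTable e f⟩ := (hc.ops s).1 hs
      refine ⟨e ⟨i, hi⟩, f, hf, (key f _).1 ?_⟩
      rwa [Equiv.symm_apply_apply]
    · rintro ⟨r, f, hf, hfr⟩
      exact ⟨_, (hc.ops _).2 ⟨f, hf, rfl⟩, e.symm r, (e.symm r).2, (key f r).2 hfr⟩

end Items

/-! ### A bound on the number of generation steps -/

section Saturation

variable {S : VPAlphabet} {R : Type} [Monoid R] {A : ExtAlgebra R} (h : ExtHom (wordExt S) A)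

/-- The sign of the height and the operations of a pair of contexts. -/
def pairIndex (x : Context S × Context S) : Bool × Function.End R × Function.End R :=
  (decide (0 < height x.1.u), ctxOp h x.1, ctxOp h x.2)

/-- The lengths of the components of a context. -/
def ctxLen (σ : Context S) : ℚ × ℚ := (σ.u.length, σ.v.length)

/-- The lengths of the components of a pair of contexts. -/
def pairLen (x : Context S × Context S) : (ℚ × ℚ) × (ℚ × ℚ) := (ctxLen x.1, ctxLen x.2)

theorem ctxLen_mul (σ τ : Context S) : ctxLen (σ.mul τ) = ctxLen σ + ctxLen τ := by
  simp [ctxLen, Context.mul, add_comm]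

theorem ctxLen_ofLeft (σ : Context S) :
    ctxLen (.ofLeft σ.word) = ((ctxLen σ).1 + (ctxLen σ).2, 0) := by
  simp [ctxLen, Context.ofLeft, Context.word]

theorem ctxLen_ofRight (σ : Context S) :
    ctxLen (.ofRight σ.word) = (0, (ctxLen σ).1 + (ctxLen σ).2) := by
  simp [ctxLen, Context.ofRight, Context.word]

theorem pairIndex_mul (x y : Context S × Context S) :
    pairIndex h (x.1.mul y.1, x.2.mul y.2) =
      ((pairIndex h x).1 || (pairIndex h y).1, (pairIndex h x).2 * (pairIndex h y).2) := by
  have hx := x.1.height_nonneg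
  have hy := y.1.height_nonneg
  refine Prod.ext ?_ (Prod.ext (ctxOp_mul h _ _) (ctxOp_mul h _ _))
  rw [pairIndex, Bool.eq_iff_iff]
  simp only [pairIndex, Bool.or_eq_true, decide_eq_true_eq, Context.mul, height_append]
  omega

theorem pairIndex_ofLeft (σ τ : Context S) : pairIndex h (.ofLeft σ.word, .ofLeft τ.word) =
    (false, leftMult (ctxOp h σ 1), leftMult (ctxOp h τ 1)) := by
  rw [pairIndex, ctxOp_ofLeft, ctxOp_ofLeft, phi_word, phi_word]
  simp [Context.ofLeft, σ.word.2.height_eq_zero]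

theorem pairIndex_ofRight (σ τ : Context S) : pairIndex h (.ofRight σ.word, .ofRight τ.word) =
    (false, rightMult (ctxOp h σ 1), rightMult (ctxOp h τ 1)) := by
  rw [pairIndex, ctxOp_ofRight, ctxOp_ofRight, phi_word, phi_word]
  simp [Context.ofRight]

/-- Homogenised affine maps. -/
theorem exists_linearMap_affine {X V : Type} [AddCommGroup V] [Module ℚ V] (o : X → X)
    (T : V →ₗ[ℚ] V) (w : V) : ∃ α : (X →₀ ℚ × V) →ₗ[ℚ] (X →₀ ℚ × V),
      ∀ x v, α (Finsupp.single x (1, v)) = Finsupp.single (o x) (1, T v + w) := by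
  obtain ⟨α, hα⟩ := exists_linearMap_single o
    ((LinearMap.fst ℚ ℚ V).prod (T ∘ₗ LinearMap.snd ℚ ℚ V + (LinearMap.fst ℚ ℚ V).smulRight w))
  exact ⟨α, fun x v => by simp [hα]⟩

/-- Linear functionals on the lengths that vanish on all pairs of contexts with given operations
that are generated in a bounded number of steps vanish on all such pairs. -/
theorem functional_eq_zero [Finite R] (f : Bool) {B : ℕ}
    (hB : 10 * (Nat.card R ^ Nat.card R * Nat.card R ^ Nat.card R) ≤ B)
    (ℓ : (ℚ × (ℚ × ℚ) × (ℚ × ℚ)) →ₗ[ℚ] ℚ) {x : Context S × Context S}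
    (hx : x ∈ growAll (pairOps f) (pairGens f))
    (hℓ : ∀ y ∈ growSet (pairOps f) (pairGens f) B, pairIndex h y = pairIndex h x →
      ℓ (1, pairLen y) = 0) : ℓ (1, pairLen x) = 0 := by
  classical
  have hfin : Finite (Function.End R) := inferInstanceAs (Finite (R → R))
  have := Fintype.ofFinite (Function.End R)
  have hcard : Fintype.card (Function.End R) = Nat.card R ^ Nat.card R := by
    rw [← Nat.card_eq_fintype_card]
    exact (Nat.card_fun (α := R) (β := R))
  let X := Bool × Function.End R × Function.End R
  let Φ : Context S × Context S → (X →₀ ℚ × (ℚ × ℚ) × (ℚ × ℚ)) := fun x =>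
    Finsupp.single (pairIndex h x) (1, pairLen x)
  -- The factor 10 is 2 · 5: two values of the sign, and five coordinates for the constant and the
  -- four lengths.
  have hrank : Module.finrank ℚ (X →₀ ℚ × (ℚ × ℚ) × (ℚ × ℚ)) ≤ B := by
    refine le_trans (le_of_eq ?_) hB
    rw [Module.finrank_finsupp]
    simp only [X, Fintype.card_prod, Fintype.card_bool, hcard, Module.finrank_prod,
      Module.finrank_self]
    ring
  have key : Φ x ∈ Submodule.span ℚ (Φ '' growSet (pairOps f) (pairGens f) B) := by
    refine span_growSet_eq Φ ?_ hrank hx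
    let P : (ℚ × ℚ) →ₗ[ℚ] ℚ × ℚ :=
      (LinearMap.fst ℚ ℚ ℚ + LinearMap.snd ℚ ℚ ℚ).prod 0
    let P' : (ℚ × ℚ) →ₗ[ℚ] ℚ × ℚ :=
      LinearMap.prod 0 (LinearMap.fst ℚ ℚ ℚ + LinearMap.snd ℚ ℚ ℚ)
    have hP : ∀ σ : Context S, ctxLen (.ofLeft σ.word) = P (ctxLen σ) := ctxLen_ofLeft
    have hP' : ∀ σ : Context S, ctxLen (.ofRight σ.word) = P' (ctxLen σ) := ctxLen_ofRight
    let p₁ := LinearMap.fst ℚ (ℚ × ℚ) (ℚ × ℚ)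
    intro x y z hz
    -- A map on pairs lifts to a linear map as soon as the new index depends only on the old one and
    -- the new lengths depend affinely on the old ones.
    have aff : ∀ (k : Context S × Context S → Context S × Context S) (o : X → X)
        (T : ((ℚ × ℚ) × (ℚ × ℚ)) →ₗ[ℚ] (ℚ × ℚ) × (ℚ × ℚ)) (w : (ℚ × ℚ) × (ℚ × ℚ)),
        (∀ t, pairIndex h (k t) = o (pairIndex h t)) → (∀ t, pairLen (k t) = T (pairLen t) + w) →
        ∃ α : (X →₀ ℚ × (ℚ × ℚ) × (ℚ × ℚ)) →ₗ[ℚ] _, ∀ t, α (Φ t) = Φ (k t) := by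
      intro k o T w h1 h2
      obtain ⟨α, hα⟩ := exists_linearMap_affine o T w
      exact ⟨α, fun t => by simp only [Φ, hα, h1, h2]⟩
    simp only [pairOps, List.mem_cons, List.not_mem_nil, or_false] at hz
    rcases hz with rfl | rfl | rfl
    · obtain ⟨α, hα⟩ := aff (fun t => (t.1.mul y.1, t.2.mul y.2))
        (fun i => (i.1 || (pairIndex h y).1, i.2 * (pairIndex h y).2)) LinearMap.id (pairLen y)
        (fun t => pairIndex_mul h t y)
        (fun t => Prod.ext (ctxLen_mul _ _) (ctxLen_mul _ _))
      obtain ⟨β, hβ⟩ := aff (fun t => (x.1.mul t.1, x.2.mul t.2))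
        (fun i => ((pairIndex h x).1 || i.1, (pairIndex h x).2 * i.2)) LinearMap.id (pairLen x)
        (fun t => pairIndex_mul h x t)
        (fun t => Prod.ext ((ctxLen_mul _ _).trans (add_comm _ _))
          ((ctxLen_mul _ _).trans (add_comm _ _)))
      exact ⟨α, β, hα x, hβ y, fun t => ⟨_, List.mem_cons_self, hα t⟩,
        fun t => ⟨_, List.mem_cons_self, hβ t⟩⟩
    -- Only words of first contexts enter this operation. For equal first components the varying
    -- word is used twice; otherwise the word of y enters as a constant.
    · obtain ⟨α, hα⟩ : ∃ α : (X →₀ ℚ × (ℚ × ℚ) × (ℚ × ℚ)) →ₗ[ℚ] _, ∀ t, α (Φ t) =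
          Φ (.ofLeft t.1.word, .ofLeft (bif f then y.1.word else t.1.word)) := by
        cases f
        · exact aff _ (fun i => (false, leftMult (i.2.1 1), leftMult (i.2.1 1)))
            ((P ∘ₗ p₁).prod (P ∘ₗ p₁)) 0 (fun t => pairIndex_ofLeft h _ _)
            (fun t => by simp [pairLen, hP, p₁])
        · exact aff _ (fun i => (false, leftMult (i.2.1 1), leftMult (ctxOp h y.1 1)))
            ((P ∘ₗ p₁).prod 0) (0, P (ctxLen y.1)) (fun t => pairIndex_ofLeft h _ _)
            (fun t => by simp [pairLen, hP, p₁])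
      obtain ⟨β, hβ⟩ : ∃ β : (X →₀ ℚ × (ℚ × ℚ) × (ℚ × ℚ)) →ₗ[ℚ] _, ∀ t, β (Φ t) =
          Φ (.ofLeft x.1.word, .ofLeft (bif f then t.1.word else x.1.word)) := by
        cases f
        · exact aff _ (fun i => (false, leftMult (ctxOp h x.1 1), leftMult (ctxOp h x.1 1)))
            0 (P (ctxLen x.1), P (ctxLen x.1)) (fun t => pairIndex_ofLeft h _ _)
            (fun t => by simp [pairLen, hP])
        · exact aff _ (fun i => (false, leftMult (ctxOp h x.1 1), leftMult (i.2.1 1)))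
            (LinearMap.prod 0 (P ∘ₗ p₁)) (P (ctxLen x.1), 0) (fun t => pairIndex_ofLeft h _ _)
            (fun t => by simp [pairLen, hP, p₁])
      exact ⟨α, β, hα x, hβ y, fun t => ⟨_, List.mem_cons_of_mem _ List.mem_cons_self, hα t⟩,
        fun t => ⟨_, List.mem_cons_of_mem _ List.mem_cons_self, hβ t⟩⟩
    · obtain ⟨α, hα⟩ : ∃ α : (X →₀ ℚ × (ℚ × ℚ) × (ℚ × ℚ)) →ₗ[ℚ] _, ∀ t, α (Φ t) =
          Φ (.ofRight t.1.word, .ofRight (bif f then t.1.word else y.1.word)) := by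
        cases f
        · exact aff _ (fun i => (false, rightMult (i.2.1 1), rightMult (ctxOp h y.1 1)))
            ((P' ∘ₗ p₁).prod 0) (0, P' (ctxLen y.1)) (fun t => pairIndex_ofRight h _ _)
            (fun t => by simp [pairLen, hP', p₁])
        · exact aff _ (fun i => (false, rightMult (i.2.1 1), rightMult (i.2.1 1)))
            ((P' ∘ₗ p₁).prod (P' ∘ₗ p₁)) 0 (fun t => pairIndex_ofRight h _ _)
            (fun t => by simp [pairLen, hP', p₁])
      obtain ⟨β, hβ⟩ : ∃ β : (X →₀ ℚ × (ℚ × ℚ) × (ℚ × ℚ)) →ₗ[ℚ] _, ∀ t, β (Φ t) =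
          Φ (.ofRight x.1.word, .ofRight (bif f then x.1.word else t.1.word)) := by
        cases f
        · exact aff _ (fun i => (false, rightMult (ctxOp h x.1 1), rightMult (i.2.1 1)))
            (LinearMap.prod 0 (P' ∘ₗ p₁)) (P' (ctxLen x.1), 0) (fun t => pairIndex_ofRight h _ _)
            (fun t => by simp [pairLen, hP', p₁])
        · exact aff _ (fun i => (false, rightMult (ctxOp h x.1 1), rightMult (ctxOp h x.1 1)))
            0 (P' (ctxLen x.1), P' (ctxLen x.1)) (fun t => pairIndex_ofRight h _ _)
            (fun t => by simp [pairLen, hP'])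
      exact ⟨α, β, hα x, hβ y, fun t => ⟨_, List.mem_cons_of_mem _
        (List.mem_cons_of_mem _ List.mem_cons_self), hα t⟩,
        fun t => ⟨_, List.mem_cons_of_mem _ (List.mem_cons_of_mem _ List.mem_cons_self), hβ t⟩⟩
  -- Evaluation at the index of x kills the vectors of pairs with another index, so only pairs with
  -- the same index matter.
  have hle : Submodule.span ℚ (Φ '' growSet (pairOps f) (pairGens f) B) ≤
      LinearMap.ker (ℓ ∘ₗ Finsupp.lapply (R := ℚ) (pairIndex h x)) := by
    refine Submodule.span_le.2 ?_
    rintro _ ⟨y, hy, rfl⟩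
    by_cases hyx : pairIndex h y = pairIndex h x
    · simpa [Φ, hyx] using hℓ y hy hyx
    · simp [Φ, Finsupp.single_eq_of_ne (Ne.symm hyx)]
  simpa [Φ] using hle key

end Saturation

/-! ### Length-synchronicity -/

/-- A sufficient number of generation steps for deciding length-synchronicity. -/
def itemBound (c : HomCode) : ℕ := 10 * (c.size ^ c.size * c.size ^ c.size)

@[fun_prop]
theorem primrec_itemBound {α : Type} [Primcodable α] {c : α → HomCode} (hc : Primrec c) :
    Primrec fun a => itemBound (c a) := by
  unfold itemBound
  fun_prop

/-- Two items violate length-synchronicity. -/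
def syncWitness (c : HomCode) (l : List ℕ) (x y : PairItem) : Bool :=
  x.1 && (y.1 && (decide (x.2.1.1 = y.2.1.1) && (tableGood c l x.2.1.1 &&
    !(decide (x.2.1.2.1 * y.2.1.2.2 = y.2.1.2.1 * x.2.1.2.2)))))

/-- The lengths recorded in two items. -/
def itemLengths (x y : PairItem) : ℕ × ℕ × ℕ × ℕ :=
  (x.2.1.2.1, x.2.1.2.2, y.2.1.2.1, y.2.1.2.2)

/-- Some pair of short contexts violates length-synchronicity. -/
def syncFails (p : HomCode × List ℕ) : Bool :=
  (itemList p.1 false (itemBound p.1)).any fun x =>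
    (itemList p.1 false (itemBound p.1)).any fun y => syncWitness p.1 p.2 x y

/-- Two items violate length-synchronicity, and have the given lengths. -/
def syncWitnessAt (p : HomCode × List ℕ) (k : ℕ × ℕ × ℕ × ℕ) (x y : PairItem) : Bool :=
  syncWitness p.1 p.2 x y && decide (k = itemLengths x y)

/-- Some pair of short contexts with the given lengths violates length-synchronicity. -/
def syncFailsAt (p : HomCode × List ℕ) (k : ℕ × ℕ × ℕ × ℕ) : Bool :=
  (itemList p.1 false (itemBound p.1)).any fun x =>
    (itemList p.1 false (itemBound p.1)).any fun y => syncWitnessAt p k x y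

/-- An item violates weak length-synchronicity. -/
def weakWitness (c : HomCode) (l : List ℕ) (x : PairItem) : Bool :=
  x.1 && (decide (x.2.1.1 = x.2.2.1) && (tableGood c l x.2.1.1 && !(decide (x.2.1 = x.2.2))))

/-- Some short context violates weak length-synchronicity. -/
def weakFails (p : HomCode × List ℕ) : Bool :=
  (itemList p.1 false (itemBound p.1)).any (weakWitness p.1 p.2) ||
    (itemList p.1 true (itemBound p.1)).any (weakWitness p.1 p.2)

@[fun_prop]
theorem primrec_syncWitness {α : Type} [Primcodable α] {c : α → HomCode} {l : α → List ℕ}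
    {x y : α → PairItem} (hc : Primrec c) (hl : Primrec l) (hx : Primrec x) (hy : Primrec y) :
    Primrec fun a => syncWitness (c a) (l a) (x a) (y a) := by
  unfold syncWitness
  fun_prop

@[fun_prop]
theorem primrec_itemLengths {α : Type} [Primcodable α] {x y : α → PairItem} (hx : Primrec x)
    (hy : Primrec y) : Primrec fun a => itemLengths (x a) (y a) := by
  unfold itemLengths
  fun_prop

@[fun_prop]
theorem primrec_syncWitnessAt {α : Type} [Primcodable α] {p : α → HomCode × List ℕ}
    {k : α → ℕ × ℕ × ℕ × ℕ} {x y : α → PairItem} (hp : Primrec p) (hk : Primrec k)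
    (hx : Primrec x) (hy : Primrec y) :
    Primrec fun a => syncWitnessAt (p a) (k a) (x a) (y a) := by
  unfold syncWitnessAt
  fun_prop

@[fun_prop]
theorem primrec_weakWitness {α : Type} [Primcodable α] {c : α → HomCode} {l : α → List ℕ}
    {x : α → PairItem} (hc : Primrec c) (hl : Primrec l) (hx : Primrec x) :
    Primrec fun a => weakWitness (c a) (l a) (x a) := by
  unfold weakWitness
  fun_prop

theorem primrec_syncFails : Primrec syncFails := by
  unfold syncFails
  fun_prop

theorem primrec_weakFails : Primrec weakFails := by
  unfold weakFails
  fun_prop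

theorem primrec_syncFailsAt :
    Primrec fun q : (HomCode × List ℕ) × (ℕ × ℕ × ℕ × ℕ) => syncFailsAt q.1 q.2 := by
  unfold syncFailsAt
  fun_prop

/-! ### Correctness of the tests for length-synchronicity -/

section Synchronous

variable {c : HomCode} {S : VPAlphabet} {N : LetterNumbering S} {R : Type} [Monoid R] {n : ℕ}
  {e : Fin n ≃ R} {A : ExtAlgebra R} {h : ExtHom (wordExt S) A} {l : List ℕ} {F : Set R}

theorem itemBound_ge (hc : c.Presents N e h) :
    10 * (Nat.card R ^ Nat.card R * Nat.card R ^ Nat.card R) ≤ itemBound c := by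
  rw [← Nat.card_congr e, Nat.card_fin, itemBound, hc.size]

theorem syncFailsAt_iff (hc : c.Presents N e h) (hl : ListsSet e l F) (k : ℕ × ℕ × ℕ × ℕ) :
    syncFailsAt (c, l) k = true ↔ ∃ x ∈ growSet (pairOps false) (pairGens (S := S) false)
      (itemBound c), ∃ y ∈ growSet (pairOps false) (pairGens (S := S) false) (itemBound c),
      (0 < height x.1.u ∧ 0 < height y.1.u ∧ h.psi x.1.extOp = h.psi y.1.extOp ∧
      (IsIdempotentElem (h.psi x.1.extOp) ∧ ReachableOp A F (h.psi x.1.extOp)) ∧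
      x.1.u.length * y.1.v.length ≠ y.1.u.length * x.1.v.length) ∧
      k = (x.1.u.length, x.1.v.length, y.1.u.length, y.1.v.length) := by
  have key : ∀ x y : Context S × Context S, syncWitness c l (encPair e h x) (encPair e h y) = true ↔
      (0 < height x.1.u ∧ 0 < height y.1.u ∧ h.psi x.1.extOp = h.psi y.1.extOp ∧
      (IsIdempotentElem (h.psi x.1.extOp) ∧ ReachableOp A F (h.psi x.1.extOp)) ∧
      x.1.u.length * y.1.v.length ≠ y.1.u.length * x.1.v.length) := by
    intro x y
    rw [← tableGood_iff hc hl]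
    simp only [syncWitness, Bool.and_eq_true, decide_eq_true_eq, Bool.not_eq_true',
      decide_eq_false_iff_not]
    simp only [encPair, encItem, decide_eq_true_eq]
    refine and_congr_right fun _ => and_congr_right fun _ => and_congr_left fun _ => ?_
    exact ⟨fun h => Subtype.ext (opTable_injective e h),
      fun h' => congrArg (fun g : A.ops => opTable e g.1) h'⟩
  simp only [syncFailsAt, syncWitnessAt, List.any_eq_true, mem_itemList hc, Bool.and_eq_true, decide_eq_true_eq]
  constructor
  · rintro ⟨_, ⟨x, hx, rfl⟩, _, ⟨y, hy, rfl⟩, h1, h2⟩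
    exact ⟨x, hx, y, hy, (key x y).1 h1, h2⟩
  · rintro ⟨x, hx, y, hy, h1, h2⟩
    exact ⟨_, ⟨x, hx, rfl⟩, _, ⟨y, hy, rfl⟩, (key x y).2 h1, h2⟩

theorem syncFails_iff (p : HomCode × List ℕ) :
    syncFails p = true ↔ ∃ k, syncFailsAt p k = true := by
  simp only [syncFails, syncFailsAt, syncWitnessAt, List.any_eq_true, Bool.and_eq_true, decide_eq_true_eq]
  constructor
  · rintro ⟨x, hx, y, hy, h⟩
    exact ⟨_, x, hx, y, hy, h, rfl⟩
  · rintro ⟨k, x, hx, y, hy, h, -⟩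
    exact ⟨x, hx, y, hy, h⟩

/-- The algorithms compare ratios by cross-multiplication; positive Δ(u) forces v to be nonempty, so
the denominators are positive where this is applied. -/
theorem div_ne_div_iff_mul {k l k' l' : ℕ} (hl : 0 < l) (hl' : 0 < l') :
    (k : ℚ) / l ≠ (k' : ℚ) / l' ↔ k * l' ≠ k' * l := by
  rw [Ne, div_eq_div_iff (by positivity) (by positivity)]
  exact_mod_cast Iff.rfl

theorem lengthWitness_of_syncFailsAt (hc : c.Presents N e h) (hl : ListsSet e l F)
    {k : ℕ × ℕ × ℕ × ℕ} (hk : syncFailsAt (c, l) k = true) :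
    LengthWitness h F k.1 k.2.1 k.2.2.1 k.2.2.2 := by
  obtain ⟨x, -, y, -, ⟨h1, h2, h3, ⟨h4, h5⟩, h6⟩, rfl⟩ := (syncFailsAt_iff hc hl k).1 hk
  exact ⟨⟨Context.length_u_pos h1, Context.length_v_pos h1, Context.length_u_pos h2,
    Context.length_v_pos h2⟩, ⟨x.1, y.1, _, h4, h5, rfl, h3.symm, h1, h2, rfl, rfl, rfl, rfl⟩,
    (div_ne_div_iff_mul (Context.length_v_pos h1) (Context.length_v_pos h2)).2 h6⟩

theorem not_lengthSynchronous_of_lengthWitness {k l k' l' : ℕ} (hw : LengthWitness h F k l k' l') :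
    ¬ LengthSynchronous h F := by
  obtain ⟨-, ⟨σ, τ, g, h1, h2, h3, h4, h5, h6, rfl, rfl, rfl, rfl⟩, h7⟩ := hw
  exact fun hs => h7 (hs g h1 h2 σ h3 τ h4 h5 h6)

/-- For a fixed short context x, having the same ratio as x is a linear condition on lengths. If it
held for all short contexts with the given operation and positive Δ(u), it would hold for σ and τ,
whose ratios would then agree. Diagonal pairs with equal first components stand for single contexts.
-/
theorem exists_syncFailsAt (hc : c.Presents N e h) (hl : ListsSet e l F)
    (hs : ¬ LengthSynchronous h F) : ∃ k, syncFailsAt (c, l) k = true := by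
  have : Finite R := Finite.of_equiv _ e
  simp only [LengthSynchronous, LengthSynchronousSet, not_forall] at hs
  obtain ⟨g, h1, h2, σ, rfl, τ, hτ, h3, h4, h5⟩ := hs
  change h.psi τ.extOp = h.psi σ.extOp at hτ
  replace h5 := (div_ne_div_iff_mul (Context.length_v_pos h3) (Context.length_v_pos h4)).1 h5
  have hσ' := (mem_growAll_pairs false σ σ).2 rfl
  have hτ' := (mem_growAll_pairs false τ τ).2 rfl
  have hidx : pairIndex h (τ, τ) = pairIndex h (σ, σ) := by
    simp [pairIndex, ctxOp, hτ, h3, h4]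
  have hB := itemBound_ge hc
  have good : ∀ y : Context S × Context S, pairIndex h y = pairIndex h (σ, σ) →
      0 < height y.1.u ∧ h.psi y.1.extOp = h.psi σ.extOp := by
    intro y hy
    simp only [pairIndex, Prod.mk.injEq, h3, decide_true, decide_eq_true_eq] at hy
    exact ⟨hy.1, Subtype.ext hy.2.1⟩
  -- If no short pair had this index, the functional reading off the homogenising coordinate would
  -- vanish at σ, where it is 1.
  obtain ⟨x, hx, hxσ⟩ : ∃ x ∈ growSet (pairOps false) (pairGens (S := S) false) (itemBound c),
      pairIndex h x = pairIndex h (σ, σ) := by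
    by_contra! hne
    have := functional_eq_zero h false hB (LinearMap.fst ℚ ℚ _) hσ' fun y hy hy' =>
      absurd hy' (hne y hy)
    simp at this
  obtain ⟨y, hy, hyσ, hxy⟩ : ∃ y ∈ growSet (pairOps false) (pairGens (S := S) false) (itemBound c),
      pairIndex h y = pairIndex h (σ, σ) ∧
      x.1.u.length * y.1.v.length ≠ y.1.u.length * x.1.v.length := by
    by_contra! hall
    let ℓ : (ℚ × (ℚ × ℚ) × (ℚ × ℚ)) →ₗ[ℚ] ℚ :=
      ((x.1.u.length : ℚ) • LinearMap.snd ℚ ℚ ℚ - (x.1.v.length : ℚ) • LinearMap.fst ℚ ℚ ℚ) ∘ₗ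
        LinearMap.fst ℚ (ℚ × ℚ) (ℚ × ℚ) ∘ₗ LinearMap.snd ℚ ℚ _
    have hℓ : ∀ z : Context S × Context S, ℓ (1, pairLen z) = (x.1.u.length : ℚ) * z.1.v.length -
        x.1.v.length * z.1.u.length := fun z => by simp [ℓ, pairLen, ctxLen]
    have hz : ∀ y ∈ growSet (pairOps false) (pairGens (S := S) false) (itemBound c),
        pairIndex h y = pairIndex h (σ, σ) → ℓ (1, pairLen y) = 0 := by
      intro y hy hy'
      rw [hℓ, sub_eq_zero]
      have := hall y hy hy'
      rw [mul_comm (x.1.v.length : ℚ)]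
      exact_mod_cast this
    have e1 := functional_eq_zero h false hB ℓ hσ' hz
    have e2 := functional_eq_zero h false hB ℓ hτ' fun y hy hy' => hz y hy (hy'.trans hidx)
    rw [hℓ, sub_eq_zero] at e1 e2
    -- Positivity of both lengths of x permits cancelling them when the two proportionalities with x
    -- are combined.
    have hpos : (0 : ℚ) < x.1.u.length * x.1.v.length := by
      have h1 := Context.length_u_pos (good x hxσ).1
      have h2 := Context.length_v_pos (good x hxσ).1
      positivity
    refine h5 ?_
    have : (x.1.u.length * x.1.v.length : ℚ) * (σ.u.length * τ.v.length) =
        (x.1.u.length * x.1.v.length : ℚ) * (τ.u.length * σ.v.length) := by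
      calc _ = (x.1.v.length * σ.u.length : ℚ) * (x.1.u.length * τ.v.length) := by ring
        _ = _ := by rw [e2, ← e1]; ring
    exact_mod_cast mul_left_cancel₀ hpos.ne' this
  obtain ⟨hx1, hx2⟩ := good x hxσ
  obtain ⟨hy1, hy2⟩ := good y hyσ
  exact ⟨_, (syncFailsAt_iff hc hl _).2
    ⟨x, hx, y, hy, ⟨hx1, hy1, hx2.trans hy2.symm, hx2 ▸ ⟨h1, h2⟩, hxy⟩, rfl⟩⟩

theorem not_syncFails_iff (hc : c.Presents N e h) (hl : ListsSet e l F) :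
    (!syncFails (c, l)) = true ↔ LengthSynchronous h F := by
  rw [Bool.not_eq_true', ← Bool.not_eq_true, syncFails_iff, not_iff_comm]
  refine ⟨exists_syncFailsAt hc hl, ?_⟩
  rintro ⟨k, hk⟩
  exact not_lengthSynchronous_of_lengthWitness (lengthWitness_of_syncFailsAt hc hl hk)

/-! ### Weak length-synchronicity -/

theorem weakWitness_iff (hc : c.Presents N e h) (hl : ListsSet e l F) (x : Context S × Context S) :
    weakWitness c l (encPair e h x) = true ↔ 0 < height x.1.u ∧
      h.psi x.1.extOp = h.psi x.2.extOp ∧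
      (IsIdempotentElem (h.psi x.1.extOp) ∧ ReachableOp A F (h.psi x.1.extOp)) ∧
      ¬ (x.1.u.length = x.2.u.length ∧ x.1.v.length = x.2.v.length) := by
  rw [← tableGood_iff hc hl]
  simp only [weakWitness, Bool.and_eq_true, decide_eq_true_eq, Bool.not_eq_true',
    decide_eq_false_iff_not]
  simp only [encPair, encItem, decide_eq_true_eq, Prod.mk.injEq]
  refine and_congr_right fun _ => ?_
  constructor
  · rintro ⟨h1, h2, h3⟩
    exact ⟨Subtype.ext (opTable_injective e h1), h2, fun h => h3 ⟨h1, h⟩⟩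
  · rintro ⟨h1, h2, h3⟩
    exact ⟨congrArg (fun g : A.ops => opTable e g.1) h1, h2, fun h => h3 h.2⟩

/-- Each difference between corresponding lengths of the two contexts is a linear functional. If all
short pairs with the index of (σ,τ) had equal lengths, these functionals would vanish at (σ,τ) as
well. -/
theorem exists_weakWitness (hc : c.Presents N e h) (hl : ListsSet e l F) (f : Bool)
    {σ τ : Context S} (hf : bif f then σ.v = τ.v else σ.u = τ.u) (h1 : 0 < height σ.u)
    (h2 : h.psi σ.extOp = h.psi τ.extOp) (h3 : IsIdempotentElem (h.psi σ.extOp))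
    (h4 : ReachableOp A F (h.psi σ.extOp))
    (h5 : ¬ (σ.u.length = τ.u.length ∧ σ.v.length = τ.v.length)) :
    (itemList c f (itemBound c)).any (weakWitness c l) = true := by
  have : Finite R := Finite.of_equiv _ e
  have hx := (mem_growAll_pairs f σ τ).2 hf
  by_contra hno
  have hno : ∀ y ∈ growSet (pairOps f) (pairGens (S := S) f) (itemBound c),
      pairIndex h y = pairIndex h (σ, τ) →
      y.1.u.length = y.2.u.length ∧ y.1.v.length = y.2.v.length := by
    intro y hy hyσ
    by_contra hne
    refine hno (List.any_eq_true.2 ⟨_, (mem_itemList hc f _ _).2 ⟨y, hy, rfl⟩,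
      (weakWitness_iff hc hl y).2 ?_⟩)
    simp only [pairIndex, Prod.mk.injEq, h1, decide_true, decide_eq_true_eq] at hyσ
    obtain ⟨hy1, hy2, hy3⟩ := hyσ
    have hy2 : h.psi y.1.extOp = h.psi σ.extOp := Subtype.ext hy2
    have hy3 : h.psi y.2.extOp = h.psi τ.extOp := Subtype.ext hy3
    exact ⟨hy1, by rw [hy2, hy3, h2], hy2 ▸ ⟨h3, h4⟩, hne⟩
  have hB := itemBound_ge hc
  have key : ∀ q : (ℚ × ℚ) →ₗ[ℚ] ℚ, q (ctxLen σ) = q (ctxLen τ) := by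
    intro q
    let ℓ : (ℚ × (ℚ × ℚ) × (ℚ × ℚ)) →ₗ[ℚ] ℚ :=
      (q ∘ₗ LinearMap.fst ℚ (ℚ × ℚ) (ℚ × ℚ) - q ∘ₗ LinearMap.snd ℚ (ℚ × ℚ) (ℚ × ℚ)) ∘ₗ
        LinearMap.snd ℚ ℚ _
    have hℓ : ∀ z : Context S × Context S, ℓ (1, pairLen z) = q (ctxLen z.1) - q (ctxLen z.2) := fun z => rfl
    have := functional_eq_zero h f hB ℓ hx fun y hy hyσ => by
      obtain ⟨e1, e2⟩ := hno y hy hyσ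
      rw [hℓ, ctxLen, ctxLen, e1, e2, sub_self]
    rwa [hℓ, sub_eq_zero] at this
  refine h5 ⟨?_, ?_⟩
  · have := key (LinearMap.fst ℚ ℚ ℚ)
    simpa [ctxLen] using this
  · have := key (LinearMap.snd ℚ ℚ ℚ)
    simpa [ctxLen] using this

theorem not_weakFails_iff (hc : c.Presents N e h) (hl : ListsSet e l F) :
    (!weakFails (c, l)) = true ↔ WeaklyLengthSynchronous h F := by
  have sound : ∀ f : Bool, (itemList c f (itemBound c)).any (weakWitness c l) = true →
      ¬ WeaklyLengthSynchronous h F := by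
    intro f hf hs
    obtain ⟨_, hz, hw⟩ := List.any_eq_true.1 hf
    obtain ⟨x, hx, rfl⟩ := (mem_itemList hc f _ _).1 hz
    obtain ⟨h1, h2, ⟨h3, h4⟩, h5⟩ := (weakWitness_iff hc hl x).1 hw
    have hxf := (mem_growAll_pairs f x.1 x.2).1 (mem_growAll.2 ⟨_, hx⟩)
    -- The data record the sign only for the first context. The second has the same height, since
    -- the two share u or v and Δ(v) = -Δ(u).
    have h6 : 0 < height x.2.u := by
      cases f
      · rwa [← show x.1.u = x.2.u from hxf]
      · have e1 := x.1.height_v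
        have e2 := x.2.height_v
        rw [show x.1.v = x.2.v from hxf] at e1
        omega
    have := hs _ h3 h4 x.1 rfl x.2 h2.symm h1 h6
    cases f
    · have hxf : x.1.u = x.2.u := hxf
      exact h5 ⟨congrArg _ hxf, this.1 hxf⟩
    · have hxf : x.1.v = x.2.v := hxf
      exact h5 ⟨this.2 hxf, congrArg _ hxf⟩
  rw [Bool.not_eq_true', weakFails, Bool.or_eq_false_iff, ← Bool.not_eq_true, ← Bool.not_eq_true]
  constructor
  · rintro ⟨hf, ht⟩ g h1 h2 σ rfl τ hτ h3 h4
    refine ⟨fun hu => ?_, fun hv => ?_⟩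
    · by_contra hne
      exact hf (exists_weakWitness hc hl false hu h3 hτ.symm h1 h2 fun h => hne h.2)
    · by_contra hne
      exact ht (exists_weakWitness hc hl true hv h3 hτ.symm h1 h2 fun h => hne h.1)
  · exact fun hs => ⟨fun hf => sound _ hf hs, fun hf => sound _ hf hs⟩

end Synchronous

/-! ### Separating by congruences -/

/-- A subgroup of a finitely generated abelian group that does not contain a torsion class does
not contain it modulo some positive number. -/
theorem exists_torsion_exponent (K : Submodule ℤ (ℤ × ℤ)) :
    ∃ t : ℕ, 0 < t ∧ ∀ x : ℤ × ℤ, ∀ m : ℕ, 0 < m → m • x ∈ K → t • x ∈ K := by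
  classical
  -- The preimage of the torsion subgroup of ℤ²/K. It is finitely generated, so the product of
  -- multipliers that take its generators into K annihilates all torsion.
  let T : Submodule ℤ (ℤ × ℤ) :=
    { carrier := {x | ∃ m : ℕ, 0 < m ∧ m • x ∈ K}
      add_mem' := by
        rintro x y ⟨m, hm, hx⟩ ⟨m', hm', hy⟩
        refine ⟨m * m', Nat.mul_pos hm hm', ?_⟩
        rw [smul_add]
        refine K.add_mem ?_ ?_
        · rw [mul_comm, mul_smul]
          exact K.smul_of_tower_mem m' hx
        · rw [mul_smul]
          exact K.smul_of_tower_mem m hy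
      zero_mem' := ⟨1, one_pos, by simp⟩
      smul_mem' := by
        rintro a x ⟨m, hm, hx⟩
        exact ⟨m, hm, by rw [smul_comm]; exact K.smul_mem a hx⟩ }
  obtain ⟨s, hs⟩ := IsNoetherian.noetherian T
  have hsT : ∀ x ∈ s, ∃ m : ℕ, 0 < m ∧ m • x ∈ K := fun x hx =>
    (hs ▸ Submodule.subset_span hx : x ∈ T)
  choose! m hm using hsT
  refine ⟨∏ x ∈ s, m x, Finset.prod_pos fun x hx => (hm x hx).1, fun x k hk hx => ?_⟩
  have hxT : x ∈ Submodule.span ℤ (s : Set (ℤ × ℤ)) := by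
    rw [hs]
    exact ⟨k, hk, hx⟩
  clear hx
  induction hxT using Submodule.span_induction with
  | mem x hx =>
    obtain ⟨a, ha⟩ := Finset.dvd_prod_of_mem m (Finset.mem_coe.1 hx)
    rw [ha, mul_comm, mul_smul]
    exact K.smul_of_tower_mem a (hm x hx).2
  | zero => simp
  | add x y _ _ hx hy =>
    rw [smul_add]
    exact K.add_mem hx hy
  | smul a x _ hx =>
    rw [smul_comm]
    exact K.smul_mem a hx

/-- Vectors of two sets in a commutative grading by a cyclic group are separated modulo some
positive number if the sets are disjoint. -/
theorem exists_separating_modulus {M : Type} [Monoid M] {D : M → Set (ℕ × ℕ)}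
    (hD : ∀ {g g' v v'}, v ∈ D g → v' ∈ D g' → v + v' ∈ D (g * g')) {g : M} {ω : ℕ} (hω : 0 < ω)
    (hg : g ^ (ω + 1) = g) (hdisj : ∀ v, v ∈ D (g ^ ω) → v ∉ D g) :
    ∃ t : ℕ, 0 < t ∧ ∀ v ∈ D (g ^ ω), ∀ w ∈ D g, ¬ (v.1 ≡ w.1 [MOD t] ∧ v.2 ≡ w.2 [MOD t]) := by
  by_cases hne : ∃ d, d ∈ D g
  swap
  · exact ⟨1, one_pos, fun v _ w hw => absurd ⟨w, hw⟩ hne⟩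
  obtain ⟨d, hd⟩ := hne
  obtain ⟨m, rfl⟩ := Nat.exists_eq_add_of_le' hω
  set e := g ^ (m + 1) with he
  have hge : g * e = g := by rw [he, ← pow_succ', hg]
  have hpow : ∀ k, 0 < k → g ^ k * e = g ^ k := by
    intro k hk
    obtain ⟨k, rfl⟩ := Nat.exists_eq_add_of_le' hk
    rw [pow_succ, mul_assoc, hge]
  have hee : e * e = e := hpow _ m.succ_pos
  -- Adding ω - 1 copies of d turns a vector of g into one of g^ω. Hence D g lies in one coset of
  -- the group generated by D e, and ω • d lies in that group.
  have hadd : ∀ w ∈ D g, w + m • d ∈ D e := by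
    intro w hw
    have : ∀ k : ℕ, w + k • d ∈ D (g ^ (k + 1)) := by
      intro k
      induction k with
      | zero => simpa using hw
      | succ k ih =>
        rw [pow_succ, succ_nsmul, ← add_assoc]
        exact hD ih hd
    exact this m
  let ι : ℕ × ℕ →+ ℤ × ℤ :=
    (Nat.castAddMonoidHom ℤ).prodMap (Nat.castAddMonoidHom ℤ)
  have hι : Function.Injective ι := by
    rintro ⟨a, b⟩ ⟨a', b'⟩ h
    simpa [ι] using h
  let K : Submodule ℤ (ℤ × ℤ) := Submodule.span ℤ (ι '' D e)
  have hK : ∀ v ∈ D e, ι v ∈ K := fun v hv => Submodule.subset_span ⟨v, hv, rfl⟩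
  have hdiff : ∀ w ∈ D g, ι w - ι d ∈ K := by
    intro w hw
    have := K.sub_mem (hK _ (hadd w hw)) (hK _ (hadd d hd))
    simpa using this
  have hmul : ∀ k : ℕ, ∀ v ∈ D e, ∀ w ∈ D e, k • v + w ∈ D e := by
    intro k v hv w hw
    induction k with
    | zero => simpa using hw
    | succ k ih =>
      have := hD hv ih
      rw [hee] at this
      rwa [succ_nsmul', add_assoc]
  -- D e is closed under addition because e is idempotent, so the group it generates consists of
  -- differences.
  have hrep : ∀ x ∈ K, ∃ a ∈ D e, ∃ b ∈ D e, x = ι a - ι b := by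
    intro x hx
    induction hx using Submodule.span_induction with
    | mem x hx =>
      obtain ⟨v, hv, rfl⟩ := hx
      have := hD hv hv
      rw [hee] at this
      exact ⟨_, this, v, hv, by simp⟩
    | zero => exact ⟨_, hadd d hd, _, hadd d hd, by simp⟩
    | add x y _ _ hx hy =>
      obtain ⟨a, ha, b, hb, rfl⟩ := hx
      obtain ⟨a', ha', b', hb', rfl⟩ := hy
      have h1 := hD ha ha'
      have h2 := hD hb hb'
      rw [hee] at h1 h2
      exact ⟨_, h1, _, h2, by simp only [map_add]; abel⟩
    | smul k x _ hx =>
      obtain ⟨a, ha, b, hb, rfl⟩ := hx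
      obtain ⟨k, rfl | rfl⟩ := k.eq_nat_or_neg
      · refine ⟨_, hmul k a ha a ha, _, hmul k b hb a ha, ?_⟩
        simp only [map_add, map_nsmul, natCast_zsmul, smul_sub]
        abel
      · refine ⟨_, hmul k b hb a ha, _, hmul k a ha a ha, ?_⟩
        simp only [map_add, map_nsmul, neg_smul, natCast_zsmul, smul_sub]
        abel
  -- If d = a - b with a and b in D e, then d + b lies in D (g e) = D g and equals a, contradicting
  -- disjointness.
  have hdK : ι d ∉ K := by
    intro h
    obtain ⟨a, ha, b, hb, hab⟩ := hrep _ h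
    have h1 : d + b = a := hι (by rw [map_add, hab]; abel)
    have h2 := hD hd hb
    rw [hge, h1] at h2
    exact hdisj a ha h2
  obtain ⟨t, ht, htK⟩ := exists_torsion_exponent K
  refine ⟨t, ht, fun v hv w hw hvw => hdK ?_⟩
  -- A congruence modulo t puts d - t • u into K. As ω • d is in K, u is torsion modulo K, so t • u
  -- and hence d would be in K.
  obtain ⟨u, hu⟩ : ∃ u : ℤ × ℤ, ι w - ι v = t • u := by
    obtain ⟨a, ha⟩ := (Nat.modEq_iff_dvd.1 hvw.1)
    obtain ⟨b, hb⟩ := (Nat.modEq_iff_dvd.1 hvw.2)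
    exact ⟨(a, b), Prod.ext (by simpa [ι] using ha) (by simpa [ι] using hb)⟩
  have h1 : ι d - t • u ∈ K := by
    have := K.sub_mem (hK v hv) (hdiff w hw)
    rw [← hu]
    convert this using 1
    abel
  have h2 : (m + 1) • ι d ∈ K := by
    have := hK _ (hadd d hd)
    rwa [map_add, map_nsmul, ← succ_nsmul'] at this
  have h3 : t • u ∈ K := by
    refine htK u ((m + 1) * t) (Nat.mul_pos m.succ_pos ht) ?_
    have := K.sub_mem h2 (K.smul_of_tower_mem (m + 1) h1)
    rwa [smul_sub, sub_sub_cancel, ← mul_smul] at this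
  simpa using K.add_mem h1 h3

/-! ### Tables of powers, collisions -/

/-- The table of the `k`-th power of a function with table `t`. -/
def tablePow (n : ℕ) (t : List ℕ) (k : ℕ) : List ℕ :=
  (fun s => tableComp n s t)^[k] (List.range n)

/-- A number `ω` such that `g ^ ω` is idempotent for every function `g` on `n` elements. -/
def opExponent (n : ℕ) : ℕ := (n ^ n).factorial

theorem opExponent_pos (n : ℕ) : 0 < opExponent n := Nat.factorial_pos _

/-- `y` is the table of a group element different from its neutral element, which has the
table `x`, and the two tables come with the same lengths. -/
def collides (n : ℕ) (x y : CtxItem) : Bool :=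
  decide (tablePow n y.1 (opExponent n + 1) = y.1) &&
    (decide (x.1 = tablePow n y.1 (opExponent n)) && (!decide (x.1 = y.1) && decide (x.2 = y.2)))

/-- Some data of the list collide. -/
def hasCollision (n : ℕ) (I : List PairItem) : Bool :=
  I.any fun x => I.any fun y => collides n x.2.1 y.2.1

/-- Reduction of lengths. -/
def reduceCtx (N : ℕ) (x : CtxItem) : CtxItem := (x.1, x.2.1 % N, x.2.2 % N)

/-- Reduction of lengths in pairs. -/
def reduceItem (N : ℕ) (x : PairItem) : PairItem := (x.1, reduceCtx N x.2.1, reduceCtx N x.2.2)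

/-- `I` contains the reductions of all data from `l`. -/
def containsReductions (N : ℕ) (I l : List PairItem) : Bool :=
  l.all fun z => I.any fun x => decide (x = reduceItem N z)

/-- `I` is a collision-free invariant modulo `N`. -/
def isInvariant (c : HomCode) (N : ℕ) (I : List PairItem) : Bool :=
  containsReductions N I (itemGens c false) && ((I.all fun x => I.all fun y =>
    containsReductions N I (itemOps c false x y)) && !hasCollision c.size I)

section Primrec

variable {α : Type} [Primcodable α]

@[fun_prop]
theorem primrec_tablePow {n k : α → ℕ} {t : α → List ℕ} (hn : Primrec n) (ht : Primrec t)
    (hk : Primrec k) : Primrec fun a => tablePow (n a) (t a) (k a) := by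
  unfold tablePow
  fun_prop

@[fun_prop]
theorem primrec_opExponent {n : α → ℕ} (hn : Primrec n) : Primrec fun a => opExponent (n a) := by
  unfold opExponent
  fun_prop

@[fun_prop]
theorem primrec_collides {n : α → ℕ} {x y : α → CtxItem} (hn : Primrec n) (hx : Primrec x)
    (hy : Primrec y) : Primrec fun a => collides (n a) (x a) (y a) := by
  unfold collides
  fun_prop

@[fun_prop]
theorem primrec_hasCollision {n : α → ℕ} {I : α → List PairItem} (hn : Primrec n)
    (hI : Primrec I) : Primrec fun a => hasCollision (n a) (I a) := by
  unfold hasCollision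
  fun_prop

@[fun_prop]
theorem primrec_reduceItem {N : α → ℕ} {x : α → PairItem} (hN : Primrec N) (hx : Primrec x) :
    Primrec fun a => reduceItem (N a) (x a) := by
  unfold reduceItem reduceCtx
  fun_prop

@[fun_prop]
theorem primrec_containsReductions {N : α → ℕ} {I l : α → List PairItem} (hN : Primrec N)
    (hI : Primrec I) (hl : Primrec l) :
    Primrec fun a => containsReductions (N a) (I a) (l a) := by
  unfold containsReductions
  fun_prop

@[fun_prop]
theorem primrec_isInvariant {c : α → HomCode} {N : α → ℕ} {I : α → List PairItem}
    (hc : Primrec c) (hN : Primrec N) (hI : Primrec I) :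
    Primrec fun a => isInvariant (c a) (N a) (I a) := by
  unfold isInvariant
  fun_prop

end Primrec

/-! ### Collision-free invariants as certificates -/

theorem containsReductions_iff {N : ℕ} {I l : List PairItem} :
    containsReductions N I l = true ↔ ∀ z ∈ l, reduceItem N z ∈ I := by
  simp [containsReductions]

theorem isInvariant_iff {c : HomCode} {N : ℕ} {I : List PairItem} :
    isInvariant c N I = true ↔ (∀ z ∈ itemGens c false, reduceItem N z ∈ I) ∧
      (∀ x ∈ I, ∀ y ∈ I, ∀ z ∈ itemOps c false x y, reduceItem N z ∈ I) ∧
      hasCollision c.size I = false := by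
  simp [isInvariant, containsReductions_iff]

theorem hasCollision_iff {n : ℕ} {I : List PairItem} :
    hasCollision n I = true ↔ ∃ x ∈ I, ∃ y ∈ I, collides n x.2.1 y.2.1 = true := by
  simp [hasCollision]

theorem collides_iff {n : ℕ} {x y : CtxItem} :
    collides n x y = true ↔ tablePow n y.1 (opExponent n + 1) = y.1 ∧
      x.1 = tablePow n y.1 (opExponent n) ∧ x.1 ≠ y.1 ∧ x.2 = y.2 := by
  simp only [collides, Bool.and_eq_true, decide_eq_true_eq, Bool.not_eq_true',
    decide_eq_false_iff_not]

/-- The set of all data. -/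
def allItems (c : HomCode) : Set PairItem :=
  growAll (itemOps c false) {z | z ∈ itemGens c false}

theorem mem_itemList_iff_growSet (c : HomCode) (k : ℕ) (z : PairItem) :
    z ∈ itemList c false k ↔ z ∈ growSet (itemOps c false) {z | z ∈ itemGens c false} k := by
  have := mem_growList_iff (E := id) (ops := itemOps c false) (opsJ := itemOps c false)
    (A := {z | z ∈ itemGens c false}) (l := itemGens c false) (by simp) (by simp) k z
  simpa [itemList] using this

/-- Lengths are only ever added, so reduction modulo N is compatible with all operations, and tables
are untouched. The results of operating on reduced data must be reduced again. -/
theorem reduceItem_itemOps (c : HomCode) (N : ℕ) (x y : PairItem) :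
    (itemOps c false (reduceItem N x) (reduceItem N y)).map (reduceItem N) =
      (itemOps c false x y).map (reduceItem N) := by
  simp [itemOps, reduceItem, reduceCtx, itemMul, itemLeft, itemRight]

/-- The data do not collide if there is a collision-free invariant. -/
theorem isInvariant.not_hasCollision {c : HomCode} {N : ℕ} {I : List PairItem}
    (hI : isInvariant c N I = true) (k : ℕ) : hasCollision c.size (itemList c false k) = false := by
  obtain ⟨h1, h2, h3⟩ := isInvariant_iff.1 hI
  have key : ∀ z ∈ allItems c, reduceItem N z ∈ I := by
    intro z hz
    refine growAll_induction (P := fun z => reduceItem N z ∈ I) h1 ?_ hz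
    intro x y z hx hy hz
    have : reduceItem N z ∈ (itemOps c false x y).map (reduceItem N) := List.mem_map_of_mem hz
    rw [← reduceItem_itemOps, List.mem_map] at this
    obtain ⟨z', hz', e⟩ := this
    rw [← e]
    exact h2 _ hx _ hy _ hz'
  rw [← Bool.not_eq_true, hasCollision_iff]
  rintro ⟨x, hx, y, hy, hxy⟩
  rw [← Bool.not_eq_true, hasCollision_iff] at h3
  rw [mem_itemList_iff_growSet] at hx hy
  refine h3 ⟨_, key x (mem_growAll.2 ⟨k, hx⟩), _, key y (mem_growAll.2 ⟨k, hy⟩), ?_⟩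
  obtain ⟨a1, a2, a3, a4⟩ := collides_iff.1 hxy
  -- Reduction keeps the tables and preserves equality of lengths, so a collision would survive
  -- inside the invariant.
  exact collides_iff.2 ⟨a1, a2, a3, by simp [reduceItem, reduceCtx, a4]⟩

theorem tablePow_opTable {R : Type} {n : ℕ} (e : Fin n ≃ R) (g : Function.End R) (k : ℕ) :
    tablePow n (opTable e g) k = opTable e (g ^ k) := by
  induction k with
  | zero =>
    have h := map_range_eq_opTable e (F := fun i => i) (g := 1) fun r => rfl
    rw [pow_zero, ← h, tablePow, Function.iterate_zero, id]
    refine ((List.map_congr_left fun i hi => ?_).trans (List.map_id _)).symm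
    exact Nat.mod_eq_of_lt (List.mem_range.1 hi)
  | succ k ih =>
    rw [tablePow, Function.iterate_succ_apply', ← tablePow, ih, tableComp_opTable, pow_succ]

theorem exists_map_range_eq_opTable (n : ℕ) (F : ℕ → ℕ) :
    ∃ g : Function.End (Fin n), (List.range n).map (fun i => F i % n) = opTable (Equiv.refl _) g :=
  ⟨fun i => ⟨F i % n, Nat.mod_lt _ i.pos⟩, map_range_eq_ofFn _ _⟩

/-- The data whose tables are tables of functions. -/
def functional (n : ℕ) : Set PairItem :=
  {z | (∃ g : Function.End (Fin n), z.2.1.1 = opTable (Equiv.refl _) g) ∧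
    ∃ g : Function.End (Fin n), z.2.2.1 = opTable (Equiv.refl _) g}

/-- No presentation is assumed: the built-in reductions modulo the size make every table that of a
self-map of n points. Thus only finitely many tables occur, for every code. -/
theorem allItems_subset_functional (c : HomCode) : allItems c ⊆ functional c.size := by
  intro z hz
  have hr : ∃ g : Function.End (Fin c.size), List.range c.size = opTable (Equiv.refl _) g := by
    refine ⟨1, ?_⟩
    rw [← pow_zero (1 : Function.End (Fin c.size)), ← tablePow_opTable]
    rfl
  have hl : ∀ r, ∃ g : Function.End (Fin c.size), tableLeft c r = opTable (Equiv.refl _) g :=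
    fun r => exists_map_range_eq_opTable _ _
  have hr' : ∀ r, ∃ g : Function.End (Fin c.size), tableRight c r = opTable (Equiv.refl _) g :=
    fun r => exists_map_range_eq_opTable _ _
  have hp : ∀ a b, ∃ g : Function.End (Fin c.size), tablePair c a b = opTable (Equiv.refl _) g :=
    fun a b => exists_map_range_eq_opTable _ _
  have hm : ∀ s t, ∃ g : Function.End (Fin c.size),
    tableComp c.size s t = opTable (Equiv.refl _) g := fun s t => exists_map_range_eq_opTable _ _
  refine growAll_induction (P := fun z => z ∈ functional c.size) ?_ ?_ hz
  · intro z hz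
    simp only [Set.mem_ofPred_eq, itemGens, List.mem_cons, List.mem_append, List.mem_map,
      List.mem_flatMap] at hz
    rcases hz with rfl | ⟨i, -, rfl⟩ | ⟨x, -, y, -, hz⟩
    · exact ⟨hr, hr⟩
    · exact ⟨hl _, hl _⟩
    · cases hb : (bif false then decide (x.2 = y.2) else decide (x.1 = y.1)) <;>
        simp only [hb, cond_true, cond_false, List.not_mem_nil, List.mem_singleton] at hz
      subst hz
      exact ⟨hp _ _, hp _ _⟩
  · intro x y z _ _ hz
    simp only [itemOps, List.mem_cons, List.not_mem_nil, or_false] at hz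
    rcases hz with rfl | rfl | rfl
    · exact ⟨hm _ _, hm _ _⟩
    · exact ⟨hl _, hl _⟩
    · exact ⟨hr' _, hr' _⟩

theorem finite_reduceItem_functional (n : ℕ) {N : ℕ} (hN : 0 < N) :
    (reduceItem N '' functional n).Finite := by
  have : (reduceItem N '' functional n) ⊆ Set.range
      fun x : Bool × (Function.End (Fin n) × Fin N × Fin N) × Function.End (Fin n) × Fin N × Fin N =>
        (x.1, (opTable (Equiv.refl _) x.2.1.1, (x.2.1.2.1 : ℕ), (x.2.1.2.2 : ℕ)),
          opTable (Equiv.refl _) x.2.2.1, (x.2.2.2.1 : ℕ), (x.2.2.2.2 : ℕ)) := by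
    rintro _ ⟨⟨b, ⟨s, k, l⟩, s', k', l'⟩, ⟨⟨g, rfl⟩, g', rfl⟩, rfl⟩
    exact ⟨(b, (g, ⟨k % N, Nat.mod_lt _ hN⟩, ⟨l % N, Nat.mod_lt _ hN⟩),
      g', ⟨k' % N, Nat.mod_lt _ hN⟩, ⟨l' % N, Nat.mod_lt _ hN⟩), rfl⟩
  have : Finite (Function.End (Fin n)) := inferInstanceAs (Finite (Fin n → Fin n))
  exact (Set.finite_range _).subset ‹_›

/-- If the data do not collide, then there is a collision-free invariant. -/
theorem exists_isInvariant {c : HomCode}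
    (hc : ∀ k, hasCollision c.size (itemList c false k) = false) :
    ∃ N I, isInvariant c N I = true := by
  classical
  set n := c.size with hn
  set ω := opExponent n with hω
  have : Fintype (Function.End (Fin n)) := inferInstanceAs (Fintype (Fin n → Fin n))
  -- The length vectors of data with table g; composing data adds the vectors and multiplies the
  -- maps. Absence of collisions says exactly that D (g ^ ω) and D g are disjoint for the relevant
  -- g.
  let D : Function.End (Fin n) → Set (ℕ × ℕ) := fun g =>
    {v | ∃ z ∈ allItems c, z.2.1 = (opTable (Equiv.refl _) g, v)}
  have hD : ∀ {g g' v v'}, v ∈ D g → v' ∈ D g' → v + v' ∈ D (g * g') := by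
    rintro g g' v v' ⟨z, hz, h⟩ ⟨z', hz', h'⟩
    refine ⟨_, growAll_ops hz hz' (List.mem_cons_self ..), ?_⟩
    simp only [itemMul, h, h', ← hn, tableComp_opTable]
    rfl
  have hdisj : ∀ g : Function.End (Fin n), g ^ (ω + 1) = g → g ^ ω ≠ g →
      ∀ v, v ∈ D (g ^ ω) → v ∉ D g := by
    rintro g hg hg' v ⟨z, hz, h⟩ ⟨z', hz', h'⟩
    obtain ⟨k, hk⟩ := mem_growAll.1 hz
    obtain ⟨k', hk'⟩ := mem_growAll.1 hz'
    have := hc (max k k')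
    rw [← Bool.not_eq_true, hasCollision_iff] at this
    refine this ⟨z, (mem_itemList_iff_growSet _ _ _).2 (growSet_mono (le_max_left _ _) hk),
      z', (mem_itemList_iff_growSet _ _ _).2 (growSet_mono (le_max_right _ _) hk'), ?_⟩
    simp only [collides_iff, h, h', tablePow_opTable, ← hω, hg]
    exact ⟨trivial, trivial, fun h => hg' (opTable_injective _ h), trivial⟩
  have ht : ∀ g : Function.End (Fin n), ∃ t : ℕ, 0 < t ∧ (g ^ (ω + 1) = g → g ^ ω ≠ g →
      ∀ v ∈ D (g ^ ω), ∀ w ∈ D g, ¬ (v.1 ≡ w.1 [MOD t] ∧ v.2 ≡ w.2 [MOD t])) := by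
    intro g
    by_cases hg : g ^ (ω + 1) = g ∧ g ^ ω ≠ g
    · obtain ⟨t, ht, h⟩ := exists_separating_modulus (D := D) (g := g) hD (opExponent_pos n) hg.1
        (hdisj g hg.1 hg.2)
      exact ⟨t, ht, fun _ _ => h⟩
    · exact ⟨1, one_pos, fun h1 h2 => absurd ⟨h1, h2⟩ hg⟩
  choose t ht htD using ht
  -- A common multiple of all moduli separates simultaneously for every g. The invariant is the
  -- finite set of reductions of all data.
  let N := ∏ g, t g
  have hN : 0 < N := Finset.prod_pos fun g _ => ht g
  have hfin : (reduceItem N '' allItems c).Finite := (finite_reduceItem_functional n hN).subset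
    (Set.image_mono (allItems_subset_functional c))
  have hI : ∀ z, z ∈ hfin.toFinset.toList ↔ ∃ x ∈ allItems c, reduceItem N x = z := by simp
  refine ⟨N, hfin.toFinset.toList, isInvariant_iff.2 ⟨fun z hz => ?_, ?_, ?_⟩⟩
  · exact (hI _).2 ⟨z, growAll_base hz, rfl⟩
  · intro x hx y hy z hz
    obtain ⟨x, hx', rfl⟩ := (hI _).1 hx
    obtain ⟨y, hy', rfl⟩ := (hI _).1 hy
    have : reduceItem N z ∈ (itemOps c false _ _).map (reduceItem N) := List.mem_map_of_mem hz
    rw [reduceItem_itemOps, List.mem_map] at this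
    obtain ⟨z', hz', e⟩ := this
    exact (hI _).2 ⟨z', growAll_ops hx' hy' hz', e⟩
  · rw [← Bool.not_eq_true, hasCollision_iff]
    rintro ⟨x, hx, y, hy, hxy⟩
    obtain ⟨x, hx', rfl⟩ := (hI _).1 hx
    obtain ⟨y, hy', rfl⟩ := (hI _).1 hy
    obtain ⟨a1, a2, a3, a4⟩ := collides_iff.1 hxy
    simp only [reduceItem, reduceCtx] at a1 a2 a3 a4
    obtain ⟨⟨g, hg⟩, -⟩ := allItems_subset_functional c hy'
    rw [hg, tablePow_opTable] at a1 a2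
    have a1 := opTable_injective _ a1
    rw [a2, hg] at a3
    have htg : t g ∣ N := Finset.dvd_prod_of_mem t (Finset.mem_univ g)
    simp only [Prod.mk.injEq] at a4
    exact htD g a1 (fun h => a3 (congrArg _ h)) x.2.1.2 ⟨x, hx', Prod.ext a2 rfl⟩ y.2.1.2
      ⟨y, hy', Prod.ext hg rfl⟩ ⟨Nat.ModEq.of_dvd htg a4.1, Nat.ModEq.of_dvd htg a4.2⟩

/-! ### Collisions witness non-aperiodicity -/

section Aperiodicity

variable {S : VPAlphabet} {R : Type} [Monoid R] {A : ExtAlgebra R} (h : ExtHom (wordExt S) A)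

theorem mul_mem_opsImage {k l k' l' : ℕ} {f g : A.ops} (hf : f ∈ opsImage h k l)
    (hg : g ∈ opsImage h k' l') : f * g ∈ opsImage h (k + k') (l + l') := by
  obtain ⟨σ, rfl, rfl, rfl⟩ := hf
  obtain ⟨τ, rfl, rfl, rfl⟩ := hg
  refine ⟨σ.mul τ, by simp [Context.mul], by simp [Context.mul, add_comm], ?_⟩
  rw [Context.extOp_mul, map_mul]

theorem pow_mem_opsImage {k l : ℕ} {g : A.ops} (hg : g ∈ opsImage h k l) (i : ℕ) :
    g ^ i ∈ opsImage h (i * k) (i * l) := by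
  induction i with
  | zero =>
    rw [zero_mul, zero_mul, pow_zero]
    refine ⟨.ofLeft 1, rfl, rfl, ?_⟩
    rw [Context.extOp_ofLeft, h.psi_left, map_one]
    exact Subtype.ext (funext fun x => one_mul x)
  | succ i ih =>
    rw [add_mul, add_mul, one_mul, one_mul, pow_succ]
    exact mul_mem_opsImage h ih hg

/-- A group element `g` and its neutral element that are induced by contexts of the same lengths
generate a group of operations induced by contexts of some fixed lengths. -/
theorem not_aperiodicSet_opsImage {k l ω : ℕ} {g : A.ops} (hω : 0 < ω) (hg : g ^ (ω + 1) = g)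
    (hne : g ^ ω ≠ g) (h1 : g ^ ω ∈ opsImage h k l) (h2 : g ∈ opsImage h k l) :
    ¬ AperiodicSet (opsImage h (ω * k) (ω * l)) := by
  have hper : ∀ i, 0 < i → g ^ ω * g ^ i = g ^ i := by
    intro i hi
    obtain ⟨i, rfl⟩ := Nat.exists_eq_add_of_le' hi
    rw [pow_succ', ← mul_assoc, ← pow_succ, hg]
  have hidem : ∀ i, (g ^ ω) ^ (i + 1) = g ^ ω := by
    intro i
    induction i with
    | zero => simp
    | succ i ih => rw [pow_succ', ih, hper ω hω]
  let H : Subsemigroup A.ops :=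
    { carrier := {x | ∃ i, 0 < i ∧ x = g ^ i}
      mul_mem' := by
        rintro _ _ ⟨i, hi, rfl⟩ ⟨j, hj, rfl⟩
        exact ⟨i + j, by omega, (pow_add g i j).symm⟩ }
  have hHg : g ∈ H := ⟨1, one_pos, (pow_one g).symm⟩
  have hHe : g ^ ω ∈ H := ⟨ω, hω, rfl⟩
  have hsub : (H : Set A.ops) ⊆ opsImage h (ω * k) (ω * l) := by
    rintro _ ⟨i, hi, rfl⟩
    have hlt := Nat.mod_lt i hω
    -- With r = i mod ω, the power g^i is a product of ω - r copies of the neutral element and r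
    -- copies of g. There are always ω factors, each of lengths (k,l), so all powers share the
    -- lengths (ωk, ωl).
    have h3 := mul_mem_opsImage h (pow_mem_opsImage h h1 (ω - i % ω))
      (pow_mem_opsImage h h2 (i % ω))
    rw [← add_mul, ← add_mul, Nat.sub_add_cancel hlt.le] at h3
    have h4 : (g ^ ω) ^ (ω - i % ω) * g ^ (i % ω) = g ^ i := by
      obtain ⟨m, hm⟩ := Nat.exists_eq_add_of_le' (Nat.sub_pos_of_lt hlt)
      rw [hm, hidem, ← hidem (i / ω), ← pow_mul, ← pow_add, mul_add, mul_one, add_comm (ω * _),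
        add_assoc, Nat.div_add_mod, pow_add, hper i hi]
    rwa [h4] at h3
  refine fun hA => hA H hsub ⟨H, subset_rfl, ⟨_, hHe, _, hHg, hne⟩, _, hHe, ?_⟩
  rintro _ ⟨i, hi, rfl⟩
  -- The exponents add up to ω(i + 1). The extra ω keeps the exponent of the inverse positive when ω
  -- = 1.
  have h5 : g ^ i * g ^ ((ω - 1) * i + ω) = g ^ ω := by
    rw [← pow_add, ← add_assoc, add_comm i, ← Nat.succ_mul, Nat.succ_eq_add_one,
      Nat.sub_add_cancel hω, ← Nat.mul_succ, pow_mul, hidem]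
  exact ⟨hper i hi, by rw [(Commute.pow_pow_self g i ω).eq, hper i hi], _,
    ⟨(ω - 1) * i + ω, by omega, rfl⟩, h5, by rw [(Commute.pow_pow_self g _ i).eq, h5]⟩

/-- A non-trivial group of operations contains an element whose `ω`-power is neutral. -/
theorem exists_pow_opExponent {n : ℕ} (e : Fin n ≃ R) {X : Set A.ops} (hX : ¬ AperiodicSet X) :
    ∃ g ∈ X, g ^ opExponent n ∈ X ∧ g ^ opExponent n ≠ g ∧ g ^ (opExponent n + 1) = g := by
  classical
  simp only [AperiodicSet, not_forall, not_not] at hX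
  obtain ⟨N, hN, H, hH, hnt, u, hu, hgrp⟩ := hX
  obtain ⟨g, hg, hgu⟩ := hnt.exists_ne u
  have hpow : ∀ i, g ^ (i + 1) ∈ H := by
    intro i
    induction i with
    | zero => simpa using hg
    | succ i ih =>
      rw [pow_succ]
      exact H.mul_mem ih hg
  have : Fintype R := Fintype.ofEquiv _ e
  -- Among n^n + 1 positive powers two coincide as maps on R. Cancelling in the group gives an
  -- exponent at most n^n with value u, and this exponent divides the factorial of n^n.
  obtain ⟨i, j, hij, heq⟩ : ∃ i j : ℕ, i < j ∧ j ≤ n ^ n ∧ g ^ (i + 1) = g ^ (j + 1) := by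
    have hcard : Fintype.card (R → R) < Fintype.card (Fin (n ^ n + 1)) := by
      rw [Fintype.card_fun, Fintype.card_fin, ← Fintype.card_congr e, Fintype.card_fin]
      exact Nat.lt_succ_self _
    obtain ⟨i, j, hne, hf⟩ := Fintype.exists_ne_map_eq_of_card_lt
      (β := R → R) (fun i : Fin (n ^ n + 1) => (g ^ (i.1 + 1)).1) hcard
    have hf : g ^ (i.1 + 1) = g ^ (j.1 + 1) := Subtype.ext hf
    rcases lt_or_gt_of_ne hne with hlt | hlt
    · exact ⟨i, j, hlt, by omega, hf⟩
    · exact ⟨j, i, hlt, by omega, hf.symm⟩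
  obtain ⟨hjn, heq⟩ := heq
  obtain ⟨d, rfl⟩ := Nat.exists_eq_add_of_lt hij
  have hd : g ^ (d + 1) = u := by
    obtain ⟨-, -, y, hy, -, hyu⟩ := hgrp _ (hpow i)
    have h1 : y * (g ^ (i + 1) * g ^ (d + 1)) = u := by
      rw [← pow_add, show i + 1 + (d + 1) = i + d + 1 + 1 by omega, ← heq, hyu]
    rwa [← mul_assoc, hyu, (hgrp _ (hpow d)).1] at h1
  have hω : g ^ opExponent n = u := by
    obtain ⟨m, hm⟩ : d + 1 ∣ opExponent n := Nat.dvd_factorial d.succ_pos (by omega)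
    obtain ⟨m, rfl⟩ : ∃ m', m = m' + 1 := Nat.exists_eq_add_of_le' (Nat.pos_of_ne_zero (by
      rintro rfl
      exact (opExponent_pos n).ne' hm))
    rw [hm, pow_mul, hd]
    clear hm
    induction m with
    | zero => simp
    | succ m ih => rw [pow_succ, ih, (hgrp _ hu).1]
  refine ⟨g, hN (hH hg), hω ▸ hN (hH hu), hω ▸ hgu.symm, ?_⟩
  rw [pow_succ, hω, (hgrp _ hg).1]

end Aperiodicity

/-! ### Collisions in the data of a presented morphism -/

section Presented

variable {S : VPAlphabet} {R : Type} [Monoid R] {A : ExtAlgebra R} {h : ExtHom (wordExt S) A}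
  {N : LetterNumbering S} {n : ℕ} {e : Fin n ≃ R} {c : HomCode}

theorem collides_encItem (e : Fin n ≃ R) (σ τ : Context S) :
    collides n (encItem e h σ) (encItem e h τ) = true ↔
      h.psi τ.extOp ^ (opExponent n + 1) = h.psi τ.extOp ∧
      h.psi σ.extOp = h.psi τ.extOp ^ opExponent n ∧ h.psi σ.extOp ≠ h.psi τ.extOp ∧
      σ.u.length = τ.u.length ∧ σ.v.length = τ.v.length := by
  have key : ∀ f g : A.ops, opTable e f.1 = opTable e g.1 ↔ f = g := fun f g =>
    ⟨fun h => Subtype.ext (opTable_injective e h), fun h => h ▸ rfl⟩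
  have hpow : ∀ (g : A.ops) k, tablePow n (opTable e g.1) k = opTable e (g ^ k).1 := fun g k => by
    rw [tablePow_opTable]
    rfl
  simp only [collides_iff, encItem, ctxOp, hpow, key, ne_eq, Prod.mk.injEq]

/-- Colliding data yield lengths for which the operations are not aperiodic. -/
theorem not_aperiodicSet_of_collides (hc : c.Presents N e h) {k : ℕ} {x y : PairItem}
    (hx : x ∈ itemList c false k) (hy : y ∈ itemList c false k)
    (hxy : collides c.size x.2.1 y.2.1 = true) :
    ¬ AperiodicSet (opsImage h (opExponent c.size * y.2.1.2.1)
      (opExponent c.size * y.2.1.2.2)) := by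
  obtain ⟨⟨σ, σ'⟩, -, rfl⟩ := (mem_itemList hc _ _ _).1 hx
  obtain ⟨⟨τ, τ'⟩, -, rfl⟩ := (mem_itemList hc _ _ _).1 hy
  rw [hc.size] at hxy ⊢
  obtain ⟨h1, h2, h3, h4, h5⟩ := (collides_encItem e σ τ).1 hxy
  rw [h2] at h3
  exact not_aperiodicSet_opsImage h (opExponent_pos n) h1 h3 ⟨σ, h4, h5, h2⟩ ⟨τ, rfl, rfl, rfl⟩

/-- A nontrivial group inside the operations of lengths (k,l) supplies an element and its neutral
element with common lengths; both come from contexts generated after finitely many steps. -/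
theorem exists_hasCollision (hc : c.Presents N e h) (hq : ¬ QuasiAperiodic h) :
    ∃ k, hasCollision c.size (itemList c false k) = true := by
  simp only [QuasiAperiodic, not_forall] at hq
  obtain ⟨k, l, hkl⟩ := hq
  obtain ⟨g, ⟨τ, h1, h2, rfl⟩, ⟨σ, h3, h4, h5⟩, h6, h7⟩ := exists_pow_opExponent e hkl
  obtain ⟨i, hi⟩ := mem_growAll.1 ((mem_growAll_pairs false σ σ).2 rfl)
  obtain ⟨j, hj⟩ := mem_growAll.1 ((mem_growAll_pairs false τ τ).2 rfl)
  refine ⟨max i j, hasCollision_iff.2 ⟨_, (mem_itemList hc _ _ _).2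
    ⟨_, growSet_mono (le_max_left i j) hi, rfl⟩, _, (mem_itemList hc _ _ _).2
    ⟨_, growSet_mono (le_max_right i j) hj, rfl⟩, ?_⟩⟩
  rw [hc.size]
  exact (collides_encItem e σ τ).2 ⟨h7, h5, h5 ▸ h6, h3.trans h1.symm, h4.trans h2.symm⟩

end Presented

/-- One can compute a number of steps after which collisions must have shown up. -/
theorem exists_computable_collisionBound : ∃ f : HomCode → ℕ, Computable f ∧
    ∀ c k, hasCollision c.size (itemList c false k) = true →
      hasCollision c.size (itemList c false (f c)) = true := by
  obtain ⟨f, hf, h⟩ := exists_computable_choice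
    (r := fun (c : HomCode) (x : ℕ × ℕ × List PairItem) =>
      hasCollision c.size (itemList c false x.1) || isInvariant c x.2.1 x.2.2)
    -- Totality is needed for every code, including those that present nothing. Either a collision
    -- appears at some stage or a certificate modulo some N exists.
    (Primrec.to_comp (by fun_prop)) (fun c => by
      by_cases hc : ∃ k, hasCollision c.size (itemList c false k) = true
      · obtain ⟨k, hk⟩ := hc
        exact ⟨(k, 0, []), by simp [hk]⟩
      · simp only [not_exists, Bool.not_eq_true] at hc
        obtain ⟨N, I, hI⟩ := exists_isInvariant hc
        exact ⟨(0, N, I), by simp [hI]⟩)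
  refine ⟨fun c => (f c).1, Computable.fst.comp hf, fun c k hk => ?_⟩
  have := h c
  rw [Bool.or_eq_true] at this
  -- A certificate excludes collisions at all stages, so if one occurs at stage k, the search must
  -- have stopped at a stage with a collision.
  refine this.resolve_right fun hI => ?_
  rw [isInvariant.not_hasCollision hI k] at hk
  exact absurd hk (by simp)

/-- `x` is a colliding pair of entries of `l`. -/
def isCollision (n : ℕ) (l : List PairItem) (x : PairItem × PairItem) : Bool :=
  (l.any fun z => decide (z = x.1)) && ((l.any fun z => decide (z = x.2)) &&
    collides n x.1.2.1 x.2.2.1)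

@[fun_prop]
theorem primrec_isCollision {α : Type} [Primcodable α] {n : α → ℕ} {l : α → List PairItem}
    {x : α → PairItem × PairItem} (hn : Primrec n) (hl : Primrec l) (hx : Primrec x) :
    Primrec fun a => isCollision (n a) (l a) (x a) := by
  unfold isCollision
  fun_prop

/-- One can compute a collision if there is one. -/
theorem exists_computable_collision : ∃ w : HomCode × ℕ → PairItem × PairItem, Computable w ∧
    ∀ c k, hasCollision c.size (itemList c false k) = true →
      (w (c, k)).1 ∈ itemList c false k ∧ (w (c, k)).2 ∈ itemList c false k ∧
      collides c.size (w (c, k)).1.2.1 (w (c, k)).2.2.1 = true := by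
  obtain ⟨w, hw, h⟩ := exists_computable_choice
    (r := fun (p : HomCode × ℕ) (x : PairItem × PairItem) =>
      !hasCollision p.1.size (itemList p.1 false p.2) ||
        isCollision p.1.size (itemList p.1 false p.2) x)
    (Primrec.to_comp (by fun_prop)) (fun p => by
      by_cases hp : hasCollision p.1.size (itemList p.1 false p.2) = true
      · obtain ⟨x, hx, y, hy, hxy⟩ := hasCollision_iff.1 hp
        exact ⟨(x, y), by simp [isCollision, hx, hy, hxy]⟩
      -- Without a collision any value is accepted, which keeps the search total.
      · exact ⟨default, by simp [hp]⟩)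
  refine ⟨w, hw, fun c k hk => ?_⟩
  simpa [hk, isCollision] using h (c, k)

end VisiblyPushdown

/-! ### The computability and decidability results -/

theorem mainTheorem9 :
    -- 1. From a DVPA, compute its syntactic Ext-algebra, syntactic morphism and `φ_L(L)`.
    (∃ f : DVPACode → HomCode × List ℕ, Computable f ∧
      ∀ (c : DVPACode) (S : VPAlphabet) (N : LetterNumbering S) (Q G : Type) (p q : ℕ)
        (eQ : Fin p ≃ Q) (eG : Fin q ≃ G) (M : DVPA S Q G), c.Presents N eQ eG M →
        ∃ (n : ℕ) (e : Fin n ≃ SyntacticMonoid M.language),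
          (f c).1.Presents N e (syntacticHom M.language) ∧
          ListsSet e (f c).2 (syntacticImage M.language)) ∧
    -- 2(a). Quasi-aperiodicity is decidable.
    (∃ d : HomCode → Bool, Computable d ∧
      ∀ (c : HomCode) (S : VPAlphabet) (N : LetterNumbering S) (R : Type) [Monoid R] (n : ℕ)
        (e : Fin n ≃ R) (A : ExtAlgebra R) (h : ExtHom (wordExt S) A), c.Presents N e h →
        (d c = true ↔ QuasiAperiodic h)) ∧
    -- If it fails, a pair witnessing the failure is computable.
    (∃ w : HomCode → ℕ × ℕ, Computable w ∧
      ∀ (c : HomCode) (S : VPAlphabet) (N : LetterNumbering S) (R : Type) [Monoid R] (n : ℕ)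
        (e : Fin n ≃ R) (A : ExtAlgebra R) (h : ExtHom (wordExt S) A), c.Presents N e h →
        ¬ QuasiAperiodic h → ¬ AperiodicSet (opsImage h (w c).1 (w c).2)) ∧
    -- 2(b). `F`-length-synchronicity is decidable.
    (∃ d : HomCode × List ℕ → Bool, Computable d ∧
      ∀ (c : HomCode) (l : List ℕ) (S : VPAlphabet) (N : LetterNumbering S) (R : Type) [Monoid R]
        (n : ℕ) (e : Fin n ≃ R) (A : ExtAlgebra R) (h : ExtHom (wordExt S) A) (F : Set R),
        c.Presents N e h → ListsSet e l F →
        (d (c, l) = true ↔ LengthSynchronous h F)) ∧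
    -- If it fails, a quadruple witnessing the failure is computable.
    (∃ w : HomCode × List ℕ → ℕ × ℕ × ℕ × ℕ, Computable w ∧
      ∀ (c : HomCode) (l : List ℕ) (S : VPAlphabet) (N : LetterNumbering S) (R : Type) [Monoid R]
        (n : ℕ) (e : Fin n ≃ R) (A : ExtAlgebra R) (h : ExtHom (wordExt S) A) (F : Set R),
        c.Presents N e h → ListsSet e l F →
        ¬ LengthSynchronous h F →
          LengthWitness h F (w (c, l)).1 (w (c, l)).2.1 (w (c, l)).2.2.1 (w (c, l)).2.2.2) ∧
    -- 2(c). `F`-weak-length-synchronicity is decidable.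
    (∃ d : HomCode × List ℕ → Bool, Computable d ∧
      ∀ (c : HomCode) (l : List ℕ) (S : VPAlphabet) (N : LetterNumbering S) (R : Type) [Monoid R]
        (n : ℕ) (e : Fin n ≃ R) (A : ExtAlgebra R) (h : ExtHom (wordExt S) A) (F : Set R),
        c.Presents N e h → ListsSet e l F →
        (d (c, l) = true ↔ WeaklyLengthSynchronous h F)) := by
  refine ⟨?_, ?_, ?_, ?_, ?_, ?_⟩
  · exact ⟨fun c => (syntacticCode c, syntacticImageCode c),
      (primrec_syntacticCode.pair primrec_syntacticImageCode).to_comp,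
      fun c S N Q G p q eQ eG M hc => syntacticCode_presents hc⟩
  · obtain ⟨f, hf, hb⟩ := exists_computable_collisionBound
    have hd : Primrec₂ fun (c : HomCode) (k : ℕ) => !hasCollision c.size (itemList c false k) :=
      show Primrec _ by fun_prop
    refine ⟨fun c => !hasCollision c.size (itemList c false (f c)),
      hd.to_comp.comp Computable.id hf, fun c S N R _ n e A h hc => ?_⟩
    rw [Bool.not_eq_true', ← Bool.not_eq_true]
    constructor
    · intro hn
      by_contra hq
      obtain ⟨k, hk⟩ := exists_hasCollision hc hq
      exact hn (hb c k hk)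
    · intro hq hn
      obtain ⟨x, hx, y, hy, hxy⟩ := hasCollision_iff.1 hn
      exact not_aperiodicSet_of_collides hc hx hy hxy (hq _ _)
  · obtain ⟨f, hf, hb⟩ := exists_computable_collisionBound
    obtain ⟨w, hw, hwc⟩ := exists_computable_collision
    -- The lengths of the colliding contexts are multiplied by ω, since the whole cyclic group has
    -- to be realised with common lengths.
    have ho : Primrec₂ fun (c : HomCode) (y : PairItem × PairItem) =>
        (opExponent c.size * y.2.2.1.2.1, opExponent c.size * y.2.2.1.2.2) :=
      show Primrec _ by fun_prop
    refine ⟨_, ho.to_comp.comp Computable.id (hw.comp (Computable.id.pair hf)),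
      fun c S N R _ n e A h hc hq => ?_⟩
    obtain ⟨k, hk⟩ := exists_hasCollision hc hq
    obtain ⟨h1, h2, h3⟩ := hwc c (f c) (hb c k hk)
    exact not_aperiodicSet_of_collides hc h1 h2 h3
  · exact ⟨fun p => !syncFails p, (Primrec.not.comp primrec_syncFails).to_comp,
      fun c l S N R _ n e A h F hc hl => not_syncFails_iff hc hl⟩
  · obtain ⟨w, hw, hwc⟩ := exists_computable_choice
      (r := fun (p : HomCode × List ℕ) (k : ℕ × ℕ × ℕ × ℕ) => !syncFails p || syncFailsAt p k)
      (Primrec.or.comp (Primrec.not.comp (primrec_syncFails.comp Primrec.fst))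
        primrec_syncFailsAt).to_comp (fun p => by
        by_cases hp : syncFails p = true
        · obtain ⟨k, hk⟩ := (syncFails_iff p).1 hp
          exact ⟨k, by simp [hk]⟩
        · exact ⟨default, by simp [hp]⟩)
    refine ⟨w, hw, fun c l S N R _ n e A h F hc hl hs => ?_⟩
    have hk := hwc (c, l)
    rw [Bool.or_eq_true, not_syncFails_iff hc hl] at hk
    exact lengthWitness_of_syncFailsAt hc hl (hk.resolve_left hs)
  · exact ⟨fun p => !weakFails p, (Primrec.not.comp primrec_weakFails).to_comp,
      fun c l S N R _ n e A h F hc hl => not_weakFails_iff hc hl⟩
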